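/- **Setting.** A diffeological quasifold of dimension $n$ is a diffeological space $X$ whose D-topology is second-countable and which is covered by quasifold charts: diffeological diffeomorphisms $F:U\to V/\Gamma$, where $U\subseteq X$ is D-open, $\Gamma$ is a countable subgroup of $\operatorname{Aff}(\mathbb R^n)$, $V\subseteq\mathbb R^n$ is open and $\Gamma$-invariant, $U$ has the subset diffeology and $V/\Gamma$ the quotient diffeology. Let $X$ be a diffeological quasifold of dimension $n$ and let $\mathcal A=\{F_i:U_i\to V_i/\Gamma_i\}$ be a countable atlas of quasifold charts covering $X$. Put $N:=\bigsqcup_i V_i$ and let $\operatorname{pr}_X:N\to X$ be given on $V_i$ by $V_i\to V_i/\Gamma_i\xrightarrow{F_i^{-1}}U_i\subseteq X$. Let $\Psi$ be the associated pseudogroup: all diffeomorphisms $\psi$ between open subsets of $N$ with $\operatorname{pr}_X\circ\psi=\operatorname{pr}_X$ on $\operatorname{dom}\psi$. For a sequence $\psi_1,\psi_2,\dots$ generating $\Psi$ (that is, $\Psi$ is the smallest pseudogroup containing all $\psi_i$) let $$W:=(N\times\mathbb R\times(0,1))\cup\bigcup_{i\ge1}\bigl(\operatorname{dom}\psi_i\times(i,i+1)\times(0,3)\bigr)\subseteq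 N\times\mathbb R\times\mathbb R,$$ and let $M:=W/{\sim}$ with quotient map $\pi:W\to M$, where $\sim$ is the equivalence relation generated by $(x,s,t)\sim(\psi_i(x),s,t-2)$ for $x\in\operatorname{dom}\psi_i$, $s\in(i,i+1)$, $t\in(2,3)$. A foliation $\mathcal F$ of a manifold $M$ is *Riemannian* if $M$ has a Riemannian metric $g$ such that, for any two vector fields $X,Y$ on an open subset of $M$ that are foliate (their brackets with all vector fields tangent to $\mathcal F$ are tangent to $\mathcal F$) and perpendicular to the leaves, the function $g(X,Y)$ is basic (its derivative along every vector field tangent to $\mathcal F$ is $0$). **Statement.** Suppose that each $V_i$ carries a Riemannian metric for which $\Gamma_i$ acts by isometries, and that every element of $\Psi$ is a local isometry of the resulting metric on $N=\bigsqcup_iV_i$. Then $\Psi$ is generated by some sequence of its elements, and for every generating sequence $\psi_1,\psi_2,\dots$ of $\Psi$ the quotient $M$ above, with the quotient topology, is a Hausdorff second-countable space with a smooth manifold structure for which $\pi$ is a smooth submersion; $M$ carries the foliation $\mathcal F$ of dimension $2$ and codimension $n$ whose tangent spaces are the images under $d\pi$ of the tangent spaces to the fibres of the first projection $W\to N$;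 the map $M/\mathcal F\to X$ sending the leaf through $\pi(x,s,t)$ to $\operatorname{pr}_X(x)$ is a well-defined diffeomorphism of diffeological spaces; and the foliation $\mathcal F$ is Riemannian. -/

import Mathlib

open Set Topology Manifold ContDiff Diffeology TopologicalSpace

noncomputable section

namespace Quasifold

/-! ### Diffeology: subsets, quotients, manifolds

Mathlib's diffeological spaces record the plots whose domain is a whole `ℝᵏ`; these determine
the plots on arbitrary open subsets of `ℝᵏ`. -/

/-- The subset diffeology: the plots of `X` with values in the subset. -/
instance subsetDiffeology {X : Type*} [DiffeologicalSpace X] (P : X → Prop) :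
    DiffeologicalSpace (Subtype P) where
  plots k := {p | IsPlot (fun r => (p r : X))}
  constant_plots x := isPlot_const
  plot_reparam hp hf := isPlot_reparam hp hf
  locality {k p} hp := by
    refine DiffeologicalSpace.locality (X := X) fun x => ?_
    obtain ⟨u, hu, hxu, h⟩ := hp x
    exact ⟨u, hu, hxu, fun hf hfs => h hf hfs⟩

theorem exists_contDiff_eventuallyEq {k m : ℕ} {v : Set (EuclideanSpace ℝ (Fin m))}
    (hv : IsOpen v) {f : EuclideanSpace ℝ (Fin m) → EuclideanSpace ℝ (Fin k)}
    (hf : ContDiffOn ℝ ∞ f v) {x : EuclideanSpace ℝ (Fin m)} (hx : x ∈ v) :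
    ∃ f' : EuclideanSpace ℝ (Fin m) → EuclideanSpace ℝ (Fin k),
      ContDiff ℝ ∞ f' ∧ ∀ᶠ y in 𝓝 x, f' y = f y := by
  obtain ⟨ε, hε, hεv⟩ := Metric.isOpen_iff.1 hv x hx
  let χ : ContDiffBump x := ⟨ε / 4, ε / 2, by linarith, by linarith⟩
  have hχ : tsupport χ ⊆ v := by
    rw [χ.tsupport_eq]
    exact (Metric.closedBall_subset_ball (show ε / 2 < ε by linarith)).trans hεv
  refine ⟨fun y => χ y • f y, contDiff_iff_contDiffAt.2 fun y => ?_, ?_⟩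
  · by_cases hy : y ∈ tsupport χ
    · exact χ.contDiff.contDiffAt.smul (hf.contDiffAt (hv.mem_nhds (hχ hy)))
    · have h0 : (fun z => χ z • f z) =ᶠ[𝓝 y] fun _ => 0 := by
        filter_upwards [(isClosed_tsupport χ).isOpen_compl.mem_nhds hy] with z hz
        have : χ z = 0 := image_eq_zero_of_notMem_tsupport hz
        simp [this]
      exact contDiffAt_const.congr_of_eventuallyEq h0
  · filter_upwards [χ.eventuallyEq_one] with y hy
    simp [hy]

/-- The quotient diffeology along a surjection `π : Y → Q`: the plots are the maps that locally
lift along `π` to plots of `Y`. -/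
@[reducible]
def quotientDiffeology {Y Q : Type*} [DiffeologicalSpace Y] (π : Y → Q)
    (hπ : Function.Surjective π) : DiffeologicalSpace Q :=
  .ofCorePlotsOn {
    isPlotOn := fun {k u} _ p => ∀ r ∈ u, ∃ q : EuclideanSpace ℝ (Fin k) → Y,
      IsPlot q ∧ ∀ᶠ y in 𝓝 r, π (q y) = p y
    isPlotOn_congr := by
      intro k u hu p p' h
      have key : ∀ {p p' : EuclideanSpace ℝ (Fin k) → Q}, EqOn p p' u →
          (∀ r ∈ u, ∃ q : EuclideanSpace ℝ (Fin k) → Y,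
            IsPlot q ∧ ∀ᶠ y in 𝓝 r, π (q y) = p y) →
          ∀ r ∈ u, ∃ q : EuclideanSpace ℝ (Fin k) → Y,
            IsPlot q ∧ ∀ᶠ y in 𝓝 r, π (q y) = p' y := by
        intro p p' h H r hr
        obtain ⟨q, hq, e⟩ := H r hr
        refine ⟨q, hq, ?_⟩
        filter_upwards [e, hu.mem_nhds hr] with y hy hyu
        rw [hy, h hyu]
      exact ⟨key h, key h.symm⟩
    isPlot_const := by
      intro k x r _
      obtain ⟨y, rfl⟩ := hπ x
      exact ⟨fun _ => y, isPlot_const, Filter.Eventually.of_forall fun _ => rfl⟩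
    isPlotOn_reparam := by
      intro k m u v hu hv p f h hp hf r hr
      obtain ⟨q, hq, e⟩ := hp (f r) (h hr)
      obtain ⟨f', hf', e'⟩ := exists_contDiff_eventuallyEq hv hf hr
      refine ⟨q ∘ f', isPlot_reparam hq hf', ?_⟩
      have hc : ContinuousAt f r := (hf.continuousOn).continuousAt (hv.mem_nhds hr)
      filter_upwards [e', hc.eventually e] with y hy hy'
      simp only [Function.comp_apply, hy, hy']
    locality := by
      intro k u hu p hp r hr
      obtain ⟨v, hv, hrv, h⟩ := hp r hr
      exact h r hrv }

/-- The diffeology of a manifold: the plots are the smooth maps `ℝᵏ → M`. -/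
@[reducible]
def manifoldDiffeology {E H : Type*} [NormedAddCommGroup E] [NormedSpace ℝ E]
    [TopologicalSpace H] (I : ModelWithCorners ℝ E H) (M : Type*) [TopologicalSpace M]
    [ChartedSpace H M] : DiffeologicalSpace M :=
  .ofCorePlotsOn {
    isPlotOn := fun {k u} _ p => ContMDiffOn 𝓘(ℝ, EuclideanSpace ℝ (Fin k)) I ∞ p u
    isPlotOn_congr := fun _ _ _ h =>
      ⟨fun hp => hp.congr fun _ hx => (h hx).symm, fun hp => hp.congr fun _ hx => h hx⟩
    isPlot_const := fun _ => contMDiff_const.contMDiffOn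
    isPlotOn_reparam := fun _ _ _ h hp hf => hp.comp hf.contMDiffOn h
    locality := fun _ _ h x hx => by
      obtain ⟨v, hv, hxv, hp⟩ := h x hx
      exact ((hp x hxv).contMDiffAt (hv.mem_nhds hxv)).contMDiffWithinAt }

/-! ### Diffeological quasifolds -/

/-- The orbit relation on an open set `V ⊆ ℝⁿ` of a group `Γ` of affine transformations. -/
def orbitSetoid {n : ℕ}
    (Γ : Subgroup (EuclideanSpace ℝ (Fin n) ≃ᵃ[ℝ] EuclideanSpace ℝ (Fin n)))
    (V : Opens (EuclideanSpace ℝ (Fin n))) : Setoid V where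
  r x y := ∃ γ ∈ Γ, γ (x : EuclideanSpace ℝ (Fin n)) = y
  iseqv :=
    { refl := fun _ => ⟨1, Γ.one_mem, rfl⟩
      symm := by
        rintro x y ⟨γ, hγ, h⟩
        exact ⟨γ⁻¹, Γ.inv_mem hγ, by rw [← h]; exact γ.symm_apply_apply _⟩
      trans := by
        rintro x y z ⟨γ, hγ, h⟩ ⟨δ, hδ, h'⟩
        exact ⟨δ * γ, Γ.mul_mem hδ hγ, by rw [← h', ← h]; rfl⟩ }

/-- The quotient `V/Γ`. -/
def OrbitSpace {n : ℕ}
    (Γ : Subgroup (EuclideanSpace ℝ (Fin n) ≃ᵃ[ℝ] EuclideanSpace ℝ (Fin n)))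
    (V : Opens (EuclideanSpace ℝ (Fin n))) : Type :=
  Quotient (orbitSetoid Γ V)

/-- The quotient map `V → V/Γ`. -/
def OrbitSpace.mk {n : ℕ}
    {Γ : Subgroup (EuclideanSpace ℝ (Fin n) ≃ᵃ[ℝ] EuclideanSpace ℝ (Fin n))}
    {V : Opens (EuclideanSpace ℝ (Fin n))} (x : V) : OrbitSpace Γ V :=
  Quotient.mk (orbitSetoid Γ V) x

/-- `V/Γ` with the quotient diffeology of the subset diffeology of `V ⊆ ℝⁿ`. -/
instance {n : ℕ} (Γ : Subgroup (EuclideanSpace ℝ (Fin n) ≃ᵃ[ℝ] EuclideanSpace ℝ (Fin n)))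
    (V : Opens (EuclideanSpace ℝ (Fin n))) : DiffeologicalSpace (OrbitSpace Γ V) :=
  quotientDiffeology (Y := {x : EuclideanSpace ℝ (Fin n) // x ∈ V}) OrbitSpace.mk
    Quotient.mk_surjective

/-- A quasifold chart `F : U → V/Γ` of dimension `n` of the diffeological space `X`. -/
structure QuasifoldChart (n : ℕ) (X : Type*) [DiffeologicalSpace X] where
  /-- the domain of the chart -/
  U : Set X
  isOpen_U : IsOpen[dTopology] U
  /-- the structure group, a countable group of affine transformations of `ℝⁿ` -/
  Γ : Subgroup (EuclideanSpace ℝ (Fin n) ≃ᵃ[ℝ] EuclideanSpace ℝ (Fin n))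
  countable_Γ : Countable Γ
  /-- the open subset of `ℝⁿ` on which `Γ` acts -/
  V : Opens (EuclideanSpace ℝ (Fin n))
  invariant : ∀ γ ∈ Γ, ∀ x ∈ V, γ x ∈ V
  /-- the chart itself -/
  F : U ≃ OrbitSpace Γ V
  dSmooth_F : DSmooth F
  dSmooth_F_symm : DSmooth F.symm

/-- `X` is a diffeological quasifold of dimension `n`. -/
def IsQuasifold (n : ℕ) (X : Type*) [DiffeologicalSpace X] : Prop :=
  @SecondCountableTopology X dTopology ∧ ∀ x : X, ∃ c : QuasifoldChart n X, x ∈ c.U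

/-! ### The disjoint union of open subsets of `ℝⁿ` as a manifold -/

section DisjointUnion

variable {ι : Type*} {n : ℕ}

/-- The disjoint union `⨆ᵢ Vᵢ` of a family of open subsets of `ℝⁿ`. -/
abbrev DisjUnion (V : ι → Opens (EuclideanSpace ℝ (Fin n))) : Type _ := Σ i, V i

/-- The inclusion `Vᵢ ⊆ ℝⁿ`, as a chart of the disjoint union with domain the summand `Vᵢ`. -/
def disjUnionChart (V : ι → Opens (EuclideanSpace ℝ (Fin n))) (i : ι) (h : Nonempty (V i)) :
    OpenPartialHomeomorph (DisjUnion V) (EuclideanSpace ℝ (Fin n)) :=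
  ((IsOpenEmbedding.sigmaMk (σ := fun j => V j) (i := i)).toOpenPartialHomeomorph
    (Sigma.mk i)).symm.trans ((V i).openPartialHomeomorphSubtypeCoe h)

instance disjUnionChartedSpace (V : ι → Opens (EuclideanSpace ℝ (Fin n))) :
    ChartedSpace (EuclideanSpace ℝ (Fin n)) (DisjUnion V) where
  atlas := {e | ∃ i h, e = disjUnionChart V i h}
  chartAt p := disjUnionChart V p.1 ⟨p.2⟩
  mem_chart_source p := by simp [disjUnionChart]
  chart_mem_atlas p := ⟨p.1, ⟨p.2⟩, rfl⟩

instance disjUnionIsManifold (V : ι → Opens (EuclideanSpace ℝ (Fin n))) :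
    IsManifold 𝓘(ℝ, EuclideanSpace ℝ (Fin n)) ∞ (DisjUnion V) where
  compatible := by
    rintro e e' ⟨i, hi, rfl⟩ ⟨j, hj, rfl⟩
    by_cases hij : i = j
    · subst hij
      exact symm_trans_mem_contDiffGroupoid _
    · refine (contDiffGroupoid ∞ _).locality fun y hy => absurd hy ?_
      rw [OpenPartialHomeomorph.trans_source]
      rintro ⟨hy, hy'⟩
      have h1 := (disjUnionChart V i hi).map_target hy
      simp [disjUnionChart] at h1 hy'
      grind

end DisjointUnion

/-! ### Pseudogroups and the structural pseudogroup of an atlas -/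

/-- The transitions in the family `ψ` generate the pseudogroup `Ψ`: it is the smallest
pseudogroup containing them. (A pseudogroup is a structure groupoid that is closed under
restriction.) -/
def PseudogroupGeneratedBy {N : Type*} [TopologicalSpace N] (Ψ : StructureGroupoid N)
    (ψ : ℕ → OpenPartialHomeomorph N N) : Prop :=
  ∀ e : OpenPartialHomeomorph N N, e ∈ Ψ ↔
    ∀ G : StructureGroupoid N, ClosedUnderRestriction G → (∀ k, ψ k ∈ G) → e ∈ G

section Atlas

variable {ι : Type*} {n : ℕ} {X : Type*} [DiffeologicalSpace X]

/-- The disjoint union `⨆ᵢ Vᵢ` of the chart spaces of a family of quasifold charts. -/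
abbrev ChartUnion (A : ι → QuasifoldChart n X) : Type _ := DisjUnion fun i => (A i).V

/-- The map `⨆ᵢ Vᵢ → ⨆ᵢ Vᵢ/Γᵢ → X` given on the summand `Vᵢ` by the inverse of `Fᵢ`. -/
def chartProjection (A : ι → QuasifoldChart n X) (p : ChartUnion A) : X :=
  ((A p.1).F.symm (OrbitSpace.mk p.2) : (A p.1).U)

/-- The structural pseudogroup of an atlas: all diffeomorphisms between open subsets of `⨆ᵢ Vᵢ`
that commute with the projection to `X`. -/
def structuralPseudogroup (A : ι → QuasifoldChart n X) : StructureGroupoid (ChartUnion A) :=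
  Pregroupoid.groupoid
    { property := fun f s =>
        ContMDiffOn 𝓘(ℝ, EuclideanSpace ℝ (Fin n)) 𝓘(ℝ, EuclideanSpace ℝ (Fin n)) ∞ f s ∧
          ∀ p ∈ s, chartProjection A (f p) = chartProjection A p
      comp := by
        rintro f g u v ⟨hf, hf'⟩ ⟨hg, hg'⟩ - - -
        refine ⟨hg.comp (hf.mono inter_subset_left) fun x hx => hx.2, fun p hp => ?_⟩
        rw [Function.comp_apply, hg' _ hp.2, hf' _ hp.1]
      id_mem := ⟨contMDiffOn_id, fun _ _ => rfl⟩
      locality := by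
        intro f u hu h
        refine ⟨fun x hx => ?_, fun x hx => ?_⟩
        · obtain ⟨v, hv, hxv, h, -⟩ := h x hx
          exact ((h x ⟨hx, hxv⟩).contMDiffAt
            ((hu.inter hv).mem_nhds ⟨hx, hxv⟩)).contMDiffWithinAt
        · obtain ⟨v, hv, hxv, -, h⟩ := h x hx
          exact h x ⟨hx, hxv⟩
      congr := by
        rintro f g u - h ⟨hf, hf'⟩
        exact ⟨hf.congr h, fun p hp => by rw [h p hp, hf' p hp]⟩ }

end Atlas

/-! ### Foliations -/

/-- A regular foliation of dimension `p` and codimension `q` of the manifold `M`, given by an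
atlas of foliated charts to `ℝᵖ × ℝ^q` whose changes of charts are locally of the form
`(x, y) ↦ (g (x, y), h y)`. -/
structure Foliation {E H : Type*} [NormedAddCommGroup E] [NormedSpace ℝ E] [TopologicalSpace H]
    (I : ModelWithCorners ℝ E H) (M : Type*) [TopologicalSpace M] [ChartedSpace H M]
    (p q : ℕ) where
  /-- the foliated charts -/
  charts : Set (OpenPartialHomeomorph M (EuclideanSpace ℝ (Fin p) × EuclideanSpace ℝ (Fin q)))
  cover : ∀ x : M, ∃ φ ∈ charts, x ∈ φ.source
  smooth : ∀ φ ∈ charts,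
    ContMDiffOn I 𝓘(ℝ, EuclideanSpace ℝ (Fin p) × EuclideanSpace ℝ (Fin q)) ∞ φ φ.source
  smooth_symm : ∀ φ ∈ charts,
    ContMDiffOn 𝓘(ℝ, EuclideanSpace ℝ (Fin p) × EuclideanSpace ℝ (Fin q)) I ∞ φ.symm φ.target
  compatible : ∀ φ ∈ charts, ∀ φ' ∈ charts, ∀ x ∈ φ.source ∩ φ'.source,
    ∃ h : EuclideanSpace ℝ (Fin q) → EuclideanSpace ℝ (Fin q),
      ∀ᶠ y in 𝓝 x, (φ' y).2 = h (φ y).2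

namespace Foliation

variable {E H : Type*} [NormedAddCommGroup E] [NormedSpace ℝ E] [TopologicalSpace H]
  {I : ModelWithCorners ℝ E H} {M : Type*} [TopologicalSpace M] [ChartedSpace H M]
  {p q : ℕ} (𝓕 : Foliation I M p q)

/-- The tangent space to the leaf through `x`: the kernel of the derivative of the transverse
component of any foliated chart at `x`. -/
def tangent (x : M) : Submodule ℝ (TangentSpace I x) :=
  ⨅ φ ∈ {φ ∈ 𝓕.charts | x ∈ φ.source},
    LinearMap.ker (mfderiv I 𝓘(ℝ, EuclideanSpace ℝ (Fin q)) (fun y => (φ y).2) x).toLinearMap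

/-- The points `x` and `y` lie in a common plaque, that is, in the same connected component of a
fibre of the transverse component of some foliated chart. -/
def SamePlaque (x y : M) : Prop :=
  ∃ φ ∈ 𝓕.charts, x ∈ φ.source ∧
    y ∈ connectedComponentIn {z | z ∈ φ.source ∧ (φ z).2 = (φ x).2} x

/-- The leaf space `M/𝓕`: points are identified when they are joined by a finite chain of
plaques. -/
def LeafSpace : Type _ := Quot 𝓕.SamePlaque

/-- The quotient map to the leaf space, sending a point to the leaf through it. -/
def leaf (x : M) : 𝓕.LeafSpace := Quot.mk _ x

/-- The leaf space with the quotient diffeology. -/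
instance : DiffeologicalSpace 𝓕.LeafSpace :=
  letI : DiffeologicalSpace M := manifoldDiffeology I M
  quotientDiffeology 𝓕.leaf Quot.mk_surjective

/-- `X` is a smooth vector field on the open set `U`. -/
def _root_.Quasifold.IsVectorFieldOn (I : ModelWithCorners ℝ E H) [IsManifold I ∞ M]
    (X : Π x : M, TangentSpace I x) (U : Set M) : Prop :=
  ContMDiffOn I I.tangent ∞ (fun x => (⟨x, X x⟩ : TangentBundle I M)) U

variable [IsManifold I ∞ M]

/-- `X` is a smooth vector field on `U` that is tangent to the leaves. -/
def IsTangentOn (X : Π x : M, TangentSpace I x) (U : Set M) : Prop :=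
  IsVectorFieldOn I X U ∧ ∀ x ∈ U, X x ∈ 𝓕.tangent x

/-- `X` is a foliate vector field on `U`: the bracket of `X` with every vector field tangent to
the leaves is tangent to the leaves. -/
def IsFoliateOn (X : Π x : M, TangentSpace I x) (U : Set M) : Prop :=
  IsVectorFieldOn I X U ∧
    ∀ Y : Π x : M, TangentSpace I x, 𝓕.IsTangentOn Y U →
      ∀ x ∈ U, VectorField.mlieBracket I X Y x ∈ 𝓕.tangent x

/-- `f` is a basic function on `U`: it is smooth and its derivative along every vector field
tangent to the leaves is zero. -/
def IsBasicOn (f : M → ℝ) (U : Set M) : Prop :=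
  ContMDiffOn I 𝓘(ℝ, ℝ) ∞ f U ∧
    ∀ X : Π x : M, TangentSpace I x, 𝓕.IsTangentOn X U →
      ∀ x ∈ U, mfderiv I 𝓘(ℝ, ℝ) f x (X x) = 0

/-- The Riemannian metric `g` on `M` is bundle-like: `g (X, Y)` is basic for any two foliate
vector fields `X`, `Y` (on an open set) that are perpendicular to the leaves. -/
def IsBundleLike
    (g : Bundle.ContMDiffRiemannianMetric I ∞ E (fun x : M => TangentSpace I x)) : Prop :=
  ∀ U : Set M, IsOpen U → ∀ X Y : Π x : M, TangentSpace I x,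
    𝓕.IsFoliateOn X U → 𝓕.IsFoliateOn Y U →
    (∀ x ∈ U, ∀ v ∈ 𝓕.tangent x, g.inner x (X x) v = 0) →
    (∀ x ∈ U, ∀ v ∈ 𝓕.tangent x, g.inner x (Y x) v = 0) →
    𝓕.IsBasicOn (fun x => g.inner x (X x) (Y x)) U

/-- The foliation is Riemannian: it admits a bundle-like metric. -/
def IsRiemannian : Prop :=
  ∃ g : Bundle.ContMDiffRiemannianMetric I ∞ E (fun x : M => TangentSpace I x),
    𝓕.IsBundleLike g

end Foliation

/-! ### The foliated manifold associated to a sequence of transitions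

The sequence `ψ₁, ψ₂, …` is indexed here as `ψ 0, ψ 1, …`. -/

section Realization

variable {N : Type*} [TopologicalSpace N]

/-- The open subset
`(N × ℝ × (0, 1)) ∪ ⋃ᵢ (dom ψᵢ × (i, i + 1) × (0, 3))`, `i = 1, 2, …`, of `N × ℝ × ℝ`. -/
def realizationDomain (ψ : ℕ → OpenPartialHomeomorph N N) : Opens (N × ℝ × ℝ) where
  carrier := univ ×ˢ (univ ×ˢ Ioo 0 1) ∪
    ⋃ k : ℕ, (ψ k).source ×ˢ (Ioo ((k : ℝ) + 1) (k + 2) ×ˢ Ioo 0 3)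
  is_open' := (isOpen_univ.prod (isOpen_univ.prod isOpen_Ioo)).union
    (isOpen_iUnion fun k => (ψ k).open_source.prod (isOpen_Ioo.prod isOpen_Ioo))

/-- The gluing `(x, s, t) ∼ (ψᵢ x, s, t - 2)` for `x ∈ dom ψᵢ`, `s ∈ (i, i + 1)`,
`t ∈ (2, 3)`. -/
def RealizationRel (ψ : ℕ → OpenPartialHomeomorph N N) (v w : realizationDomain ψ) : Prop :=
  ∃ k : ℕ, v.1.1 ∈ (ψ k).source ∧ v.1.2.1 ∈ Ioo ((k : ℝ) + 1) (k + 2) ∧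
    v.1.2.2 ∈ Ioo (2 : ℝ) 3 ∧ w.1 = (ψ k v.1.1, v.1.2.1, v.1.2.2 - 2)

/-- The quotient of the open set above by the equivalence relation generated by the gluing. -/
def Realization (ψ : ℕ → OpenPartialHomeomorph N N) : Type _ := Quot (RealizationRel ψ)

/-- The quotient topology. -/
instance (ψ : ℕ → OpenPartialHomeomorph N N) : TopologicalSpace (Realization ψ) :=
  inferInstanceAs (TopologicalSpace (Quot (RealizationRel ψ)))

/-- The quotient map. -/
def Realization.mk {ψ : ℕ → OpenPartialHomeomorph N N} (v : realizationDomain ψ) :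
    Realization ψ := Quot.mk _ v

end Realization

/-- The model space `ℝⁿ × ℝ × ℝ`. -/
abbrev RealizationModel (n : ℕ) : Type :=
  ModelProd (EuclideanSpace ℝ (Fin n)) (ModelProd ℝ ℝ)

/-- The model with corners for products `N × ℝ × ℝ` with an `n`-manifold `N`. -/
abbrev realizationModelWithCorners (n : ℕ) :
    ModelWithCorners ℝ (EuclideanSpace ℝ (Fin n) × ℝ × ℝ) (RealizationModel n) :=
  𝓘(ℝ, EuclideanSpace ℝ (Fin n)).prod (𝓘(ℝ, ℝ).prod 𝓘(ℝ, ℝ))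

end Quasifold

end

open Quasifold

noncomputable section

namespace Quasifold

/-! ### Smooth maps with values in countable families of affine maps -/

section Analysis

variable {E : Type*} [NormedAddCommGroup E] [InnerProductSpace ℝ E] [FiniteDimensional ℝ E]

/-! The space `M` suspends the generators of `Ψ`. Over each `x : N` lies the connected strip `ℝ ×
(0,1)`. For each `i` with `x ∈ dom ψᵢ` a column `(i,i+1) × (0,3)` is attached to it, and the top of
that column is glued to the strip over `ψᵢ x`. Each fibre of the first projection therefore lies in
one leaf, and gluing merges the leaves over `x` and `ψᵢ x`. The leaves correspond to the orbits of
the pseudogroup generated by the `ψᵢ`, that is, of `Ψ`.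

The analytic core identifies these orbits with the fibres of `pr_X`. A smooth map that takes
pointwise values in the orbits of a countable affine group agrees near each point with one group
element (`exists_eventuallyEq_affine`): by Baire this holds near a dense set of points, so the
second derivative vanishes, and the affine pieces agree. Hence local lifts of the chart transitions
can be corrected to local diffeomorphisms (`exists_mem_structuralPseudogroup`). Two elements of `Ψ`
that agree in their target summand differ locally by an element of `Γᵢ`
(`exists_eventually_coord_eq`). With the Lindelöf property this gives countable generation
(`exists_pseudogroupGeneratedBy`).

Gluing only relates heights `t > 2` to heights `t < 1`, so it never composes with itself
(`Realization.mk_eq_iff`). The quotient map is open, and it is injective on `t < 2` and on `1 < t`.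
These halves supply charts, and every coordinate change is locally `(x, s, t) ↦ (ρ x, s, t + δ)`
with `ρ ∈ Ψ` (`exists_realizationChart_eq`). Smoothness, the submersion property and the foliation
are read off from this form. Plots are compared by lifting to `M` in one direction and by the
section `x ↦ (x, 0, 1/2)` in the other (`exists_leafSpace_equiv`).

Since each `ρ` is an isometry, the product of the metric of `N` with the Euclidean metric of `ℝ²`
descends to `M` (`realizationMetric`). Foliate perpendicular fields have no `ℝ²` component, and
their `ℝⁿ` component does not vary along the leaves. So their pairing is basic
(`realizationFoliation_isBundleLike`). -/

/-- A bump function contracts the space towards `x`. Plots are defined on all of `ℝᵏ`, so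
precomposition with `b` turns a map that is only usable near `x` into a global plot with the same
germ. -/
theorem exists_contDiff_mem_eventually_eq_self (x : E) {s : Set E} (hs : s ∈ 𝓝 x) :
    ∃ b : E → E, ContDiff ℝ ∞ b ∧ (∀ y, b y ∈ s) ∧ ∀ᶠ y in 𝓝 x, b y = y := by
  obtain ⟨ε, hε, hεs⟩ := Metric.mem_nhds_iff.1 hs
  let χ : ContDiffBump x := ⟨ε / 4, ε / 2, by linarith, by linarith⟩
  refine ⟨fun y => x + χ y • (y - x), contDiff_const.add (χ.contDiff.smul
    (contDiff_id.sub contDiff_const)), fun y => hεs ?_, ?_⟩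
  · rw [mem_ball_iff_norm, add_sub_cancel_left, norm_smul, Real.norm_of_nonneg χ.nonneg]
    by_cases hy : y ∈ Metric.ball x (ε / 2)
    · rw [mem_ball_iff_norm] at hy
      calc χ y * ‖y - x‖ ≤ 1 * ‖y - x‖ := by gcongr; exact χ.le_one
        _ < ε := by linarith
    · have : χ y = 0 := by
        have h := χ.support_eq
        rw [← Function.notMem_support, h]
        exact hy
      simpa [this] using hε
  · filter_upwards [χ.eventuallyEq_one] with y hy
    simp [hy]

/-- Baire's theorem: the coincidence sets of `f` with the countably many `γ` are closed and cover a
ball, so one of them has an interior point in it. -/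
theorem exists_eventuallyEq_affine_of_isOpen (Γ : Set (E ≃ᵃ[ℝ] E)) (hΓ : Γ.Countable)
    {f : E → E} {O : Set E} (hO : IsOpen O) (hne : O.Nonempty) (hf : ContinuousOn f O)
    (h : ∀ y ∈ O, ∃ γ ∈ Γ, f y = γ y) : ∃ y ∈ O, ∃ γ ∈ Γ, f =ᶠ[𝓝 y] γ := by
  obtain ⟨y₀, hy₀⟩ := hne
  obtain ⟨ε, hε, hεO⟩ := Metric.nhds_basis_closedBall.mem_iff.1 (hO.mem_nhds hy₀)
  have : Countable Γ := hΓ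
  -- The index `none` carries the complement of the open ball, so that the closed sets cover the
  -- whole space.
  let C : Option Γ → Set E := fun o => o.elim (Metric.ball y₀ ε)ᶜ
    fun γ => {y ∈ Metric.closedBall y₀ ε | f y = (γ : E ≃ᵃ[ℝ] E) y}
  have hC : ∀ o, IsClosed (C o) := by
    rintro (_ | γ)
    · exact Metric.isOpen_ball.isClosed_compl
    · have h1 : ContinuousOn (fun y => f y - (γ : E ≃ᵃ[ℝ] E) y) (Metric.closedBall y₀ ε) :=
        (hf.mono hεO).sub (γ : E ≃ᵃ[ℝ] E).toAffineMap.continuous_of_finiteDimensional.continuousOn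
      have h2 := h1.preimage_isClosed_of_isClosed Metric.isClosed_closedBall
        (isClosed_singleton (x := (0 : E)))
      convert h2 using 1
      ext y
      simp [C, sub_eq_zero]
  have hU : ⋃ o, C o = univ := by
    refine eq_univ_of_forall fun y => mem_iUnion.2 ?_
    by_cases hy : y ∈ Metric.ball y₀ ε
    · obtain ⟨γ, hγ, e⟩ := h y (hεO (Metric.ball_subset_closedBall hy))
      exact ⟨some ⟨γ, hγ⟩, Metric.ball_subset_closedBall hy, e⟩
    · exact ⟨none, hy⟩
  obtain ⟨y, hy, hyC⟩ := (dense_iUnion_interior_of_closed hC hU).inter_open_nonempty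
    (Metric.ball y₀ ε) Metric.isOpen_ball ⟨y₀, Metric.mem_ball_self hε⟩
  obtain ⟨o, ho⟩ := mem_iUnion.1 hyC
  cases o with
  | none => exact absurd hy (interior_subset ho)
  | some γ =>
    refine ⟨y, hεO (Metric.ball_subset_closedBall hy), γ, γ.2, ?_⟩
    filter_upwards [mem_interior_iff_mem_nhds.1 ho] with z hz using hz.2

/-- Baire alone gives an affine germ only near some point of each open set. Two continuous
derivatives extend this to every point: the second derivative cannot be nonzero on an open set, so
it vanishes on a ball, the first derivative is constant there, and one affine germ determines `f`.
-/
theorem exists_eventuallyEq_affine (Γ : Set (E ≃ᵃ[ℝ] E)) (hΓ : Γ.Countable)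
    {f : E → E} {x : E} (hf : ContDiffAt ℝ 2 f x) (h : ∀ᶠ y in 𝓝 x, ∃ γ ∈ Γ, f y = γ y) :
    ∃ γ ∈ Γ, f =ᶠ[𝓝 x] γ := by
  obtain ⟨r, hr, hB⟩ := Metric.eventually_nhds_iff_ball.1 ((hf.eventually (by simp)).and h)
  have hfB : ContDiffOn ℝ 2 f (Metric.ball x r) := fun y hy => (hB y hy).1.contDiffWithinAt
  have hconn := (convex_ball x r).isPreconnected
  have hdγ : ∀ (γ : E ≃ᵃ[ℝ] E) y, HasFDerivAt (γ : E → E)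
      (LinearMap.toContinuousLinearMap (γ.linear : E →ₗ[ℝ] E)) y := fun γ y => by
    have h1 := (LinearMap.toContinuousLinearMap (γ.linear : E →ₗ[ℝ] E)).hasFDerivAt (x := y)
    have h2 : (γ : E → E) = fun z => LinearMap.toContinuousLinearMap (γ.linear : E →ₗ[ℝ] E) z
        + γ 0 := by
      ext1 z
      have := γ.toAffineMap.decomp
      have := congrFun this z
      simpa using this
    rw [h2]
    exact h1.add_const _
  have hd2 : ∀ y ∈ Metric.ball x r, fderiv ℝ (fderiv ℝ f) y = 0 := by
    have hc : ContinuousOn (fderiv ℝ (fderiv ℝ f)) (Metric.ball x r) := fun y hy => by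
      have h1 : ContDiffAt ℝ 1 (fderiv ℝ f) y := (hB y hy).1.fderiv_right (by norm_num)
      exact (h1.fderiv_right (m := 0) (by norm_num)).continuousAt.continuousWithinAt
    by_contra! hcon
    obtain ⟨y, hy, hne⟩ := hcon
    have hO : IsOpen (Metric.ball x r ∩ fderiv ℝ (fderiv ℝ f) ⁻¹' {0}ᶜ) :=
      hc.isOpen_inter_preimage Metric.isOpen_ball isOpen_compl_singleton
    obtain ⟨z, hz, γ, -, e⟩ := exists_eventuallyEq_affine_of_isOpen Γ hΓ hO ⟨y, hy, hne⟩
      (hfB.continuousOn.mono inter_subset_left) (fun z hz => (hB z hz.1).2)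
    apply hz.2
    have e1 : fderiv ℝ f =ᶠ[𝓝 z] fun _ =>
        LinearMap.toContinuousLinearMap (γ.linear : E →ₗ[ℝ] E) := by
      filter_upwards [e.eventuallyEq_nhds] with w hw
      rw [hw.fderiv_eq, (hdγ γ w).fderiv]
    rw [mem_singleton_iff, e1.fderiv_eq]
    simp
  obtain ⟨y, hy, γ, hγ, e⟩ := exists_eventuallyEq_affine_of_isOpen Γ hΓ Metric.isOpen_ball
    ⟨x, Metric.mem_ball_self hr⟩ hfB.continuousOn (fun z hz => (hB z hz).2)
  refine ⟨γ, hγ, ?_⟩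
  -- The derivative is constant on the ball and equals the linear part of `γ` at `y`. So `f - γ` is
  -- constant there, and it vanishes at `y`.
  have hd1 : ∀ z ∈ Metric.ball x r,
      fderiv ℝ f z = LinearMap.toContinuousLinearMap (γ.linear : E →ₗ[ℝ] E) := fun z hz => by
    have hdiff : DifferentiableOn ℝ (fderiv ℝ f) (Metric.ball x r) := fun w hw =>
      (((hB w hw).1.fderiv_right (m := 1) (by norm_num)).differentiableAt
        (by norm_num)).differentiableWithinAt
    rw [Metric.isOpen_ball.is_const_of_fderiv_eq_zero hconn hdiff hd2 hz hy, e.fderiv_eq,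
      (hdγ γ y).fderiv]
  have hsub : ∀ z ∈ Metric.ball x r, HasFDerivAt (fun z => f z - γ z) (0 : E →L[ℝ] E) z :=
    fun z hz => by
      have h1 := ((hB z hz).1.differentiableAt (by norm_num)).hasFDerivAt
      rw [hd1 z hz] at h1
      have h2 := h1.sub (hdγ γ z)
      rwa [sub_self] at h2
  filter_upwards [Metric.ball_mem_nhds x hr] with z hz
  have := Metric.isOpen_ball.is_const_of_fderiv_eq_zero hconn
    (fun w hw => (hsub w hw).differentiableAt.differentiableWithinAt)
    (fun w hw => (hsub w hw).fderiv) hz hy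
  simp only [e.eq_of_nhds, sub_self] at this
  exact sub_eq_zero.1 this

end Analysis

/-! ### Diffeologies -/

section Diffeology

theorem isPlot_subtype_iff {X : Type*} [DiffeologicalSpace X] {P : X → Prop} {k : ℕ}
    {p : EuclideanSpace ℝ (Fin k) → Subtype P} : IsPlot p ↔ IsPlot fun r => (p r : X) :=
  Iff.rfl

theorem isPlot_quotientDiffeology_iff {Y Q : Type*} [DiffeologicalSpace Y] (π : Y → Q)
    (hπ : Function.Surjective π) {k : ℕ} {p : EuclideanSpace ℝ (Fin k) → Q} :
    @IsPlot Q (quotientDiffeology π hπ) k p ↔ ∀ r, ∃ q : EuclideanSpace ℝ (Fin k) → Y,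
      IsPlot q ∧ ∀ᶠ y in 𝓝 r, π (q y) = p y :=
  ⟨fun h r => h r (mem_univ r), fun h r _ => h r⟩

theorem isPlot_manifoldDiffeology_iff {E H : Type*} [NormedAddCommGroup E] [NormedSpace ℝ E]
    [TopologicalSpace H] (I : ModelWithCorners ℝ E H) (M : Type*) [TopologicalSpace M]
    [ChartedSpace H M] {k : ℕ} {p : EuclideanSpace ℝ (Fin k) → M} :
    @IsPlot M (manifoldDiffeology I M) k p ↔
      ContMDiff 𝓘(ℝ, EuclideanSpace ℝ (Fin k)) I ∞ p :=
  contMDiffOn_univ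

/-- Being a plot is a local property. -/
theorem isPlot_of_locally {X : Type*} [DiffeologicalSpace X] {k : ℕ}
    {p : EuclideanSpace ℝ (Fin k) → X}
    (h : ∀ r, ∃ q : EuclideanSpace ℝ (Fin k) → X, IsPlot q ∧ ∀ᶠ y in 𝓝 r, q y = p y) :
    IsPlot p := by
  refine DiffeologicalSpace.locality fun r => ?_
  obtain ⟨q, hq, e⟩ := h r
  obtain ⟨u, hu, huo, hru⟩ := eventually_nhds_iff.1 e
  refine ⟨u, huo, hru, fun {m f} hfu hf => ?_⟩
  have : p ∘ f = q ∘ f := funext fun z => (hu _ (hfu z)).symm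
  rw [this]
  exact isPlot_reparam hq hf

end Diffeology

/-! ### Charts of the disjoint union -/

section DisjointUnion

variable {ι : Type*} {n : ℕ} {V : ι → Opens (EuclideanSpace ℝ (Fin n))}

/-- The map `⨆ᵢ Vᵢ → ℝⁿ` given by the inclusions. -/
def DisjUnion.coord (p : DisjUnion V) : EuclideanSpace ℝ (Fin n) := p.2

theorem disjUnionChart_source (i : ι) (h : Nonempty (V i)) :
    (disjUnionChart V i h).source = {p | p.1 = i} := by
  ext ⟨j, x⟩
  simp [disjUnionChart, eq_comm]

theorem disjUnionChart_target (i : ι) (h : Nonempty (V i)) :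
    (disjUnionChart V i h).target = V i := by
  ext x
  simp [disjUnionChart]

theorem disjUnionChart_symm_apply (i : ι) (h : Nonempty (V i)) (x : V i) :
    (disjUnionChart V i h).symm (x : EuclideanSpace ℝ (Fin n)) = ⟨i, x⟩ := by
  have : (disjUnionChart V i h).symm (x : EuclideanSpace ℝ (Fin n)) =
    ⟨i, ((V i).openPartialHomeomorphSubtypeCoe h).symm x⟩ := rfl
  rw [this]
  congr 1
  exact ((V i).openPartialHomeomorphSubtypeCoe h).left_inv (x := x) (by simp)

theorem disjUnionChart_apply (i : ι) (h : Nonempty (V i)) (x : V i) :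
    disjUnionChart V i h ⟨i, x⟩ = (x : EuclideanSpace ℝ (Fin n)) := by
  have h1 := disjUnionChart_symm_apply i h x
  have h2 : (x : EuclideanSpace ℝ (Fin n)) ∈ (disjUnionChart V i h).target := by
    rw [disjUnionChart_target]; exact x.2
  rw [← h1, (disjUnionChart V i h).right_inv h2]

theorem chartAt_disjUnion_source (p : DisjUnion V) :
    (chartAt (EuclideanSpace ℝ (Fin n)) p).source = {q | q.1 = p.1} :=
  disjUnionChart_source _ _

theorem chartAt_disjUnion_target (p : DisjUnion V) :
    (chartAt (EuclideanSpace ℝ (Fin n)) p).target = V p.1 :=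
  disjUnionChart_target _ _

theorem chartAt_disjUnion_apply {p q : DisjUnion V} (h : q.1 = p.1) :
    chartAt (EuclideanSpace ℝ (Fin n)) p q = q.coord := by
  obtain ⟨i, x⟩ := p
  obtain ⟨j, y⟩ := q
  obtain rfl : j = i := h
  exact disjUnionChart_apply _ _ _

theorem chartAt_disjUnion_symm_apply (p : DisjUnion V) (x : V p.1) :
    (chartAt (EuclideanSpace ℝ (Fin n)) p).symm (x : EuclideanSpace ℝ (Fin n)) = ⟨p.1, x⟩ :=
  disjUnionChart_symm_apply _ _ _

theorem chartAt_disjUnion_congr {p q : DisjUnion V} (h : q.1 = p.1) :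
    chartAt (EuclideanSpace ℝ (Fin n)) q = chartAt (EuclideanSpace ℝ (Fin n)) p := by
  obtain ⟨i, x⟩ := p
  obtain ⟨j, y⟩ := q
  obtain rfl : j = i := h
  rfl

theorem DisjUnion.isOpen_fiber (i : ι) : IsOpen {q : DisjUnion V | q.1 = i} := by
  convert isOpen_range_sigmaMk (σ := fun j => V j) (i := i) using 1
  ext ⟨j, x⟩
  simp [eq_comm]

theorem DisjUnion.eventually_fst_eq (p : DisjUnion V) : ∀ᶠ q in 𝓝 p, q.1 = p.1 :=
  (DisjUnion.isOpen_fiber p.1).mem_nhds rfl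

theorem DisjUnion.contMDiff_coord : ContMDiff 𝓘(ℝ, EuclideanSpace ℝ (Fin n))
    𝓘(ℝ, EuclideanSpace ℝ (Fin n)) ∞ (DisjUnion.coord (V := V)) := by
  intro p
  have h : ContMDiffAt 𝓘(ℝ, EuclideanSpace ℝ (Fin n)) 𝓘(ℝ, EuclideanSpace ℝ (Fin n)) ∞
      (chartAt (EuclideanSpace ℝ (Fin n)) p) p :=
    contMDiffAt_of_mem_maximalAtlas (IsManifold.chart_mem_maximalAtlas p) (mem_chart_source _ p)
  refine h.congr_of_eventuallyEq ?_
  filter_upwards [DisjUnion.eventually_fst_eq p] with q hq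
  exact (chartAt_disjUnion_apply hq).symm

theorem contMDiffAt_chartAt_disjUnion_symm (p : DisjUnion V) {x : EuclideanSpace ℝ (Fin n)}
    (hx : x ∈ V p.1) : ContMDiffAt 𝓘(ℝ, EuclideanSpace ℝ (Fin n))
    𝓘(ℝ, EuclideanSpace ℝ (Fin n)) ∞ (chartAt (EuclideanSpace ℝ (Fin n)) p).symm x :=
  contMDiffAt_symm_of_mem_maximalAtlas (IsManifold.chart_mem_maximalAtlas p)
    (by rw [chartAt_disjUnion_target]; exact hx)

/-- Continuity fixes the summand locally, and on a fixed summand the inclusion into `ℝⁿ` is a chart.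
-/
theorem DisjUnion.contMDiffAt_iff {E' H' M' : Type*} [NormedAddCommGroup E'] [NormedSpace ℝ E']
    [TopologicalSpace H'] {I' : ModelWithCorners ℝ E' H'} [TopologicalSpace M']
    [ChartedSpace H' M'] {f : M' → DisjUnion V} {x : M'} :
    ContMDiffAt I' 𝓘(ℝ, EuclideanSpace ℝ (Fin n)) ∞ f x ↔
      ContinuousAt f x ∧ ContMDiffAt I' 𝓘(ℝ, EuclideanSpace ℝ (Fin n)) ∞ (fun y => (f y).coord) x := by
  refine ⟨fun h => ⟨h.continuousAt, DisjUnion.contMDiff_coord.contMDiffAt.comp x h⟩, ?_⟩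
  rintro ⟨hc, h⟩
  have h1 : ContMDiffAt I' 𝓘(ℝ, EuclideanSpace ℝ (Fin n)) ∞
      ((chartAt (EuclideanSpace ℝ (Fin n)) (f x)).symm ∘ fun y => (f y).coord) x :=
    (contMDiffAt_chartAt_disjUnion_symm (f x) (f x).2.2).comp x h
  refine h1.congr_of_eventuallyEq ?_
  filter_upwards [hc.eventually (DisjUnion.eventually_fst_eq (f x))] with y hy
  have h2 := (chartAt (EuclideanSpace ℝ (Fin n)) (f x)).left_inv (x := f y)
    (by rw [chartAt_disjUnion_source]; exact hy)
  rw [chartAt_disjUnion_apply hy] at h2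
  exact h2.symm

end DisjointUnion

/-! ### The structural pseudogroup -/

/-- In a pseudogroup that is closed under restriction, membership depends only on germs. -/
theorem StructureGroupoid.mem_of_eventuallyEq {H : Type*} [TopologicalSpace H]
    (G : StructureGroupoid H) [ClosedUnderRestriction G] {e : OpenPartialHomeomorph H H}
    (h : ∀ x ∈ e.source, ∃ e' ∈ G, x ∈ e'.source ∧ e =ᶠ[𝓝 x] e') : e ∈ G := by
  refine G.locality fun x hx => ?_
  obtain ⟨e', he', hx', hee'⟩ := h x hx
  obtain ⟨u, hu, huo, hxu⟩ := eventually_nhds_iff.1 hee'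
  refine ⟨e.source ∩ e'.source ∩ u, (e.open_source.inter e'.open_source).inter huo,
    ⟨⟨hx, hx'⟩, hxu⟩, ?_⟩
  have ho := (e.open_source.inter e'.open_source).inter huo
  refine G.mem_of_eqOnSource (closedUnderRestriction' he' ho) ⟨?_, ?_⟩
  · rw [e.restr_source' _ ho, e'.restr_source' _ ho]
    ext; simp; tauto
  · intro y hy
    rw [e.restr_source' _ ho] at hy
    simpa using hu y hy.2.2

/-! ### Transporting local homeomorphisms of `ℝⁿ` to the disjoint union -/

section Conjugation

variable {ι : Type*} {n : ℕ} {V : ι → Opens (EuclideanSpace ℝ (Fin n))}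

theorem DisjUnion.ext {p q : DisjUnion V}
    (h : p.1 = q.1) (h' : p.coord = q.coord) : p = q := by
  obtain ⟨i, x⟩ := p
  obtain ⟨j, y⟩ := q
  obtain rfl : i = j := h
  exact Sigma.ext rfl (heq_of_eq (Subtype.ext h'))

theorem DisjUnion.coord_mem {p : DisjUnion V} {i : ι} (h : p.1 = i) : p.coord ∈ V i :=
  h ▸ p.2.2

/-- A local homeomorphism of `ℝⁿ`, as a local homeomorphism from the summand of `p` to the summand
of `q` of a disjoint union. -/
def chartConj (p q : DisjUnion V)
    (e : OpenPartialHomeomorph (EuclideanSpace ℝ (Fin n)) (EuclideanSpace ℝ (Fin n))) :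
    OpenPartialHomeomorph (DisjUnion V) (DisjUnion V) :=
  (chartAt (EuclideanSpace ℝ (Fin n)) p).trans
    (e.trans (chartAt (EuclideanSpace ℝ (Fin n)) q).symm)

variable {p q : DisjUnion V}
  {e : OpenPartialHomeomorph (EuclideanSpace ℝ (Fin n)) (EuclideanSpace ℝ (Fin n))}

theorem mem_chartConj_source_iff {r : DisjUnion V} : r ∈ (chartConj p q e).source ↔
    r.1 = p.1 ∧ r.coord ∈ e.source ∧ e r.coord ∈ V q.1 := by
  simp only [chartConj, OpenPartialHomeomorph.trans_source, chartAt_disjUnion_source, mem_inter_iff,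
    mem_preimage, OpenPartialHomeomorph.symm_source, chartAt_disjUnion_target]
  refine and_congr_right fun h => ?_
  rw [chartAt_disjUnion_apply h]
  rfl

theorem chartConj_apply {r : DisjUnion V} (hr : r ∈ (chartConj p q e).source) :
    chartConj p q e r = ⟨q.1, e r.coord, (mem_chartConj_source_iff.1 hr).2.2⟩ := by
  rw [← chartAt_disjUnion_symm_apply q ⟨e r.coord, (mem_chartConj_source_iff.1 hr).2.2⟩]
  simp only [chartConj, OpenPartialHomeomorph.coe_trans, Function.comp_apply]
  rw [chartAt_disjUnion_apply (mem_chartConj_source_iff.1 hr).1]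

theorem chartConj_symm : (chartConj p q e).symm = chartConj q p e.symm := by
  simp [chartConj, OpenPartialHomeomorph.trans_symm_eq_symm_trans_symm,
    OpenPartialHomeomorph.trans_assoc]

theorem contMDiffOn_chartConj (he : ContDiffOn ℝ ∞ e e.source) :
    ContMDiffOn 𝓘(ℝ, EuclideanSpace ℝ (Fin n)) 𝓘(ℝ, EuclideanSpace ℝ (Fin n)) ∞
      (chartConj p q e) (chartConj p q e).source := by
  intro r hr
  refine ContMDiffAt.contMDiffWithinAt (DisjUnion.contMDiffAt_iff.2
    ⟨(chartConj p q e).continuousAt hr, ?_⟩)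
  have h1 : ContMDiffAt 𝓘(ℝ, EuclideanSpace ℝ (Fin n)) 𝓘(ℝ, EuclideanSpace ℝ (Fin n)) ∞
      (e ∘ DisjUnion.coord) r := by
    refine ContMDiffAt.comp r (contMDiffAt_iff_contDiffAt.2 (he.contDiffAt ?_))
      DisjUnion.contMDiff_coord.contMDiffAt
    exact e.open_source.mem_nhds (mem_chartConj_source_iff.1 hr).2.1
  refine h1.congr_of_eventuallyEq ?_
  filter_upwards [(chartConj p q e).open_source.mem_nhds hr] with r' hr'
  rw [chartConj_apply hr']
  rfl

end Conjugation

/-! ### Orbits and generators of the structural pseudogroup -/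

section Atlas

variable {ι : Type*} {n : ℕ} {X : Type*} [DiffeologicalSpace X] {A : ι → QuasifoldChart n X}

theorem mem_structuralPseudogroup_iff {e : OpenPartialHomeomorph (ChartUnion A) (ChartUnion A)} :
    e ∈ structuralPseudogroup A ↔
      ContMDiffOn 𝓘(ℝ, EuclideanSpace ℝ (Fin n)) 𝓘(ℝ, EuclideanSpace ℝ (Fin n)) ∞ e e.source ∧
      ContMDiffOn 𝓘(ℝ, EuclideanSpace ℝ (Fin n)) 𝓘(ℝ, EuclideanSpace ℝ (Fin n)) ∞
        e.symm e.target ∧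
      ∀ p ∈ e.source, chartProjection A (e p) = chartProjection A p := by
  refine mem_groupoid_of_pregroupoid.trans ⟨fun h => ⟨h.1.1, h.2.1, h.1.2⟩, fun h =>
    ⟨⟨h.1, h.2.2⟩, h.2.1, fun p hp => ?_⟩⟩
  have := h.2.2 _ (e.map_target hp)
  rw [e.right_inv hp] at this
  exact this.symm

instance closedUnderRestriction_structuralPseudogroup :
    ClosedUnderRestriction (structuralPseudogroup A) where
  closedUnderRestriction {e} he s hs := by
    rw [mem_structuralPseudogroup_iff] at he ⊢
    refine ⟨he.1.mono ?_, he.2.1.mono ?_, fun p hp => he.2.2 p ?_⟩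
    · exact inter_subset_left
    · exact inter_subset_left
    · exact hp.1

theorem chartProjection_eq_iff {i : ι} {x y : (A i).V} :
    chartProjection A ⟨i, x⟩ = chartProjection A ⟨i, y⟩ ↔
      ∃ γ ∈ (A i).Γ, γ (x : EuclideanSpace ℝ (Fin n)) = y := by
  simp only [chartProjection, Subtype.coe_inj, EmbeddingLike.apply_eq_iff_eq]
  exact Quotient.eq (r := orbitSetoid (A i).Γ (A i).V)

theorem exists_chartProjection_eq {x : X} {i : ι} (hx : x ∈ (A i).U) :
    ∃ y : (A i).V, chartProjection A ⟨i, y⟩ = x := by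
  obtain ⟨y, hy⟩ := Quotient.mk_surjective (s := orbitSetoid (A i).Γ (A i).V) ((A i).F ⟨x, hx⟩)
  refine ⟨y, ?_⟩
  change (((A i).F.symm (Quotient.mk _ y) : (A i).U) : X) = x
  rw [hy, Equiv.symm_apply_apply]

theorem chartProjection_mem (p : ChartUnion A) : chartProjection A p ∈ (A p.1).U :=
  Subtype.prop _

/-- The restriction of the projection to a summand maps plots to plots. -/
theorem isPlot_chartProjection {i : ι} {k : ℕ} {q : EuclideanSpace ℝ (Fin k) → (A i).V}
    (hq : ContDiff ℝ ∞ fun r => (q r : EuclideanSpace ℝ (Fin n))) :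
    IsPlot fun r => chartProjection A ⟨i, q r⟩ := by
  have h1 : IsPlot fun r => (OrbitSpace.mk (q r) : OrbitSpace (A i).Γ (A i).V) :=
    (isPlot_quotientDiffeology_iff (Y := {x // x ∈ (A i).V}) _
      Quotient.mk_surjective).2 fun r =>
      ⟨q, isPlot_subtype_iff.2 hq.isPlot, .of_forall fun _ => rfl⟩
  exact isPlot_subtype_iff.1 ((A i).dSmooth_F_symm _ _ h1)

/-- A plot of `X` lifts locally to every chart around its value. -/
theorem exists_lift {k : ℕ} {p : EuclideanSpace ℝ (Fin k) → X} (hp : IsPlot p)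
    (r : EuclideanSpace ℝ (Fin k)) {i : ι} (hr : p r ∈ (A i).U) :
    ∃ q : EuclideanSpace ℝ (Fin k) → (A i).V,
      ContDiff ℝ ∞ (fun r => (q r : EuclideanSpace ℝ (Fin n))) ∧
      ∀ᶠ y in 𝓝 r, chartProjection A ⟨i, q y⟩ = p y := by
  -- The chart can only be applied to plots of `U`. D-openness makes the preimage of `U` open, so
  -- `p` can be confined to it near `r`.
  have ho : IsOpen (p ⁻¹' (A i).U) :=
    isOpen_iff_preimages_plots.1 (A i).isOpen_U k p hp
  obtain ⟨b, hb, hbU, hbr⟩ := exists_contDiff_mem_eventually_eq_self r (ho.mem_nhds hr)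
  have h1 : IsPlot fun y => (⟨p (b y), hbU y⟩ : (A i).U) :=
    isPlot_subtype_iff.2 (isPlot_reparam hp hb)
  obtain ⟨q, hq, e⟩ := (isPlot_quotientDiffeology_iff (Y := {x // x ∈ (A i).V}) _
      Quotient.mk_surjective).1
    ((A i).dSmooth_F _ _ h1) r
  refine ⟨q, (isPlot_subtype_iff.1 hq).contDiff, ?_⟩
  filter_upwards [e, hbr] with y hy hby
  change (((A i).F.symm (OrbitSpace.mk (q y)) : (A i).U) : X) = p y
  have hy' : OrbitSpace.mk (q y) = (A i).F ⟨p (b y), hbU y⟩ := hy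
  rw [hy', Equiv.symm_apply_apply]
  simp only [hby]

theorem contDiff_affineEquiv (γ : EuclideanSpace ℝ (Fin n) ≃ᵃ[ℝ] EuclideanSpace ℝ (Fin n)) :
    ContDiff ℝ ∞ γ := by
  have h1 : (γ : EuclideanSpace ℝ (Fin n) → EuclideanSpace ℝ (Fin n)) =
      fun z => LinearMap.toContinuousLinearMap (γ.linear : _ →ₗ[ℝ] _) z + γ 0 := by
    ext1 z
    simpa using congrFun γ.toAffineMap.decomp z
  rw [h1]
  exact (ContinuousLinearMap.contDiff _).add contDiff_const

/-- Local lifts of the identity of `V/Γ` are given by elements of `Γ`. -/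
theorem eventuallyEq_of_chartProjection_eq {i : ι}
    {f : EuclideanSpace ℝ (Fin n) → EuclideanSpace ℝ (Fin n)} {x : EuclideanSpace ℝ (Fin n)}
    (hf : ContDiffAt ℝ ∞ f x)
    (h : ∀ᶠ y in 𝓝 x, ∃ (hy : y ∈ (A i).V) (hfy : f y ∈ (A i).V),
      chartProjection A ⟨i, f y, hfy⟩ = chartProjection A ⟨i, y, hy⟩) :
    ∃ γ ∈ (A i).Γ, f =ᶠ[𝓝 x] γ := by
  have := (A i).countable_Γ
  refine exists_eventuallyEq_affine ((A i).Γ : Set _) (to_countable _)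
    (hf.of_le ENat.LEInfty.out) ?_
  filter_upwards [h] with y ⟨hy, hfy, e⟩
  obtain ⟨γ, hγ, e⟩ := chartProjection_eq_iff.1 e.symm
  exact ⟨γ, hγ, e.symm⟩

/-- Near `p` the projection is a plot of `X`, which lifts through the chart of `q`. -/
theorem exists_local_lift {p q : ChartUnion A} (h : chartProjection A p = chartProjection A q) :
    ∃ f : EuclideanSpace ℝ (Fin n) → EuclideanSpace ℝ (Fin n), ContDiff ℝ ∞ f ∧
      f p.coord = q.coord ∧ ∀ᶠ x in 𝓝 p.coord, ∃ (hx : x ∈ (A p.1).V) (hfx : f x ∈ (A q.1).V),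
        chartProjection A ⟨q.1, f x, hfx⟩ = chartProjection A ⟨p.1, x, hx⟩ := by
  obtain ⟨b, hb, hbV, hbp⟩ := exists_contDiff_mem_eventually_eq_self p.coord
    ((A p.1).V.isOpen.mem_nhds p.2.2)
  have h1 : IsPlot fun y => chartProjection A ⟨p.1, b y, hbV y⟩ :=
    isPlot_chartProjection (q := fun y => ⟨b y, hbV y⟩) hb
  have hbpe : b p.coord = p.coord := hbp.self_of_nhds
  have hpe : chartProjection A ⟨p.1, b p.coord, hbV p.coord⟩ = chartProjection A q := by
    rw [← h]; congr 2; exact Subtype.ext hbpe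
  obtain ⟨f, hf, e⟩ := exists_lift h1 p.coord (i := q.1) (by
    rw [hpe]; exact chartProjection_mem q)
  have e0 := e.self_of_nhds
  rw [hpe] at e0
  -- The lift only has to meet the orbit of `q`; an element of the structure group moves its value
  -- to `q` itself.
  obtain ⟨γ, hγ, hγe⟩ := chartProjection_eq_iff.1 e0
  refine ⟨fun x => γ (f x), ?_, hγe, ?_⟩
  · have : ContDiff ℝ ∞ γ := by
      have h1 : (γ : EuclideanSpace ℝ (Fin n) → EuclideanSpace ℝ (Fin n)) =
          fun z => LinearMap.toContinuousLinearMap (γ.linear : _ →ₗ[ℝ] _) z + γ 0 := by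
        ext1 z
        simpa using congrFun γ.toAffineMap.decomp z
      rw [h1]
      exact (ContinuousLinearMap.contDiff _).add contDiff_const
    exact this.comp hf
  · filter_upwards [e, hbp, (A p.1).V.isOpen.mem_nhds p.2.2] with x hx hbx hxV
    refine ⟨hxV, (A q.1).invariant γ hγ _ (f x).2, ?_⟩
    have h2 : chartProjection A ⟨q.1, f x⟩ =
        chartProjection A ⟨q.1, γ (f x), (A q.1).invariant γ hγ _ (f x).2⟩ :=
      chartProjection_eq_iff.2 ⟨γ, hγ, rfl⟩
    rw [← h2, hx]
    congr 2; exact Subtype.ext hbx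

theorem chartProjection_smul {i : ι} {γ : EuclideanSpace ℝ (Fin n) ≃ᵃ[ℝ] EuclideanSpace ℝ (Fin n)}
    (hγ : γ ∈ (A i).Γ) (x : (A i).V) :
    chartProjection A ⟨i, γ x, (A i).invariant γ hγ x x.2⟩ = chartProjection A ⟨i, x⟩ :=
  (chartProjection_eq_iff.2 ⟨γ, hγ, rfl⟩).symm

/-- The fibres of the projection are the orbits of the structural pseudogroup. -/
theorem exists_mem_structuralPseudogroup {p q : ChartUnion A}
    (h : chartProjection A p = chartProjection A q) :
    ∃ ψ ∈ structuralPseudogroup A, p ∈ ψ.source ∧ ψ p = q := by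
  obtain ⟨f, hf, hfp, hfpr⟩ := exists_local_lift h
  obtain ⟨g₀, hg₀, hgq, hgpr⟩ := exists_local_lift h.symm
  have hfc : Filter.Tendsto f (𝓝 p.coord) (𝓝 q.coord) := by
    simpa [hfp] using hf.continuous.tendsto p.coord
  have hg₀c : Filter.Tendsto g₀ (𝓝 q.coord) (𝓝 p.coord) := by
    simpa [hgq] using hg₀.continuous.tendsto q.coord
  -- `g₀ ∘ f` lifts the identity of `V/Γ`, so its germ is some `γ ∈ Γ`. Replacing `g₀` by `γ⁻¹ ∘ g₀`
  -- makes it a left inverse of `f`.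
  obtain ⟨γ, hγ, hγe⟩ := eventuallyEq_of_chartProjection_eq (A := A) (i := p.1)
      (f := g₀ ∘ f) (x := p.coord) (hg₀.comp hf).contDiffAt (by
    filter_upwards [hfpr, hfc.eventually hgpr] with x ⟨hx, hfx, e⟩ ⟨hx', hgx, e'⟩
    exact ⟨hx, hgx, e'.trans e⟩)
  have hγp : γ p.coord = p.coord := by
    rw [← hγe.eq_of_nhds, Function.comp_apply, hfp, hgq]
  set g := fun y => γ⁻¹ (g₀ y) with hg_def
  have hgs : ContDiff ℝ ∞ g := (contDiff_affineEquiv γ⁻¹).comp hg₀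
  have hgf : ∀ᶠ x in 𝓝 p.coord, g (f x) = x := by
    filter_upwards [hγe] with x hx
    change γ⁻¹ ((g₀ ∘ f) x) = x
    rw [hx]
    exact γ.symm_apply_apply x
  have hgq' : g q.coord = p.coord := by rw [← hfp]; exact hgf.self_of_nhds
  have hgc : Filter.Tendsto g (𝓝 q.coord) (𝓝 p.coord) := by
    simpa [hgq'] using hgs.continuous.tendsto q.coord
  obtain ⟨δ, hδ, hδe⟩ := eventuallyEq_of_chartProjection_eq (A := A) (i := q.1)
      (f := f ∘ g) (x := q.coord) (hf.comp hgs).contDiffAt (by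
    filter_upwards [hgpr, hgc.eventually hfpr] with y ⟨hy, hgy, e⟩ ⟨hy', hfy, e'⟩
    refine ⟨hy, hfy, ?_⟩
    rw [← e]
    exact e'.trans (chartProjection_smul ((A p.1).Γ.inv_mem hγ) ⟨g₀ y, hgy⟩))
  have hδq : δ q.coord = q.coord := by
    rw [← hδe.eq_of_nhds, Function.comp_apply, hgq', hfp]
  have hδc : Filter.Tendsto δ (𝓝 q.coord) (𝓝 q.coord) := by
    simpa [hδq] using (contDiff_affineEquiv δ).continuous.tendsto q.coord
  -- The germ `δ` of `f ∘ g` is idempotent because `g ∘ f = id`. An idempotent injective map is the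
  -- identity.
  have hfg : ∀ᶠ y in 𝓝 q.coord, f (g y) = y := by
    filter_upwards [hδe, hδc.eventually hδe, hgc.eventually hgf] with y h1 h2 h3
    simp only [Function.comp_apply] at h1 h2
    rw [← h1, h3, h1] at h2
    rw [h1]
    exact (δ.injective h2).symm
  -- On `O₁ ∩ f⁻¹ O₂` and `O₂ ∩ g⁻¹ O₁` the germ identities hold at every point, so `f` and `g` are
  -- mutually inverse there.
  obtain ⟨O₁, hO₁, hO₁o, hpO₁⟩ := eventually_nhds_iff.1 (hgf.and hfpr)
  obtain ⟨O₂, hO₂, hO₂o, hqO₂⟩ := eventually_nhds_iff.1 hfg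
  let e : OpenPartialHomeomorph (EuclideanSpace ℝ (Fin n)) (EuclideanSpace ℝ (Fin n)) :=
    { toFun := f
      invFun := g
      source := O₁ ∩ f ⁻¹' O₂
      target := O₂ ∩ g ⁻¹' O₁
      map_source' := fun x hx => ⟨hx.2, by
        rw [mem_preimage, (hO₁ x hx.1).1]; exact hx.1⟩
      map_target' := fun y hy => ⟨hy.2, by
        rw [mem_preimage, hO₂ y hy.1]; exact hy.1⟩
      left_inv' := fun x hx => (hO₁ x hx.1).1
      right_inv' := fun y hy => hO₂ y hy.1
      open_source := hO₁o.inter (hO₂o.preimage hf.continuous)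
      open_target := hO₂o.inter (hO₁o.preimage hgs.continuous)
      continuousOn_toFun := hf.continuous.continuousOn
      continuousOn_invFun := hgs.continuous.continuousOn }
  have hp : p ∈ (chartConj p q e).source := by
    refine mem_chartConj_source_iff.2 ⟨rfl, ⟨hpO₁, ?_⟩, ?_⟩
    · rw [mem_preimage, hfp]; exact hqO₂
    · change f p.coord ∈ _
      rw [hfp]; exact q.2.2
  refine ⟨chartConj p q e, mem_structuralPseudogroup_iff.2
    ⟨contMDiffOn_chartConj hf.contDiffOn, ?_, fun r hr => ?_⟩, hp, ?_⟩
  · have := contMDiffOn_chartConj (p := q) (q := p) (e := e.symm) hgs.contDiffOn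
    rwa [← chartConj_symm] at this
  · obtain ⟨h1, h2, h3⟩ := mem_chartConj_source_iff.1 hr
    obtain ⟨h4, h5, h6⟩ := (hO₁ _ h2.1).2
    rw [chartConj_apply hr]
    refine h6.trans ?_
    obtain ⟨i, z⟩ := r
    obtain rfl : i = p.1 := h1
    rfl
  · rw [chartConj_apply hp]
    exact Sigma.ext rfl (heq_of_eq (Subtype.ext hfp))

/-- Two elements of the structural pseudogroup with values in the same summand differ locally by
an element of the structure group. -/
theorem exists_eventually_coord_eq {e e' : OpenPartialHomeomorph (ChartUnion A) (ChartUnion A)}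
    (he : e ∈ structuralPseudogroup A) (he' : e' ∈ structuralPseudogroup A) {p : ChartUnion A}
    (hp : p ∈ e.source) (hp' : p ∈ e'.source) (h : (e p).1 = (e' p).1) :
    ∃ γ ∈ (A (e p).1).Γ, ∀ᶠ q in 𝓝 p, (e' q).coord = γ (e q).coord := by
  set c := chartAt (EuclideanSpace ℝ (Fin n)) (e p)
  have he1 := mem_structuralPseudogroup_iff.1 he
  have he2 := mem_structuralPseudogroup_iff.1 he'
  have hcs : ∀ y ∈ (A (e p).1).V, ContMDiffAt 𝓘(ℝ, EuclideanSpace ℝ (Fin n))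
    𝓘(ℝ, EuclideanSpace ℝ (Fin n)) ∞ c.symm y := fun y hy =>
    contMDiffAt_chartAt_disjUnion_symm (e p) hy
  have hV : (e p).coord ∈ (A (e p).1).V := (e p).2.2
  have hcp : c.symm (e p).coord = e p := chartAt_disjUnion_symm_apply (e p) (e p).2
  -- In coordinates `e' ∘ e⁻¹` is a local lift of the identity of `V/Γ` for the common target
  -- summand, so it is given by an element of `Γ`.
  have hsmooth : ContMDiffAt 𝓘(ℝ, EuclideanSpace ℝ (Fin n)) 𝓘(ℝ, EuclideanSpace ℝ (Fin n)) ∞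
      (fun y => (e' (e.symm (c.symm y))).coord) (e p).coord := by
    have h1 : ContMDiffAt 𝓘(ℝ, EuclideanSpace ℝ (Fin n)) 𝓘(ℝ, EuclideanSpace ℝ (Fin n)) ∞
        (e.symm ∘ c.symm) (e p).coord := by
      refine ContMDiffAt.comp _ ?_ (hcs _ hV)
      rw [hcp]
      exact he1.2.1.contMDiffAt (e.open_target.mem_nhds (e.map_source hp))
    have h2 : (e.symm ∘ c.symm) (e p).coord = p := by
      rw [Function.comp_apply, hcp, e.left_inv hp]
    have h3 : ContMDiffAt 𝓘(ℝ, EuclideanSpace ℝ (Fin n)) 𝓘(ℝ, EuclideanSpace ℝ (Fin n)) ∞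
        (DisjUnion.coord ∘ e') p := ContMDiffAt.comp _ DisjUnion.contMDiff_coord.contMDiffAt
      (he2.1.contMDiffAt (e'.open_source.mem_nhds hp'))
    rw [← h2] at h3
    exact h3.comp _ h1
  have htend : Filter.Tendsto (fun y => e.symm (c.symm y)) (𝓝 (e p).coord) (𝓝 p) := by
    have h1 : ContinuousAt c.symm (e p).coord := (hcs _ hV).continuousAt
    have h2 := e.continuousAt_symm (e.map_source hp)
    rw [← hcp] at h2
    have := h2.comp h1
    change Filter.Tendsto (e.symm ∘ c.symm) _ _
    simpa [ContinuousAt, hcp, e.left_inv hp] using this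
  obtain ⟨γ, hγ, hγe⟩ := eventuallyEq_of_chartProjection_eq (A := A) (i := (e p).1)
      (contMDiffAt_iff_contDiffAt.1 hsmooth) (by
    have h1 : ∀ᶠ q in 𝓝 p, q ∈ e'.source ∧ q ∈ e.source ∧ (e' q).1 = (e p).1 := by
      filter_upwards [e'.open_source.mem_nhds hp', e.open_source.mem_nhds hp,
        (e'.continuousAt hp').eventually (DisjUnion.eventually_fst_eq (e' p))] with q h1 h2 h3
      exact ⟨h1, h2, h3.trans h.symm⟩
    have h2 : ∀ᶠ z in 𝓝 (e p), z ∈ e.target := e.open_target.mem_nhds (e.map_source hp)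
    have h3 : Filter.Tendsto c.symm (𝓝 (e p).coord) (𝓝 (e p)) := by
      simpa [ContinuousAt, hcp] using (hcs _ hV).continuousAt
    filter_upwards [htend.eventually h1, h3.eventually h2, (A (e p).1).V.isOpen.mem_nhds hV]
      with y ⟨h4, h5, h6⟩ h7 h8
    have h9 : c.symm y = ⟨(e p).1, y, h8⟩ := chartAt_disjUnion_symm_apply (e p) ⟨y, h8⟩
    have h10 := he2.2.2 _ h4
    rw [← he1.2.2 _ h5, e.right_inv h7, h9] at h10
    rw [h9] at h6
    refine ⟨h8, ?_, ?_⟩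
    · rw [h9]; exact DisjUnion.coord_mem h6
    · refine Eq.trans ?_ h10
      exact congrArg _ (DisjUnion.ext h6.symm
        (congrArg (fun z => (e' (e.symm z)).coord) h9)))
  refine ⟨γ, hγ, ?_⟩
  have h1 : Filter.Tendsto (fun q => (e q).coord) (𝓝 p) (𝓝 (e p).coord) :=
    (DisjUnion.contMDiff_coord.continuous.continuousAt.comp (e.continuousAt hp))
  filter_upwards [h1.eventually hγe, e.open_source.mem_nhds hp,
    (e.continuousAt hp).eventually (DisjUnion.eventually_fst_eq (e p))] with q hq hqs hq1
  rw [← hq]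
  have h2 : c.symm (e q).coord = e q := by
    have := c.left_inv (x := e q) (by rw [chartAt_disjUnion_source]; exact hq1)
    rwa [chartAt_disjUnion_apply hq1] at this
  rw [h2, e.left_inv hqs]

/-- The action of an element of the structure group on its summand. -/
def structureGroupAction (q : ChartUnion A)
    (γ : EuclideanSpace ℝ (Fin n) ≃ᵃ[ℝ] EuclideanSpace ℝ (Fin n)) :
    OpenPartialHomeomorph (ChartUnion A) (ChartUnion A) :=
  chartConj q q (AffineEquiv.toContinuousAffineEquiv γ).toHomeomorph.toOpenPartialHomeomorph

theorem structureGroupAction_mem (q : ChartUnion A)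
    {γ : EuclideanSpace ℝ (Fin n) ≃ᵃ[ℝ] EuclideanSpace ℝ (Fin n)} (hγ : γ ∈ (A q.1).Γ) :
    structureGroupAction q γ ∈ structuralPseudogroup A := by
  refine mem_structuralPseudogroup_iff.2
    ⟨contMDiffOn_chartConj (contDiff_affineEquiv γ).contDiffOn, ?_, fun r hr => ?_⟩
  · have := contMDiffOn_chartConj (p := q) (q := q)
      (e := (AffineEquiv.toContinuousAffineEquiv γ).toHomeomorph.toOpenPartialHomeomorph.symm)
      (contDiff_affineEquiv γ⁻¹).contDiffOn
    rwa [← chartConj_symm] at this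
  · have h1 := (mem_chartConj_source_iff.1 hr).1
    rw [structureGroupAction, chartConj_apply hr]
    obtain ⟨i, z⟩ := r
    obtain rfl : i = q.1 := h1
    exact chartProjection_smul hγ z

theorem mem_structureGroupAction_source_iff {q r : ChartUnion A}
    {γ : EuclideanSpace ℝ (Fin n) ≃ᵃ[ℝ] EuclideanSpace ℝ (Fin n)} (hγ : γ ∈ (A q.1).Γ) :
    r ∈ (structureGroupAction q γ).source ↔ r.1 = q.1 := by
  refine mem_chartConj_source_iff.trans ⟨fun h => h.1, fun h => ⟨h, mem_univ _, ?_⟩⟩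
  refine (A q.1).invariant γ hγ _ ?_
  rw [← h]
  exact r.2.2

/-- The structural pseudogroup of a countable atlas is countably generated. -/
theorem exists_pseudogroupGeneratedBy [Countable ι] :
    ∃ ψ : ℕ → OpenPartialHomeomorph (ChartUnion A) (ChartUnion A),
      PseudogroupGeneratedBy (structuralPseudogroup A) ψ := by
  classical
  let Ψ := structuralPseudogroup A
  -- `D j` consists of the points that the pseudogroup can move into the summand `j`. Points outside
  -- `D j` receive the identity as a default choice.
  let D : ι → Set (ChartUnion A) := fun j => {p | ∃ e ∈ Ψ, p ∈ e.source ∧ (e p).1 = j}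
  have hD : ∀ j, ∀ p : ChartUnion A, ∃ e ∈ Ψ, p ∈ D j → p ∈ e.source ∧ (e p).1 = j := by
    intro j p
    by_cases hp : p ∈ D j
    · obtain ⟨e, he, h⟩ := hp
      exact ⟨e, he, fun _ => h⟩
    · exact ⟨_, Ψ.id_mem, fun h => absurd h hp⟩
  choose e he heD using hD
  -- Lindelöf: countably many elements suffice to move all of `D j` into the summand `j`.
  have hcov : ∀ j, ∃ t ⊆ D j, t.Countable ∧
      D j ⊆ ⋃ x ∈ t, (e j x).source ∩ (e j x) ⁻¹' {q | q.1 = j} := fun j =>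
    countable_cover_nhdsWithin fun p hp => mem_nhdsWithin_of_mem_nhds
      (((e j p).isOpen_inter_preimage (DisjUnion.isOpen_fiber j)).mem_nhds (heD j p hp))
  choose t htD htc htcov using hcov
  -- The identity is included so that `S` is nonempty and can be enumerated by `ℕ`.
  let S : Set (OpenPartialHomeomorph (ChartUnion A) (ChartUnion A)) :=
    insert (OpenPartialHomeomorph.refl _) (⋃ j, ⋃ p ∈ t j, ⋃ γ ∈ (A (e j p p).1).Γ,
      {(e j p).trans (structureGroupAction (e j p p) γ)})
  have hSc : S.Countable := by
    refine Countable.insert _ (countable_iUnion fun j => (htc j).biUnion fun p _ => ?_)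
    have := (A (e j p p).1).countable_Γ
    exact (to_countable (SetLike.coe (A (e j p p).1).Γ)).biUnion fun γ _ => countable_singleton _
  have hSΨ : ∀ f ∈ S, f ∈ Ψ := by
    rintro f (rfl | hf)
    · exact Ψ.id_mem
    · simp only [mem_iUnion, mem_singleton_iff] at hf
      obtain ⟨j, p, -, γ, hγ, rfl⟩ := hf
      exact Ψ.trans (he j p) (structureGroupAction_mem _ hγ)
  obtain ⟨ψ, hψ⟩ := hSc.exists_eq_range ⟨_, mem_insert _ _⟩
  have hψS : ∀ k, ψ k ∈ S := fun k => hψ ▸ mem_range_self k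
  refine ⟨ψ, fun f => ⟨fun hf G hG hGψ => ?_, fun h => h Ψ inferInstance fun k => hSΨ _ (hψS k)⟩⟩
  -- Near `p`, both `f` and one of the chosen `e j x` land in the summand `j`. So `f` is `e j x`
  -- followed by an element of the structure group, which is a member of `S`.
  refine StructureGroupoid.mem_of_eventuallyEq G fun p hp => ?_
  have hpD : p ∈ D (f p).1 := ⟨f, hf, hp, rfl⟩
  obtain ⟨x, hx⟩ := mem_iUnion.1 (htcov _ hpD)
  obtain ⟨hxt, hpx, hpx'⟩ := mem_iUnion.1 hx
  set j := (f p).1 with hj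
  have hxx := (heD j x (htD j hxt)).2
  obtain ⟨γ, hγ, hγe⟩ := exists_eventually_coord_eq (he j x) hf hpx hp hpx'
  have hγ' : γ ∈ (A (e j x x).1).Γ := by
    have h1 : (e j x p).1 = (e j x x).1 := hpx'.trans hxx.symm
    rwa [← h1]
  have hmem : (e j x).trans (structureGroupAction (e j x x) γ) ∈ S := by
    refine mem_insert_of_mem _ ?_
    simp only [mem_iUnion, mem_singleton_iff]
    exact ⟨j, x, hxt, γ, hγ', rfl⟩
  rw [hψ] at hmem
  obtain ⟨k, hk⟩ := hmem
  refine ⟨ψ k, hGψ k, ?_, ?_⟩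
  · rw [hk, OpenPartialHomeomorph.trans_source]
    exact ⟨hpx, (mem_structureGroupAction_source_iff hγ').2 (hpx'.trans hxx.symm)⟩
  · filter_upwards [hγe, (f.continuousAt hp).eventually (DisjUnion.eventually_fst_eq (f p)),
      ((e j x).isOpen_inter_preimage (DisjUnion.isOpen_fiber j)).mem_nhds ⟨hpx, hpx'⟩]
      with q h1 h2 h3
    have h4 : e j x q ∈ (structureGroupAction (e j x x) γ).source :=
      (mem_structureGroupAction_source_iff hγ').2 (Eq.trans h3.2 hxx.symm)
    rw [hk, OpenPartialHomeomorph.trans_apply, structureGroupAction, chartConj_apply h4]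
    exact DisjUnion.ext (h2.trans hxx.symm) h1

end Atlas

/-! ### The topology of the realization -/

section RealizationTopology

variable {N : Type*} [TopologicalSpace N] {ψ : ℕ → OpenPartialHomeomorph N N}

theorem mem_realizationDomain_iff {v : N × ℝ × ℝ} : v ∈ realizationDomain ψ ↔
    v.2.2 ∈ Ioo (0 : ℝ) 1 ∨ ∃ k : ℕ, v.1 ∈ (ψ k).source ∧
      v.2.1 ∈ Ioo ((k : ℝ) + 1) (k + 2) ∧ v.2.2 ∈ Ioo (0 : ℝ) 3 := by
  change v ∈ (_ ∪ _ : Set _) ↔ _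
  simp

/-- The intervals `(k + 1, k + 2)` are disjoint. -/
theorem eq_of_mem_Ioo_nat {k l : ℕ} {s : ℝ} (hk : s ∈ Ioo ((k : ℝ) + 1) (k + 2))
    (hl : s ∈ Ioo ((l : ℝ) + 1) (l + 2)) : k = l := by
  have h1 : (k : ℝ) < l + 1 := by linarith [hk.1, hl.2]
  have h2 : (l : ℝ) < k + 1 := by linarith [hl.1, hk.2]
  have h1' : k < l + 1 := by exact_mod_cast h1
  have h2' : l < k + 1 := by exact_mod_cast h2
  omega

/-- No point is both a source and a target of the gluing, so the generated equivalence relation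
needs no chains. -/
theorem RealizationRel.lt {v w : realizationDomain ψ} (h : RealizationRel ψ v w) :
    2 < v.1.2.2 ∧ w.1.2.2 < 1 := by
  obtain ⟨k, -, -, ht, e⟩ := h
  refine ⟨ht.1, ?_⟩
  rw [e]
  linarith [ht.2]

theorem RealizationRel.right_unique {v w w' : realizationDomain ψ} (h : RealizationRel ψ v w)
    (h' : RealizationRel ψ v w') : w = w' := by
  obtain ⟨k, -, hs, -, e⟩ := h
  obtain ⟨l, -, hs', -, e'⟩ := h'
  obtain rfl := eq_of_mem_Ioo_nat hs hs'
  exact Subtype.ext (e.trans e'.symm)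

/-- The coordinate `s` is preserved and determines the index `k`; then injectivity of `ψ k` recovers
the point. -/
theorem RealizationRel.left_unique {v v' w : realizationDomain ψ} (h : RealizationRel ψ v w)
    (h' : RealizationRel ψ v' w) : v = v' := by
  obtain ⟨k, hx, hs, -, e⟩ := h
  obtain ⟨l, hx', hs', -, e'⟩ := h'
  rw [e] at e'
  simp only [Prod.mk.injEq] at e'
  obtain ⟨e1, e2, e3⟩ := e'
  obtain rfl := eq_of_mem_Ioo_nat hs (e2 ▸ hs')
  exact Subtype.ext (Prod.ext ((ψ k).injOn hx hx' e1) (Prod.ext e2 (by linarith)))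

/-- A chain of two gluings either collapses, by uniqueness of sources and targets, or would need a
height both above 2 and below 1. -/
theorem Realization.mk_eq_iff {v w : realizationDomain ψ} :
    Realization.mk v = Realization.mk w ↔
      v = w ∨ RealizationRel ψ v w ∨ RealizationRel ψ w v := by
  refine ⟨fun h => ?_, ?_⟩
  · have hE := Quot.eqvGen_exact h
    clear h
    induction hE with
    | rel _ _ h => exact .inr (.inl h)
    | refl => exact .inl rfl
    | symm _ _ _ ih =>
      tauto
    | trans _ _ _ _ _ ih ih' =>
      rcases ih with rfl | h1 | h1 <;>
      rcases ih' with rfl | h2 | h2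
      · exact .inl rfl
      · exact .inr (.inl h2)
      · exact .inr (.inr h2)
      · exact .inr (.inl h1)
      · linarith [h1.lt.2, h2.lt.1]
      · exact .inl (h1.left_unique h2)
      · exact .inr (.inr h1)
      · exact .inl (h1.right_unique h2)
      · linarith [h1.lt.1, h2.lt.2]
  · rintro (rfl | h | h)
    · rfl
    · exact Quot.sound h
    · exact (Quot.sound h).symm

theorem Realization.mk_surjective : Function.Surjective (Realization.mk (ψ := ψ)) :=
  Quot.mk_surjective

theorem Realization.continuous_mk : Continuous (Realization.mk (ψ := ψ)) :=
  continuous_quot_mk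

/-- The map `(x, s, t) ↦ (ρ x, s, t + δ)`. -/
def shiftMap {N N' : Type*} (ρ : N → N') (δ : ℝ) (v : N × ℝ × ℝ) : N' × ℝ × ℝ :=
  (ρ v.1, v.2.1, v.2.2 + δ)

theorem shiftMap_zero_id {N : Type*} (v : N × ℝ × ℝ) : shiftMap id 0 v = v := by
  simp [shiftMap]

theorem continuousAt_shiftMap {N' : Type*} [TopologicalSpace N'] {ρ : N → N'} {δ : ℝ}
    {v : N × ℝ × ℝ} (h : ContinuousAt ρ v.1) : ContinuousAt (shiftMap ρ δ) v := by
  unfold shiftMap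
  exact (ContinuousAt.comp (f := Prod.fst) h continuousAt_fst).prodMk (by fun_prop)

/-- Identified points of the domain are related by a map `(x, s, t) ↦ (ρ x, s, t + δ)`, where
`ρ` belongs to the pseudogroup, that preserves the quotient map locally. -/
theorem Realization.exists_shiftMap (Ψ : StructureGroupoid N) (hψ : ∀ k, ψ k ∈ Ψ)
    {v w : realizationDomain ψ} (h : Realization.mk v = Realization.mk w) :
    ∃ ρ ∈ Ψ, ∃ δ : ℝ, v.1.1 ∈ ρ.source ∧ w.1 = shiftMap ρ δ v.1 ∧
      ∀ᶠ u : realizationDomain ψ in 𝓝 v, ∃ hu : shiftMap ρ δ u.1 ∈ realizationDomain ψ,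
        Realization.mk ⟨shiftMap ρ δ u.1, hu⟩ = Realization.mk u := by
  rcases Realization.mk_eq_iff.1 h with rfl | ⟨k, hx, hs, ht, e⟩ | ⟨k, hx, hs, ht, e⟩
  · refine ⟨_, Ψ.id_mem, 0, mem_univ _, (shiftMap_zero_id _).symm, .of_forall fun u => ?_⟩
    have h1 : shiftMap (OpenPartialHomeomorph.refl N) 0 u.1 = u.1 := shiftMap_zero_id _
    exact ⟨h1.symm ▸ u.2, congrArg Realization.mk (Subtype.ext h1)⟩
  · refine ⟨ψ k, hψ k, -2, hx, e, ?_⟩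
    have h1 : Continuous fun u : realizationDomain ψ => u.1.1 := by fun_prop
    have h2 : Continuous fun u : realizationDomain ψ => u.1.2.1 := by fun_prop
    have h3 : Continuous fun u : realizationDomain ψ => u.1.2.2 := by fun_prop
    filter_upwards [((ψ k).open_source.preimage h1).mem_nhds hx,
      (isOpen_Ioo.preimage h2).mem_nhds hs, (isOpen_Ioo.preimage h3).mem_nhds ht] with u hux hus hut
    have hm : shiftMap (ψ k) (-2) u.1 ∈ realizationDomain ψ := mem_realizationDomain_iff.2
      (.inl ⟨by simp only [shiftMap]; linarith [hut.1], by simp only [shiftMap]; linarith [hut.2]⟩)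
    exact ⟨hm, Realization.mk_eq_iff.2 (.inr (.inr ⟨k, hux, hus, hut, rfl⟩))⟩
  · have hx' : v.1.1 ∈ (ψ k).target := by rw [e]; exact (ψ k).map_source hx
    have hs' : v.1.2.1 ∈ Ioo ((k : ℝ) + 1) (k + 2) := by rw [e]; exact hs
    have ht' : v.1.2.2 ∈ Ioo (0 : ℝ) 1 := by
      rw [e]; exact ⟨by linarith [ht.1], by linarith [ht.2]⟩
    refine ⟨(ψ k).symm, Ψ.symm (hψ k), 2, hx', ?_, ?_⟩
    · rw [e]
      simp [shiftMap, (ψ k).left_inv hx]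
    have h1 : Continuous fun u : realizationDomain ψ => u.1.1 := by fun_prop
    have h2 : Continuous fun u : realizationDomain ψ => u.1.2.1 := by fun_prop
    have h3 : Continuous fun u : realizationDomain ψ => u.1.2.2 := by fun_prop
    filter_upwards [((ψ k).open_target.preimage h1).mem_nhds hx',
      (isOpen_Ioo.preimage h2).mem_nhds hs', (isOpen_Ioo.preimage h3).mem_nhds ht']
      with u hux hus hut
    have hux' := (ψ k).map_target hux
    have hut' : u.1.2.2 + 2 ∈ Ioo (2 : ℝ) 3 := ⟨by linarith [hut.1], by linarith [hut.2]⟩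
    have hm : shiftMap (ψ k).symm 2 u.1 ∈ realizationDomain ψ := mem_realizationDomain_iff.2
      (.inr ⟨k, hux', hus, ⟨by simp only [shiftMap]; linarith [hut.1], hut'.2⟩⟩)
    refine ⟨hm, Realization.mk_eq_iff.2 (.inr (.inl ⟨k, hux', hus, hut', ?_⟩))⟩
    exact Prod.ext ((ψ k).right_inv hux).symm (Prod.ext rfl (by simp [shiftMap]))

theorem Realization.eventually_exists_shiftMap_mem {ρ : OpenPartialHomeomorph N N} {δ : ℝ}
    {v w : realizationDomain ψ} (hv : v.1.1 ∈ ρ.source) (hw : w.1 = shiftMap ρ δ v.1)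
    {U : Set (realizationDomain ψ)} (hU : U ∈ 𝓝 w) :
    ∀ᶠ u : realizationDomain ψ in 𝓝 v, ∀ hu : shiftMap ρ δ u.1 ∈ realizationDomain ψ,
      ⟨shiftMap ρ δ u.1, hu⟩ ∈ U := by
  rw [nhds_subtype_eq_comap] at hU
  obtain ⟨O, hO, hOU⟩ := Filter.mem_comap.1 hU
  rw [hw] at hO
  have h1 : ContinuousAt (fun u : realizationDomain ψ => shiftMap ρ δ u.1) v :=
    ContinuousAt.comp (continuousAt_shiftMap (ρ.continuousAt hv)) continuousAt_subtype_val
  filter_upwards [h1 hO] with u hu hu'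
  exact hOU hu

/-- Identified points have neighbourhoods related by a continuous shift that preserves classes, so
saturations of open sets are open. -/
theorem Realization.isOpenMap_mk : IsOpenMap (Realization.mk (ψ := ψ)) := by
  intro U hU
  refine isOpen_coinduced.2 (isOpen_iff_mem_nhds.2 ?_)
  rintro v ⟨w, hw, e⟩
  -- Only continuity of `ρ` matters here, so the pseudogroup of all local homeomorphisms serves.
  obtain ⟨ρ, -, δ, hv, hvw, h⟩ := Realization.exists_shiftMap (continuousGroupoid N)
    (fun _ => mem_groupoid_of_pregroupoid.2 ⟨trivial, trivial⟩) e.symm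
  filter_upwards [h, Realization.eventually_exists_shiftMap_mem hv hvw (hU.mem_nhds hw)]
    with u ⟨hu, e'⟩ hu'
  exact ⟨_, hu' hu, e'⟩

instance [SecondCountableTopology N] : SecondCountableTopology (Realization ψ) :=
  Realization.mk_surjective |> fun h =>
    (IsOpenQuotientMap.isQuotientMap ⟨h, Realization.continuous_mk,
      Realization.isOpenMap_mk⟩).secondCountableTopology Realization.isOpenMap_mk

/-- The part of the domain where the quotient map is injective: the subset `t < 2` or `1 < t`. -/
def halfDomain (ψ : ℕ → OpenPartialHomeomorph N N) (a : Bool) : Set (realizationDomain ψ) :=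
  if a then {v | v.1.2.2 < 2} else {v | 1 < v.1.2.2}

theorem isOpen_halfDomain (a : Bool) : IsOpen (halfDomain ψ a) := by
  have h3 : Continuous fun u : realizationDomain ψ => u.1.2.2 := by fun_prop
  cases a
  · exact isOpen_lt continuous_const h3
  · exact isOpen_lt h3 continuous_const

theorem injOn_halfDomain (a : Bool) : InjOn Realization.mk (halfDomain ψ a) := by
  intro v hv w hw e
  rcases Realization.mk_eq_iff.1 e with h | h | h
  · exact h
  all_goals
    have := h.lt
    cases a <;> simp [halfDomain] at hv hw <;> linarith

theorem exists_mem_halfDomain (v : realizationDomain ψ) : ∃ a, v ∈ halfDomain ψ a := by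
  by_cases h : v.1.2.2 < 2
  · exact ⟨true, h⟩
  · exact ⟨false, show 1 < v.1.2.2 by linarith⟩

/-- The quotient map on a half of the domain, as a local homeomorphism. -/
def halfMk (ψ : ℕ → OpenPartialHomeomorph N N) (v₀ : realizationDomain ψ) (a : Bool) :
    OpenPartialHomeomorph (realizationDomain ψ) (Realization ψ) :=
  haveI : Nonempty (realizationDomain ψ) := ⟨v₀⟩
  OpenPartialHomeomorph.ofContinuousOpen ((injOn_halfDomain (ψ := ψ) a).toPartialEquiv _ _)
    Realization.continuous_mk.continuousOn Realization.isOpenMap_mk (isOpen_halfDomain a)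

theorem mk_halfMk_symm (v₀ : realizationDomain ψ) (a : Bool) {m : Realization ψ}
    (hm : m ∈ (halfMk ψ v₀ a).target) : Realization.mk ((halfMk ψ v₀ a).symm m) = m :=
  (halfMk ψ v₀ a).right_inv hm

/-- A height above 2 is lowered by 2 through the gluing. The interval `(0, 2]` is a fundamental
domain for `t` modulo 2. -/
theorem exists_mk_eq_mem_Ioc (m : Realization ψ) :
    ∃ v : realizationDomain ψ, Realization.mk v = m ∧ v.1.2.2 ∈ Ioc (0 : ℝ) 2 := by
  obtain ⟨v, rfl⟩ := Realization.mk_surjective m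
  by_cases h : v.1.2.2 ≤ 2
  · refine ⟨v, rfl, ?_, h⟩
    rcases mem_realizationDomain_iff.1 v.2 with h | ⟨-, -, -, h⟩ <;> exact h.1
  · rcases mem_realizationDomain_iff.1 v.2 with h' | ⟨k, hx, hs, ht⟩
    · linarith [h'.2]
    · rw [not_le] at h
      have hm : ((ψ k v.1.1, v.1.2.1, v.1.2.2 - 2) : N × ℝ × ℝ) ∈ realizationDomain ψ :=
        mem_realizationDomain_iff.2 (.inl ⟨by simpa using h, by simp; linarith [ht.2]⟩)
      refine ⟨⟨_, hm⟩, Realization.mk_eq_iff.2 (.inr (.inr ⟨k, hx, hs, ⟨h, ht.2⟩, rfl⟩)), ?_, ?_⟩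
      · simpa using h
      · simp; linarith [ht.2]

/-- Gluing changes `t` by 2, so `t` modulo 2 is a continuous map to a circle that separates points
with different values. Points with equal values have representatives of equal height, hence in a
common half, where the quotient map is injective and open. -/
instance [T2Space N] : T2Space (Realization ψ) := by
  let θ : Realization ψ → AddCircle (2 : ℝ) := Quot.lift (fun v => ((v.1.2.2 : ℝ) : AddCircle (2 : ℝ))) (by
    rintro v w ⟨k, -, -, -, e⟩
    rw [e]
    simp [AddCircle.coe_period])
  have hθ : Continuous θ := by
    refine continuous_quot_lift _ ?_
    exact (AddCircle.continuous_mk' 2).comp (by fun_prop)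
  refine ⟨fun m m' hne => ?_⟩
  by_cases hmm : θ m = θ m'
  · obtain ⟨v, rfl, hv⟩ := exists_mk_eq_mem_Ioc m
    obtain ⟨w, rfl, hw⟩ := exists_mk_eq_mem_Ioc m'
    have hvw : v.1.2.2 = w.1.2.2 := by
      -- The two heights in `(0, 2]` differ by a multiple of 2 and by less than 2.
      have h1 : ((v.1.2.2 - w.1.2.2 : ℝ) : AddCircle (2 : ℝ)) = 0 := by
        rw [AddCircle.coe_sub, sub_eq_zero]
        exact hmm
      obtain ⟨z, hz⟩ := (AddCircle.coe_eq_zero_iff 2).1 h1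
      have h2 : -1 < (z : ℝ) := by simp at hz; linarith [hv.1, hw.2]
      have h3 : (z : ℝ) < 1 := by simp at hz; linarith [hv.2, hw.1]
      have h2' : -1 < z := by exact_mod_cast h2
      have h3' : z < 1 := by exact_mod_cast h3
      obtain rfl : z = 0 := by omega
      simp at hz
      linarith
    obtain ⟨a, ha⟩ := exists_mem_halfDomain v
    have hb : w ∈ halfDomain ψ a := by
      cases a <;> simpa [halfDomain, hvw] using ha
    obtain ⟨U, U', hU, hU', hvU, hwU', hd⟩ := t2_separation (x := v) (y := w)
      (fun h => hne (h ▸ rfl))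
    refine ⟨Realization.mk '' (U ∩ halfDomain ψ a), Realization.mk '' (U' ∩ halfDomain ψ a),
      Realization.isOpenMap_mk _ (hU.inter (isOpen_halfDomain a)),
      Realization.isOpenMap_mk _ (hU'.inter (isOpen_halfDomain a)), ⟨v, ⟨hvU, ha⟩, rfl⟩,
      ⟨w, ⟨hwU', hb⟩, rfl⟩, ?_⟩
    rw [disjoint_left]
    rintro _ ⟨u, ⟨hu, hua⟩, rfl⟩ ⟨u', ⟨hu', hua'⟩, e⟩
    have := injOn_halfDomain a hua' hua e
    subst this
    exact disjoint_left.1 hd hu hu'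
  · obtain ⟨U, U', hU, hU', h1, h2, hd⟩ := t2_separation hmm
    exact ⟨_, _, hU.preimage hθ, hU'.preimage hθ, h1, h2, hd.preimage θ⟩

end RealizationTopology

/-! ### Coordinate representations of maps of the disjoint union -/

section CoordRep

variable {ι : Type*} {n : ℕ} {V : ι → Opens (EuclideanSpace ℝ (Fin n))}

/-- The coordinate representation near `p` of a map of the disjoint union. -/
def coordRep (ρ : DisjUnion V → DisjUnion V) (p : DisjUnion V) :
    EuclideanSpace ℝ (Fin n) → EuclideanSpace ℝ (Fin n) :=
  fun x => (ρ ((chartAt (EuclideanSpace ℝ (Fin n)) p).symm x)).coord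

theorem chartAt_disjUnion_symm_coord {p q : DisjUnion V} (h : q.1 = p.1) :
    (chartAt (EuclideanSpace ℝ (Fin n)) p).symm q.coord = q := by
  obtain ⟨i, x⟩ := p
  obtain ⟨j, y⟩ := q
  obtain rfl : j = i := h
  exact chartAt_disjUnion_symm_apply _ _

theorem coordRep_coord (ρ : DisjUnion V → DisjUnion V) {p q : DisjUnion V} (h : q.1 = p.1) :
    coordRep ρ p q.coord = (ρ q).coord := by
  rw [coordRep, chartAt_disjUnion_symm_coord h]

theorem tendsto_chartAt_disjUnion_symm (p : DisjUnion V) :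
    Filter.Tendsto (chartAt (EuclideanSpace ℝ (Fin n)) p).symm (𝓝 p.coord) (𝓝 p) := by
  have h := (contMDiffAt_chartAt_disjUnion_symm p p.2.2).continuousAt
  have h' : (chartAt (EuclideanSpace ℝ (Fin n)) p).symm (p.2 : EuclideanSpace ℝ (Fin n)) = p :=
    chartAt_disjUnion_symm_coord rfl
  rwa [ContinuousAt, h'] at h

theorem contDiffAt_coordRep {ρ : DisjUnion V → DisjUnion V} {p : DisjUnion V}
    (h : ContMDiffAt 𝓘(ℝ, EuclideanSpace ℝ (Fin n)) 𝓘(ℝ, EuclideanSpace ℝ (Fin n)) ∞ ρ p) :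
    ContDiffAt ℝ ∞ (coordRep ρ p) p.coord := by
  rw [← contMDiffAt_iff_contDiffAt]
  have h1 := (DisjUnion.contMDiff_coord (V := V)).contMDiffAt.comp p h
  have h' : (chartAt (EuclideanSpace ℝ (Fin n)) p).symm p.coord = p :=
    chartAt_disjUnion_symm_coord rfl
  rw [← h'] at h1
  exact h1.comp p.coord (contMDiffAt_chartAt_disjUnion_symm p p.2.2)

/-- The derivative of the coordinate representation of a local diffeomorphism is bijective. -/
theorem bijective_fderiv_coordRep {ρ : OpenPartialHomeomorph (DisjUnion V) (DisjUnion V)}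
    (h : ContMDiffOn 𝓘(ℝ, EuclideanSpace ℝ (Fin n)) 𝓘(ℝ, EuclideanSpace ℝ (Fin n)) ∞ ρ ρ.source)
    (h' : ContMDiffOn 𝓘(ℝ, EuclideanSpace ℝ (Fin n)) 𝓘(ℝ, EuclideanSpace ℝ (Fin n)) ∞
      ρ.symm ρ.target) {p : DisjUnion V} (hp : p ∈ ρ.source) :
    Function.Bijective (fderiv ℝ (coordRep ρ p) p.coord) := by
  have h1 := contDiffAt_coordRep (h.contMDiffAt (ρ.open_source.mem_nhds hp))
  have h2 := contDiffAt_coordRep (h'.contMDiffAt (ρ.open_target.mem_nhds (ρ.map_source hp)))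
  have hc : coordRep ρ p p.coord = (ρ p).coord := coordRep_coord ρ rfl
  have h3 : coordRep ρ.symm (ρ p) ∘ coordRep ρ p =ᶠ[𝓝 p.coord] id := by
    filter_upwards [(tendsto_chartAt_disjUnion_symm p).eventually
        ((ρ.continuousAt hp).eventually (DisjUnion.eventually_fst_eq (ρ p))),
      (tendsto_chartAt_disjUnion_symm p).eventually (ρ.open_source.mem_nhds hp),
      (V p.1).isOpen.mem_nhds p.2.2] with x hx hx' hxV
    rw [Function.comp_apply, coordRep, coordRep, chartAt_disjUnion_symm_coord hx,
      ρ.left_inv hx', chartAt_disjUnion_symm_apply p ⟨x, hxV⟩]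
    rfl
  have h4 := (h2.differentiableAt (by simp)).hasFDerivAt
  rw [← hc] at h4
  have h5 := (h4.comp _ (h1.differentiableAt (by simp)).hasFDerivAt).unique
    ((hasFDerivAt_id p.coord).congr_of_eventuallyEq h3)
  have hinj : Function.Injective (fderiv ℝ (coordRep ρ p) p.coord) := fun u w huw => by
    have := DFunLike.congr_fun h5 u
    have h6 := DFunLike.congr_fun h5 w
    simp only [ContinuousLinearMap.comp_apply, ContinuousLinearMap.id_apply] at this h6
    rw [← this, ← h6, huw]
  exact ⟨hinj, LinearMap.injective_iff_surjective.1 hinj⟩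

end CoordRep

/-! ### The manifold structure of the realization -/

section RealizationManifold

variable {ι : Type*} {n : ℕ} {V : ι → Opens (EuclideanSpace ℝ (Fin n))}
  {ψ : ℕ → OpenPartialHomeomorph (DisjUnion V) (DisjUnion V)}

/-- The coordinates `(x, s, t)` of a point of the domain. -/
def domainCoord (w : realizationDomain ψ) : EuclideanSpace ℝ (Fin n) × ℝ × ℝ :=
  (w.1.1.coord, w.1.2)

theorem chartAt_realizationDomain_source (v : realizationDomain ψ) :
    (chartAt (RealizationModel n) v).source = {w | w.1.1.1 = v.1.1.1} := by
  ext w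
  change w ∈ ((chartAt (RealizationModel n) v.1).subtypeRestr ⟨v⟩).source ↔ _
  rw [OpenPartialHomeomorph.subtypeRestr_source]
  change w.1 ∈ (OpenPartialHomeomorph.prod _ _).source ↔ _
  simp only [OpenPartialHomeomorph.prod_source, mem_prod, chartAt_disjUnion_source]
  exact and_iff_left ⟨mem_univ _, mem_univ _⟩

theorem chartAt_realizationDomain_apply {v w : realizationDomain ψ} (h : w.1.1.1 = v.1.1.1) :
    chartAt (RealizationModel n) v w = domainCoord w := by
  change (chartAt (EuclideanSpace ℝ (Fin n)) v.1.1 w.1.1, w.1.2) = _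
  rw [chartAt_disjUnion_apply h]
  rfl

theorem chartAt_realizationDomain_symm_domainCoord {v w : realizationDomain ψ}
    (h : w.1.1.1 = v.1.1.1) : (chartAt (RealizationModel n) v).symm (domainCoord w) = w := by
  rw [← chartAt_realizationDomain_apply h]
  exact (chartAt (RealizationModel n) v).left_inv (by rwa [chartAt_realizationDomain_source])

/-- The chart of the realization given by a summand and a half of the domain. -/
def realizationChart (v : realizationDomain ψ) (a : Bool) :
    OpenPartialHomeomorph (Realization ψ) (RealizationModel n) :=
  (halfMk ψ v a).symm.trans (chartAt (RealizationModel n) v)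

theorem mem_realizationChart_source_iff {v : realizationDomain ψ} {a : Bool} {m : Realization ψ} :
    m ∈ (realizationChart v a).source ↔
      ∃ w ∈ halfDomain ψ a, w.1.1.1 = v.1.1.1 ∧ Realization.mk w = m := by
  rw [realizationChart, OpenPartialHomeomorph.trans_source, chartAt_realizationDomain_source]
  constructor
  · rintro ⟨h1, h2⟩
    exact ⟨_, (halfMk ψ v a).map_target h1, h2, mk_halfMk_symm v a h1⟩
  · rintro ⟨w, hw, h, rfl⟩
    have h1 : Realization.mk w ∈ (halfMk ψ v a).target := (halfMk ψ v a).map_source hw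
    refine ⟨h1, ?_⟩
    have h2 : (halfMk ψ v a).symm (Realization.mk w) = w := (halfMk ψ v a).left_inv hw
    change ((halfMk ψ v a).symm (Realization.mk w)).1.1.1 = v.1.1.1
    rwa [h2]

theorem realizationChart_mk {v w : realizationDomain ψ} {a : Bool} (hw : w ∈ halfDomain ψ a)
    (h : w.1.1.1 = v.1.1.1) : realizationChart v a (Realization.mk w) = domainCoord w := by
  have h2 : (halfMk ψ v a).symm (Realization.mk w) = w := (halfMk ψ v a).left_inv hw
  change chartAt (RealizationModel n) v ((halfMk ψ v a).symm (Realization.mk w)) = _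
  rw [h2, chartAt_realizationDomain_apply h]

instance : ChartedSpace (RealizationModel n) (Realization ψ) where
  atlas := {c | ∃ v a, c = realizationChart v a}
  chartAt m := realizationChart (Realization.mk_surjective m).choose
    (exists_mem_halfDomain (Realization.mk_surjective m).choose).choose
  mem_chart_source m := mem_realizationChart_source_iff.2
    ⟨_, (exists_mem_halfDomain (Realization.mk_surjective m).choose).choose_spec, rfl,
      (Realization.mk_surjective m).choose_spec⟩
  chart_mem_atlas _ := ⟨_, _, rfl⟩

/-- In charts, the quotient map has locally the form `(x, s, t) ↦ (h x, s, t + δ)`. -/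
theorem exists_realizationChart_mk_eq (Ψ : StructureGroupoid (DisjUnion V)) (hψ : ∀ k, ψ k ∈ Ψ)
    {u v : realizationDomain ψ} {b : Bool}
    (hu : Realization.mk u ∈ (realizationChart v b).source) :
    ∃ ρ ∈ Ψ, ∃ δ : ℝ, u.1.1 ∈ ρ.source ∧ (ρ u.1.1).1 = v.1.1.1 ∧ ∀ᶠ u' in 𝓝 u,
      realizationChart v b (Realization.mk u') = shiftMap (coordRep ρ u.1.1) δ (domainCoord u') := by
  obtain ⟨w, hw, hwv, e⟩ := mem_realizationChart_source_iff.1 hu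
  obtain ⟨ρ, hρ, δ, hus, hwu, hev⟩ := Realization.exists_shiftMap Ψ hψ e.symm
  have hρw : ρ u.1.1 = w.1.1 := by rw [hwu]; rfl
  refine ⟨ρ, hρ, δ, hus, hρw ▸ hwv, ?_⟩
  have hc : ContinuousAt (fun u' : realizationDomain ψ => u'.1.1) u := by fun_prop
  filter_upwards [hev, Realization.eventually_exists_shiftMap_mem hus hwu
      ((isOpen_halfDomain b).mem_nhds hw),
    hc.eventually (DisjUnion.eventually_fst_eq u.1.1),
    hc.eventually ((ρ.continuousAt hus).eventually (DisjUnion.eventually_fst_eq (ρ u.1.1)))]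
    with u' ⟨hm, e'⟩ hb h1 h2
  rw [← e', realizationChart_mk (hb hm) (h2.trans (hρw ▸ hwv))]
  change ((ρ u'.1.1).coord, _) = (coordRep ρ u.1.1 u'.1.1.coord, _)
  rw [coordRep_coord _ h1]
  rfl

theorem exists_mem_source_realizationChart {v : realizationDomain ψ} {a : Bool}
    {m : Realization ψ} (hm : m ∈ (realizationChart v a).source) :
    ∃ u ∈ halfDomain ψ a, u.1.1.1 = v.1.1.1 ∧ Realization.mk u = m ∧
      realizationChart v a m = domainCoord u := by
  obtain ⟨u, hu, huv, rfl⟩ := mem_realizationChart_source_iff.1 hm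
  exact ⟨u, hu, huv, rfl, realizationChart_mk hu huv⟩

/-- Changes of charts have locally the form `(x, s, t) ↦ (h x, s, t + δ)`. -/
theorem exists_realizationChart_eq (Ψ : StructureGroupoid (DisjUnion V)) (hψ : ∀ k, ψ k ∈ Ψ)
    {v v' : realizationDomain ψ} {a b : Bool} {m : Realization ψ}
    (hm : m ∈ (realizationChart v a).source) (hm' : m ∈ (realizationChart v' b).source) :
    ∃ ρ ∈ Ψ, ∃ δ : ℝ, ∃ p : DisjUnion V, p ∈ ρ.source ∧ p.1 = v.1.1.1 ∧ (ρ p).1 = v'.1.1.1 ∧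
      p.coord = (realizationChart v a m).1 ∧ ∀ᶠ m' in 𝓝 m,
        realizationChart v' b m' = shiftMap (coordRep ρ p) δ (realizationChart v a m') := by
  obtain ⟨u, hu, huv, rfl, e⟩ := exists_mem_source_realizationChart hm
  obtain ⟨ρ, hρ, δ, hus, h1, h2⟩ := exists_realizationChart_mk_eq Ψ hψ hm'
  refine ⟨ρ, hρ, δ, u.1.1, hus, huv, h1, by rw [e]; rfl, ?_⟩
  have hc : Filter.Tendsto (halfMk ψ v a).symm (𝓝 (Realization.mk u)) (𝓝 u) := by
    have h3 := (halfMk ψ v a).continuousAt_symm ((halfMk ψ v a).map_source hu)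
    have h4 := (halfMk ψ v a).left_inv hu
    rwa [ContinuousAt, h4] at h3
  filter_upwards [hc.eventually h2, (realizationChart v a).open_source.mem_nhds hm,
    (halfMk ψ v a).open_target.mem_nhds ((halfMk ψ v a).map_source hu)] with m' h3 h4 h5
  rw [mk_halfMk_symm v a h5] at h3
  rw [h3]
  obtain ⟨w, hw, hwv, rfl, e'⟩ := exists_mem_source_realizationChart h4
  have h6 : (halfMk ψ v a).symm (Realization.mk w) = w := (halfMk ψ v a).left_inv hw
  rw [h6, e']

theorem contDiffAt_shiftMap {h : EuclideanSpace ℝ (Fin n) → EuclideanSpace ℝ (Fin n)} (δ : ℝ)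
    {z : EuclideanSpace ℝ (Fin n) × ℝ × ℝ} (hh : ContDiffAt ℝ ∞ h z.1) :
    ContDiffAt ℝ ∞ (shiftMap h δ) z := by
  unfold shiftMap
  exact (hh.comp z contDiffAt_fst).prodMk (by fun_prop)

/-- The block form `dh × id` controls the derivative of the quotient map, the tangent spaces of the
foliation and the invariance of the metric. -/
theorem hasFDerivAt_shiftMap {h : EuclideanSpace ℝ (Fin n) → EuclideanSpace ℝ (Fin n)} (δ : ℝ)
    {z : EuclideanSpace ℝ (Fin n) × ℝ × ℝ} (hh : ContDiffAt ℝ ∞ h z.1) :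
    HasFDerivAt (shiftMap h δ) ((fderiv ℝ h z.1).prodMap (.id ℝ (ℝ × ℝ))) z := by
  have h1 := (hh.differentiableAt (by simp)).hasFDerivAt.comp z hasFDerivAt_fst
  have h2 : HasFDerivAt (fun z : EuclideanSpace ℝ (Fin n) × ℝ × ℝ => z.2 + (0, δ))
    (ContinuousLinearMap.snd ℝ _ _) z := hasFDerivAt_snd.add_const _
  refine ((h1.prodMk h2).congr_of_eventuallyEq (.of_forall fun z => ?_)).congr_fderiv rfl
  simp [shiftMap, Prod.ext_iff]

/-- Coordinate changes are shifts by elements of `Ψ`, so they are as smooth as those elements. -/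
theorem isManifold_realization (Ψ : StructureGroupoid (DisjUnion V)) (hψ : ∀ k, ψ k ∈ Ψ)
    (hΨ : ∀ ρ ∈ Ψ, ContMDiffOn 𝓘(ℝ, EuclideanSpace ℝ (Fin n))
      𝓘(ℝ, EuclideanSpace ℝ (Fin n)) ∞ ρ ρ.source) :
    IsManifold (realizationModelWithCorners n) ∞ (Realization ψ) := by
  refine isManifold_of_contDiffOn _ _ _ ?_
  rintro _ _ ⟨v, a, rfl⟩ ⟨v', b, rfl⟩ z ⟨⟨hz1, hz2⟩, -⟩
  refine ContDiffAt.contDiffWithinAt ?_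
  change z ∈ (realizationChart v a).target at hz1
  change (realizationChart v a).symm z ∈ (realizationChart v' b).source at hz2
  change ContDiffAt ℝ ∞ (E := EuclideanSpace ℝ (Fin n) × ℝ × ℝ)
    (F := EuclideanSpace ℝ (Fin n) × ℝ × ℝ)
    (fun z => realizationChart v' b ((realizationChart v a).symm z)) z
  obtain ⟨ρ, hρ, δ, p, hp, -, -, hpz, h⟩ := exists_realizationChart_eq Ψ hψ
    ((realizationChart v a).map_target hz1) hz2
  rw [(realizationChart v a).right_inv hz1] at hpz
  have h1 : ContDiffAt ℝ ∞ (shiftMap (coordRep ρ p) δ) z := by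
    refine contDiffAt_shiftMap δ ?_
    rw [← hpz]
    exact contDiffAt_coordRep ((hΨ ρ hρ).contMDiffAt (ρ.open_source.mem_nhds hp))
  refine h1.congr_of_eventuallyEq ?_
  filter_upwards [((realizationChart v a).continuousAt_symm hz1).eventually h,
    (realizationChart v a).open_target.mem_nhds hz1] with z' h2 h3
  rw [h2, (realizationChart v a).right_inv h3]

end RealizationManifold

/-! ### Derivatives in charts -/

section ChartDerivative

variable {E H E' H' : Type*} [NormedAddCommGroup E] [NormedSpace ℝ E]
  [TopologicalSpace H] {I : ModelWithCorners ℝ E H} [NormedAddCommGroup E'] [NormedSpace ℝ E']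
  [TopologicalSpace H'] {I' : ModelWithCorners ℝ E' H'}
  {M M' : Type*} [TopologicalSpace M] [ChartedSpace H M] [TopologicalSpace M'] [ChartedSpace H' M']
  {f : M → M'} {x : M} {G : E → E'}

theorem hasMFDerivAt_of_eventuallyEq {G' : E →L[ℝ] E'} (hc : ContinuousAt f x)
    (h : writtenInExtChartAt I I' x f =ᶠ[𝓝 (extChartAt I x x)] G)
    (hG : HasFDerivAt G G' (extChartAt I x x)) : HasMFDerivAt I I' f x G' :=
  ⟨hc, (hG.congr_of_eventuallyEq h).hasFDerivWithinAt⟩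

theorem contMDiffAt_of_eventuallyEq (hc : ContinuousAt f x)
    (h : writtenInExtChartAt I I' x f =ᶠ[𝓝 (extChartAt I x x)] G)
    (hG : ContDiffAt ℝ ∞ G (extChartAt I x x)) : ContMDiffAt I I' ∞ f x :=
  contMDiffAt_iff.2 ⟨hc, (hG.congr_of_eventuallyEq h).contDiffWithinAt⟩

end ChartDerivative

/-! ### The quotient map and the tangent bundle in preferred charts -/

section Realization

variable {ι : Type*} {n : ℕ} {V : ι → Opens (EuclideanSpace ℝ (Fin n))}
  {ψ : ℕ → OpenPartialHomeomorph (DisjUnion V) (DisjUnion V)}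

/-- A representative of a point of the realization. -/
def repr (m : Realization ψ) : realizationDomain ψ := (Realization.mk_surjective m).choose

theorem mk_repr (m : Realization ψ) : Realization.mk (repr m) = m :=
  (Realization.mk_surjective m).choose_spec

/-- A half of the domain that contains the representative. -/
def half (m : Realization ψ) : Bool := (exists_mem_halfDomain (repr m)).choose

theorem repr_mem_halfDomain (m : Realization ψ) : repr m ∈ halfDomain ψ (half m) :=
  (exists_mem_halfDomain (repr m)).choose_spec

theorem chartAt_realization (m : Realization ψ) :
    chartAt (RealizationModel n) m = realizationChart (repr m) (half m) := rfl

theorem chartAt_realization_self (m : Realization ψ) :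
    chartAt (RealizationModel n) m m = domainCoord (repr m) := by
  have h : chartAt (RealizationModel n) m m =
      chartAt (RealizationModel n) m (Realization.mk (repr m)) := by rw [mk_repr]
  rw [h, chartAt_realization, realizationChart_mk (repr_mem_halfDomain m) rfl]

theorem range_realizationModelWithCorners :
    range (realizationModelWithCorners n) = univ :=
  eq_univ_of_forall fun z => ⟨z, rfl⟩

theorem tendsto_chartAt_realizationDomain_symm (v : realizationDomain ψ) :
    Filter.Tendsto (chartAt (RealizationModel n) v).symm (𝓝 (domainCoord v)) (𝓝 v) := by
  have h1 := (chartAt (RealizationModel n) v).continuousAt_symm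
    ((chartAt (RealizationModel n) v).map_source (mem_chart_source _ v))
  rwa [chartAt_realizationDomain_apply rfl, ContinuousAt,
    chartAt_realizationDomain_symm_domainCoord rfl] at h1

theorem eventually_domainCoord_chartAt_symm (v : realizationDomain ψ) :
    ∀ᶠ z in 𝓝 (domainCoord v), ((chartAt (RealizationModel n) v).symm z).1.1.1 = v.1.1.1 ∧
      domainCoord ((chartAt (RealizationModel n) v).symm z) = z := by
  have h1 := (chartAt (RealizationModel n) v).open_target.mem_nhds
    ((chartAt (RealizationModel n) v).map_source (mem_chart_source _ v))
  rw [chartAt_realizationDomain_apply rfl] at h1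
  filter_upwards [h1] with z hz
  have h2 := (chartAt (RealizationModel n) v).map_target hz
  rw [chartAt_realizationDomain_source] at h2
  refine ⟨h2, ?_⟩
  rw [← chartAt_realizationDomain_apply h2, (chartAt (RealizationModel n) v).right_inv hz]

theorem DisjUnion.eq_repr {m : Realization ψ} {p : DisjUnion V} (h : p.1 = (repr m).1.1.1)
    (h' : p.coord = (domainCoord (repr m)).1) : p = (repr m).1.1 := DisjUnion.ext h h'

theorem chartAt_disjUnion_symm_coord_eq {p : DisjUnion V} {q : DisjUnion V} (h : q.1 = p.1)
    {x : EuclideanSpace ℝ (Fin n)} (hx : q.coord = x) :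
    (chartAt (EuclideanSpace ℝ (Fin n)) p).symm x = q := by
  rw [← hx, chartAt_disjUnion_symm_coord h]

variable (Ψ : StructureGroupoid (DisjUnion V))

/-- The preferred chart at the class of `v` is built from a chosen representative that may differ
from `v`; `ρ` and `δ` account for the difference. -/
theorem writtenInExtChartAt_mk (hψ : ∀ k, ψ k ∈ Ψ) (v : realizationDomain ψ) :
    ∃ ρ ∈ Ψ, v.1.1 ∈ ρ.source ∧ ∃ δ : ℝ,
      writtenInExtChartAt (realizationModelWithCorners n) (realizationModelWithCorners n) v
        (Realization.mk (ψ := ψ)) =ᶠ[𝓝 (domainCoord v)] shiftMap (coordRep ρ v.1.1) δ := by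
  obtain ⟨ρ, hρ, δ, h1, h2, h3⟩ := exists_realizationChart_mk_eq Ψ hψ (u := v)
    (mem_chart_source (RealizationModel n) (Realization.mk v))
  refine ⟨ρ, hρ, h1, δ, ?_⟩
  filter_upwards [(tendsto_chartAt_realizationDomain_symm v).eventually h3,
    eventually_domainCoord_chartAt_symm v] with z h4 ⟨_, h5⟩
  exact Eq.trans h4 (congrArg _ h5)

theorem extChartAt_realizationDomain_self (v : realizationDomain ψ) :
    extChartAt (realizationModelWithCorners n) v v = domainCoord v :=
  chartAt_realizationDomain_apply rfl

theorem contMDiff_mk (hψ : ∀ k, ψ k ∈ Ψ) (hΨ : ∀ ρ ∈ Ψ, ContMDiffOn 𝓘(ℝ, EuclideanSpace ℝ (Fin n))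
    𝓘(ℝ, EuclideanSpace ℝ (Fin n)) ∞ ρ ρ.source) :
    ContMDiff (realizationModelWithCorners n) (realizationModelWithCorners n) ∞
      (Realization.mk (ψ := ψ)) := by
  intro v
  obtain ⟨ρ, hρ, h1, δ, h2⟩ := writtenInExtChartAt_mk Ψ hψ v
  refine contMDiffAt_of_eventuallyEq (G := shiftMap (coordRep ρ v.1.1) δ) Realization.continuous_mk.continuousAt
    (by rw [extChartAt_realizationDomain_self]; exact h2) ?_
  rw [extChartAt_realizationDomain_self]
  exact contDiffAt_shiftMap δ
    (contDiffAt_coordRep ((hΨ ρ hρ).contMDiffAt (ρ.open_source.mem_nhds h1)))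

/-- The first block is the derivative of a local diffeomorphism. This gives both the submersion
property and the images of the vertical spaces. -/
theorem hasMFDerivAt_mk (hψ : ∀ k, ψ k ∈ Ψ)
    (hΨ : ∀ ρ ∈ Ψ, ContMDiffOn 𝓘(ℝ, EuclideanSpace ℝ (Fin n))
      𝓘(ℝ, EuclideanSpace ℝ (Fin n)) ∞ ρ ρ.source) (v : realizationDomain ψ) :
    ∃ L : EuclideanSpace ℝ (Fin n) →L[ℝ] EuclideanSpace ℝ (Fin n), Function.Bijective L ∧
      HasMFDerivAt (realizationModelWithCorners n) (realizationModelWithCorners n)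
        (Realization.mk (ψ := ψ)) v (L.prodMap (.id ℝ (ℝ × ℝ))) := by
  obtain ⟨ρ, hρ, h1, δ, h2⟩ := writtenInExtChartAt_mk Ψ hψ v
  refine ⟨_, bijective_fderiv_coordRep (hΨ ρ hρ) (hΨ _ (Ψ.symm hρ)) h1,
    hasMFDerivAt_of_eventuallyEq (G := shiftMap (coordRep ρ v.1.1) δ) Realization.continuous_mk.continuousAt
    (by rw [extChartAt_realizationDomain_self]; exact h2) ?_⟩
  rw [extChartAt_realizationDomain_self]
  exact hasFDerivAt_shiftMap (z := domainCoord v) δ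
    (contDiffAt_coordRep ((hΨ ρ hρ).contMDiffAt (ρ.open_source.mem_nhds h1)))

theorem hasMFDerivAt_fst_realizationDomain (v : realizationDomain ψ) :
    HasMFDerivAt (realizationModelWithCorners n) 𝓘(ℝ, EuclideanSpace ℝ (Fin n))
      (fun w : realizationDomain ψ => w.1.1) v
      (ContinuousLinearMap.fst ℝ (EuclideanSpace ℝ (Fin n)) (ℝ × ℝ)) := by
  refine hasMFDerivAt_of_eventuallyEq (G := Prod.fst) (by fun_prop) ?_ hasFDerivAt_fst
  rw [extChartAt_realizationDomain_self]
  filter_upwards [eventually_domainCoord_chartAt_symm v] with z ⟨h1, h2⟩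
  change chartAt (EuclideanSpace ℝ (Fin n)) v.1.1
    ((chartAt (RealizationModel n) v).symm z).1.1 = z.1
  rw [chartAt_disjUnion_apply h1]
  exact congrArg Prod.fst h2

/-- The coordinate changes of the tangent bundle of the realization. -/
theorem tangentCoordChange_realization [IsManifold (realizationModelWithCorners n) ∞ (Realization ψ)]
    (hψ : ∀ k, ψ k ∈ Ψ)
    (hΨ : ∀ ρ ∈ Ψ, ContMDiffOn 𝓘(ℝ, EuclideanSpace ℝ (Fin n))
      𝓘(ℝ, EuclideanSpace ℝ (Fin n)) ∞ ρ ρ.source) {m m₀ : Realization ψ}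
    (hm : m ∈ (chartAt (RealizationModel n) m₀).source) :
    ∃ ρ ∈ Ψ, (repr m).1.1 ∈ ρ.source ∧
      ρ (repr m).1.1 = (chartAt (EuclideanSpace ℝ (Fin n)) (repr m₀).1.1).symm
        (chartAt (RealizationModel n) m₀ m).1 ∧
      tangentCoordChange (realizationModelWithCorners n) m m₀ m =
        (fderiv ℝ (coordRep ρ (repr m).1.1) (repr m).1.1.coord).prodMap (.id ℝ (ℝ × ℝ)) := by
  obtain ⟨ρ, hρ, δ, p, hp, hp1, hp2, hpc, h⟩ := exists_realizationChart_eq Ψ hψ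
    (mem_chart_source (RealizationModel n) m) hm
  have hpc' : p.coord = (chartAt (RealizationModel n) m m).1 := hpc
  rw [chartAt_realization_self] at hpc'
  -- The base point of the coordinate change has the summand and the coordinates of the chosen
  -- representative.
  obtain rfl : p = (repr m).1.1 := DisjUnion.eq_repr hp1 hpc'
  refine ⟨ρ, hρ, hp, ?_, ?_⟩
  · refine (chartAt_disjUnion_symm_coord_eq hp2 ?_).symm
    have h1 := congrArg Prod.fst h.self_of_nhds
    rw [← coordRep_coord ρ rfl]
    refine Eq.trans ?_ h1.symm
    simp only [shiftMap]
    exact congrArg _ hpc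
  · rw [tangentCoordChange_def, range_realizationModelWithCorners, fderivWithin_univ]
    have hz : extChartAt (realizationModelWithCorners n) m m = domainCoord (repr m) :=
      chartAt_realization_self m
    rw [hz]
    have h2 : extChartAt (realizationModelWithCorners n) m₀ ∘
        (extChartAt (realizationModelWithCorners n) m).symm =ᶠ[𝓝 (domainCoord (repr m))]
        shiftMap (coordRep ρ (repr m).1.1) δ := by
      rw [← hz]
      have h3 := continuousAt_extChartAt_symm (I := realizationModelWithCorners n) m
      rw [ContinuousAt, extChartAt_to_inv] at h3
      filter_upwards [h3.eventually h, extChartAt_target_mem_nhds (I := realizationModelWithCorners n) m] with z h4 h5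
      refine h4.trans ?_
      have h6 := (extChartAt (realizationModelWithCorners n) m).right_inv h5
      exact congrArg _ h6
    exact ((hasFDerivAt_shiftMap δ (contDiffAt_coordRep ((hΨ ρ hρ).contMDiffAt
      (ρ.open_source.mem_nhds hp)))).congr_of_eventuallyEq h2).fderiv

end Realization

/-! ### The foliation of the realization -/

section RealizationFoliation

variable {ι : Type*} {n : ℕ} {V : ι → Opens (EuclideanSpace ℝ (Fin n))}
  {ψ : ℕ → OpenPartialHomeomorph (DisjUnion V) (DisjUnion V)}

/-- The linear identification of `ℝⁿ × ℝ × ℝ` with `ℝ² × ℝⁿ`. -/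
def modelSwap (n : ℕ) : (EuclideanSpace ℝ (Fin n) × ℝ × ℝ) ≃L[ℝ]
    EuclideanSpace ℝ (Fin 2) × EuclideanSpace ℝ (Fin n) :=
  (ContinuousLinearEquiv.prodComm ℝ _ _).trans
    -- Any linear identification of the leaf directions serves; only the transverse factor matters
    -- for compatibility.
    (ContinuousLinearEquiv.prodCongr (ContinuousLinearEquiv.ofFinrankEq (by simp))
      (ContinuousLinearEquiv.refl ℝ _))

/-- The identification of the model space with `ℝ² × ℝⁿ`, as a homeomorphism. -/
def modelSwapHomeomorph (n : ℕ) : RealizationModel n ≃ₜ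
    EuclideanSpace ℝ (Fin 2) × EuclideanSpace ℝ (Fin n) :=
  (modelSwap n).toHomeomorph

/-- The foliated chart given by a summand and a half of the domain. -/
def foliatedChart (v : realizationDomain ψ) (a : Bool) : OpenPartialHomeomorph (Realization ψ)
    (EuclideanSpace ℝ (Fin 2) × EuclideanSpace ℝ (Fin n)) :=
  (realizationChart v a).trans (modelSwapHomeomorph n).toOpenPartialHomeomorph

theorem foliatedChart_source (v : realizationDomain ψ) (a : Bool) :
    (foliatedChart v a).source = (realizationChart v a).source := by
  simp [foliatedChart]

theorem foliatedChart_snd (v : realizationDomain ψ) (a : Bool) (m : Realization ψ) :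
    (foliatedChart v a m).2 = (realizationChart v a m).1 := rfl

variable (Ψ : StructureGroupoid (DisjUnion V))

/-- The foliation of the realization by the images of the fibres of the first projection. -/
def realizationFoliation (hψ : ∀ k, ψ k ∈ Ψ)
    (hΨ : ∀ ρ ∈ Ψ, ContMDiffOn 𝓘(ℝ, EuclideanSpace ℝ (Fin n))
      𝓘(ℝ, EuclideanSpace ℝ (Fin n)) ∞ ρ ρ.source) :
    Foliation (realizationModelWithCorners n) (Realization ψ) 2 n where
  charts := {φ | ∃ v a, φ = foliatedChart v a}
  cover m := ⟨_, ⟨repr m, half m, rfl⟩, by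
    rw [foliatedChart_source]; exact mem_chart_source (RealizationModel n) m⟩
  smooth := by
    have := isManifold_realization Ψ hψ hΨ
    rintro _ ⟨v, a, rfl⟩
    have h1 : ContMDiffOn (realizationModelWithCorners n) (realizationModelWithCorners n) ∞
        (realizationChart v a) (realizationChart v a).source :=
      contMDiffOn_of_mem_maximalAtlas (IsManifold.subset_maximalAtlas ⟨v, a, rfl⟩)
    rw [foliatedChart_source]
    exact ((modelSwap n).contDiff.contMDiff.comp
      (realizationModelWithCorners n).contMDiff).comp_contMDiffOn h1
  smooth_symm := by
    have := isManifold_realization Ψ hψ hΨ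
    rintro _ ⟨v, a, rfl⟩
    have h1 : ContMDiffOn (realizationModelWithCorners n) (realizationModelWithCorners n) ∞
        (realizationChart v a).symm (realizationChart v a).target :=
      contMDiffOn_symm_of_mem_maximalAtlas (IsManifold.subset_maximalAtlas ⟨v, a, rfl⟩)
    have h2 : ContMDiffOn 𝓘(ℝ, EuclideanSpace ℝ (Fin n) × ℝ × ℝ) (realizationModelWithCorners n) ∞
        (realizationModelWithCorners n).symm univ := by
      have := (realizationModelWithCorners n).contMDiffOn_symm (n := ∞)
      rwa [range_realizationModelWithCorners] at this
    refine h1.comp ((contMDiffOn_univ.1 h2).comp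
      (modelSwap n).symm.contDiff.contMDiff).contMDiffOn ?_
    intro z hz
    rw [foliatedChart, OpenPartialHomeomorph.trans_target] at hz
    exact hz.2
  compatible := by
    rintro _ ⟨v, a, rfl⟩ _ ⟨v', b, rfl⟩ m ⟨hm, hm'⟩
    rw [foliatedChart_source] at hm hm'
    obtain ⟨ρ, -, δ, p, -, -, -, -, h⟩ := exists_realizationChart_eq Ψ hψ hm hm'
    -- The `x`-component of a shift depends on `x` alone.
    refine ⟨coordRep ρ p, ?_⟩
    filter_upwards [h] with m' h'
    rw [foliatedChart_snd, foliatedChart_snd, h']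
    rfl

theorem hasMFDerivAt_foliatedChart_snd (hψ : ∀ k, ψ k ∈ Ψ)
    (hΨ : ∀ ρ ∈ Ψ, ContMDiffOn 𝓘(ℝ, EuclideanSpace ℝ (Fin n))
      𝓘(ℝ, EuclideanSpace ℝ (Fin n)) ∞ ρ ρ.source) {m : Realization ψ}
    {v : realizationDomain ψ} {a : Bool} (hm : m ∈ (realizationChart v a).source) :
    ∃ L : EuclideanSpace ℝ (Fin n) →L[ℝ] EuclideanSpace ℝ (Fin n), Function.Bijective L ∧
      HasMFDerivAt (realizationModelWithCorners n) 𝓘(ℝ, EuclideanSpace ℝ (Fin n))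
        (fun m' => (foliatedChart v a m').2) m (L.comp (.fst ℝ _ (ℝ × ℝ))) := by
  have hm₀ : m ∈ (realizationChart (repr m) (half m)).source :=
    mem_chart_source (RealizationModel n) m
  obtain ⟨ρ, hρ, δ, p, hp, hp1, hp2, hpc, h⟩ := exists_realizationChart_eq Ψ hψ hm₀ hm
  refine ⟨_, bijective_fderiv_coordRep (hΨ ρ hρ) (hΨ _ (Ψ.symm hρ)) hp,
    hasMFDerivAt_of_eventuallyEq (G := coordRep ρ p ∘ Prod.fst) ?_ ?_ ?_⟩
  · have h1 := (foliatedChart v a).continuousAt (x := m) (by rwa [foliatedChart_source])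
    exact h1.snd
  · have h3 := continuousAt_extChartAt_symm (I := realizationModelWithCorners n) m
    rw [ContinuousAt, extChartAt_to_inv] at h3
    filter_upwards [h3.eventually h,
      extChartAt_target_mem_nhds (I := realizationModelWithCorners n) m] with z h4 h5
    have h6 := (extChartAt (realizationModelWithCorners n) m).right_inv h5
    exact (congrArg Prod.fst h4).trans (congrArg (coordRep ρ p) (congrArg Prod.fst h6))
  · have h1 : (extChartAt (realizationModelWithCorners n) m m).1 = p.coord := hpc.symm
    refine HasFDerivAt.comp _ ?_ hasFDerivAt_fst
    rw [h1]
    exact ((contDiffAt_coordRep ((hΨ ρ hρ).contMDiffAt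
      (ρ.open_source.mem_nhds hp))).differentiableAt (by simp)).hasFDerivAt

/-- In the coordinates of the preferred chart, the tangent spaces to the leaves are `0 × ℝ²`. -/
theorem realizationFoliation_tangent (hψ : ∀ k, ψ k ∈ Ψ)
    (hΨ : ∀ ρ ∈ Ψ, ContMDiffOn 𝓘(ℝ, EuclideanSpace ℝ (Fin n))
      𝓘(ℝ, EuclideanSpace ℝ (Fin n)) ∞ ρ ρ.source) (m : Realization ψ) :
    (realizationFoliation Ψ hψ hΨ).tangent m =
      (LinearMap.ker (LinearMap.fst ℝ (EuclideanSpace ℝ (Fin n)) (ℝ × ℝ)) :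
        Submodule ℝ (EuclideanSpace ℝ (Fin n) × ℝ × ℝ)) := by
  -- Each foliated chart gives the same kernel, so the infimum that defines the tangent space is
  -- this common value.
  have key : ∀ v a, m ∈ (realizationChart v a).source →
      LinearMap.ker (mfderiv (realizationModelWithCorners n) 𝓘(ℝ, EuclideanSpace ℝ (Fin n))
        (fun m' => (foliatedChart v a m').2) m).toLinearMap =
      (LinearMap.ker (LinearMap.fst ℝ (EuclideanSpace ℝ (Fin n)) (ℝ × ℝ)) :
        Submodule ℝ (EuclideanSpace ℝ (Fin n) × ℝ × ℝ)) := by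
    intro v a hm
    obtain ⟨L, hL, h⟩ := hasMFDerivAt_foliatedChart_snd Ψ hψ hΨ hm
    rw [h.mfderiv]
    ext z
    change L z.1 = 0 ↔ z.1 = 0
    exact map_eq_zero_iff L hL.1
  unfold Foliation.tangent
  refine le_antisymm ?_ ?_
  · have hm₀ : m ∈ (realizationChart (repr m) (half m)).source :=
      mem_chart_source (RealizationModel n) m
    rw [← key _ _ hm₀]
    refine iInf₂_le _ ⟨⟨_, _, rfl⟩, ?_⟩
    rwa [foliatedChart_source]
  · refine le_iInf₂ ?_
    rintro _ ⟨⟨v, a, rfl⟩, hm⟩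
    rw [foliatedChart_source] at hm
    exact (key v a hm).ge

/-- The derivative of the quotient map is `L × id`, so it restricts to the identity of `0 × ℝ²`. -/
theorem realizationFoliation_tangent_mk (hψ : ∀ k, ψ k ∈ Ψ)
    (hΨ : ∀ ρ ∈ Ψ, ContMDiffOn 𝓘(ℝ, EuclideanSpace ℝ (Fin n))
      𝓘(ℝ, EuclideanSpace ℝ (Fin n)) ∞ ρ ρ.source) (v : realizationDomain ψ) :
    (realizationFoliation Ψ hψ hΨ).tangent (Realization.mk v) =
      (LinearMap.ker (mfderiv (realizationModelWithCorners n) 𝓘(ℝ, EuclideanSpace ℝ (Fin n))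
        (fun w : realizationDomain ψ => w.1.1) v).toLinearMap).map
      (mfderiv (realizationModelWithCorners n) (realizationModelWithCorners n)
        (Realization.mk (ψ := ψ)) v).toLinearMap := by
  obtain ⟨L, hL, h⟩ := hasMFDerivAt_mk Ψ hψ hΨ v
  rw [realizationFoliation_tangent, h.mfderiv, (hasMFDerivAt_fst_realizationDomain v).mfderiv]
  ext z
  constructor
  · intro hz
    change z.1 = 0 at hz
    refine ⟨z, hz, ?_⟩
    change (L z.1, z.2) = z
    rw [hz, map_zero, ← hz]
  · rintro ⟨w, hw, rfl⟩
    change w.1 = 0 at hw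
    change L w.1 = 0
    rw [hw, map_zero]

theorem mfderiv_mk_surjective (hψ : ∀ k, ψ k ∈ Ψ)
    (hΨ : ∀ ρ ∈ Ψ, ContMDiffOn 𝓘(ℝ, EuclideanSpace ℝ (Fin n))
      𝓘(ℝ, EuclideanSpace ℝ (Fin n)) ∞ ρ ρ.source) (v : realizationDomain ψ) :
    Function.Surjective (mfderiv (realizationModelWithCorners n) (realizationModelWithCorners n)
      (Realization.mk (ψ := ψ)) v) := by
  obtain ⟨L, hL, h⟩ := hasMFDerivAt_mk Ψ hψ hΨ v
  rw [h.mfderiv]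
  intro z
  obtain ⟨u, hu⟩ := hL.2 z.1
  exact ⟨(u, z.2), Prod.ext hu rfl⟩

end RealizationFoliation

/-! ### The leaf space -/

section LeafSpace

variable {ι : Type*} {n : ℕ} {V : ι → Opens (EuclideanSpace ℝ (Fin n))}
  {ψ : ℕ → OpenPartialHomeomorph (DisjUnion V) (DisjUnion V)}

/-- The section `x ↦ (x, 0, 1 / 2)` of the first projection. -/
def baseSection (ψ : ℕ → OpenPartialHomeomorph (DisjUnion V) (DisjUnion V)) (x : DisjUnion V) :
    realizationDomain ψ :=
  ⟨(x, 0, 1 / 2), mem_realizationDomain_iff.2 (.inl (by norm_num))⟩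

theorem contMDiff_baseSection {k : ℕ} {i : ι} {q : EuclideanSpace ℝ (Fin k) → V i}
    (hq : ContDiff ℝ ∞ fun r => (q r : EuclideanSpace ℝ (Fin n))) :
    ContMDiff 𝓘(ℝ, EuclideanSpace ℝ (Fin k)) (realizationModelWithCorners n) ∞
      fun r => baseSection ψ ⟨i, q r⟩ := by
  intro r
  have hqc : Continuous q := continuous_induced_rng.2 hq.continuous
  refine contMDiffAt_of_eventuallyEq
    (G := fun r => ((q r : EuclideanSpace ℝ (Fin n)), (0 : ℝ), (1 / 2 : ℝ))) ?_ ?_ ?_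
  · refine Continuous.continuousAt (Continuous.subtype_mk ?_ _)
    exact ((continuous_sigmaMk (σ := fun j => V j)).comp hqc).prodMk continuous_const
  · refine .of_forall fun r' => ?_
    change chartAt (RealizationModel n) (baseSection ψ ⟨i, q r⟩) (baseSection ψ ⟨i, q r'⟩) = _
    rw [chartAt_realizationDomain_apply (v := baseSection ψ ⟨i, q r⟩)
      (w := baseSection ψ ⟨i, q r'⟩) rfl]
    rfl
  · exact (hq.prodMk contDiff_const).contDiffAt

variable (Ψ : StructureGroupoid (DisjUnion V)) (hψ : ∀ k, ψ k ∈ Ψ)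
    (hΨ : ∀ ρ ∈ Ψ, ContMDiffOn 𝓘(ℝ, EuclideanSpace ℝ (Fin n))
      𝓘(ℝ, EuclideanSpace ℝ (Fin n)) ∞ ρ ρ.source)

/-- A convex part of a fibre inside one half is connected, and its image has constant transverse
coordinate in a single foliated chart. Hence it lies in one plaque. -/
theorem leaf_mk_eq_of_convex {S : Set (ℝ × ℝ)} (hS : Convex ℝ S) (x : DisjUnion V) (a : Bool)
    (hx : ∀ z ∈ S, ∃ h : (x, z) ∈ realizationDomain ψ, ⟨(x, z), h⟩ ∈ halfDomain ψ a)
    {v w : realizationDomain ψ} (hv : v.1.1 = x) (hw : w.1.1 = x) (hvS : v.1.2 ∈ S)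
    (hwS : w.1.2 ∈ S) :
    (realizationFoliation Ψ hψ hΨ).leaf (Realization.mk v) =
      (realizationFoliation Ψ hψ hΨ).leaf (Realization.mk w) := by
  have hva : v ∈ halfDomain ψ a := by
    obtain ⟨h, h'⟩ := hx _ hvS
    rwa [show v = ⟨(x, v.1.2), h⟩ from Subtype.ext (Prod.ext hv rfl)]
  refine Quot.sound ⟨foliatedChart v a, ⟨v, a, rfl⟩, ?_, ?_⟩
  · rw [foliatedChart_source]
    exact mem_realizationChart_source_iff.2 ⟨v, hva, rfl, rfl⟩
  let f : S → Realization ψ := fun z => Realization.mk ⟨(x, z.1), (hx z z.2).1⟩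
  have hf : Continuous f := Realization.continuous_mk.comp (by fun_prop)
  have hSc : PreconnectedSpace S := Subtype.preconnectedSpace hS.isPreconnected
  refine (isPreconnected_range hf).subset_connectedComponentIn ?_ ?_ ?_
  · refine ⟨⟨v.1.2, hvS⟩, congrArg Realization.mk (Subtype.ext (Prod.ext hv.symm rfl))⟩
  · rintro _ ⟨z, rfl⟩
    obtain ⟨h, h'⟩ := hx z z.2
    have hz : (⟨(x, z.1), h⟩ : realizationDomain ψ).1.1.1 = v.1.1.1 := by rw [hv]
    refine ⟨?_, ?_⟩
    · rw [foliatedChart_source]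
      exact mem_realizationChart_source_iff.2 ⟨_, h', hz, rfl⟩
    · rw [foliatedChart_snd, foliatedChart_snd, realizationChart_mk h' hz,
        realizationChart_mk hva rfl]
      simp [domainCoord, hv]
  · refine ⟨⟨w.1.2, hwS⟩, congrArg Realization.mk (Subtype.ext (Prod.ext hw.symm rfl))⟩

/-- The strip, the part of a column below height 2 and the part above height 1 are convex and each
lies in one half. Their overlaps connect any point of the fibre to the base section. -/
theorem leaf_mk_eq_baseSection (v : realizationDomain ψ) :
    (realizationFoliation Ψ hψ hΨ).leaf (Realization.mk v) =
      (realizationFoliation Ψ hψ hΨ).leaf (Realization.mk (baseSection ψ v.1.1)) := by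
  have h1 : ∀ w : realizationDomain ψ, w.1.2.2 ∈ Ioo (0 : ℝ) 1 →
      (realizationFoliation Ψ hψ hΨ).leaf (Realization.mk w) =
        (realizationFoliation Ψ hψ hΨ).leaf (Realization.mk (baseSection ψ w.1.1)) := by
    intro w hw
    refine leaf_mk_eq_of_convex Ψ hψ hΨ (S := univ ×ˢ Ioo 0 1) (convex_univ.prod (convex_Ioo 0 1))
      w.1.1 true ?_ rfl rfl ⟨mem_univ _, hw⟩ ⟨mem_univ _, by norm_num [baseSection]⟩
    intro z hz
    exact ⟨mem_realizationDomain_iff.2 (.inl hz.2), lt_trans hz.2.2 one_lt_two⟩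
  by_cases hv : v.1.2.2 ∈ Ioo (0 : ℝ) 1
  · exact h1 v hv
  obtain ⟨k, hx, hs, ht⟩ := (mem_realizationDomain_iff.1 v.2).resolve_left hv
  have h2 : ∀ w : realizationDomain ψ, w.1.1 = v.1.1 → w.1.2.1 ∈ Ioo ((k : ℝ) + 1) (k + 2) →
      w.1.2.2 ∈ Ioo (0 : ℝ) 2 → (realizationFoliation Ψ hψ hΨ).leaf (Realization.mk w) =
        (realizationFoliation Ψ hψ hΨ).leaf (Realization.mk (baseSection ψ v.1.1)) := by
    intro w hwx hws hwt
    have hm : (v.1.1, v.1.2.1, (1 / 2 : ℝ)) ∈ realizationDomain ψ :=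
      mem_realizationDomain_iff.2 (.inl (by norm_num))
    refine Eq.trans ?_ (h1 ⟨_, hm⟩ (by norm_num))
    refine leaf_mk_eq_of_convex Ψ hψ hΨ (S := Ioo ((k : ℝ) + 1) (k + 2) ×ˢ Ioo 0 2)
      ((convex_Ioo _ _).prod (convex_Ioo 0 2)) v.1.1 true ?_ hwx rfl ⟨hws, hwt⟩
      ⟨hs, by norm_num⟩
    intro z hz
    exact ⟨mem_realizationDomain_iff.2 (.inr ⟨k, hx, hz.1, hz.2.1, by linarith [hz.2.2]⟩), hz.2.2⟩
  by_cases hv2 : v.1.2.2 < 2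
  · exact h2 v rfl hs ⟨ht.1, hv2⟩
  -- Height `3/2` lies in both halves, so it is the relay between the two charts.
  have hm : (v.1.1, v.1.2.1, (3 / 2 : ℝ)) ∈ realizationDomain ψ :=
    mem_realizationDomain_iff.2 (.inr ⟨k, hx, hs, by norm_num⟩)
  refine Eq.trans ?_ (h2 ⟨_, hm⟩ rfl hs (by norm_num))
  refine leaf_mk_eq_of_convex Ψ hψ hΨ (S := Ioo ((k : ℝ) + 1) (k + 2) ×ˢ Ioo 1 3)
    ((convex_Ioo _ _).prod (convex_Ioo 1 3)) v.1.1 false ?_ rfl rfl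
    ⟨hs, by linarith, ht.2⟩ ⟨hs, by norm_num⟩
  intro z hz
  exact ⟨mem_realizationDomain_iff.2 (.inr ⟨k, hx, hz.1, by linarith [hz.2.1], hz.2.2⟩), hz.2.1⟩

/-- The glued points `(x, k + 3/2, 5/2)` and `(ψ k x, k + 3/2, 1/2)` lie in the fibres over `x` and
`ψ k x`, and each fibre lies in one leaf. -/
theorem leaf_baseSection_apply (k : ℕ) {x : DisjUnion V} (hx : x ∈ (ψ k).source) :
    (realizationFoliation Ψ hψ hΨ).leaf (Realization.mk (baseSection ψ (ψ k x))) =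
      (realizationFoliation Ψ hψ hΨ).leaf (Realization.mk (baseSection ψ x)) := by
  have hs : (k : ℝ) + 3 / 2 ∈ Ioo ((k : ℝ) + 1) (k + 2) := by constructor <;> linarith
  have hm : (x, (k : ℝ) + 3 / 2, (5 / 2 : ℝ)) ∈ realizationDomain ψ :=
    mem_realizationDomain_iff.2 (.inr ⟨k, hx, hs, by norm_num⟩)
  have hm' : (ψ k x, (k : ℝ) + 3 / 2, (1 / 2 : ℝ)) ∈ realizationDomain ψ :=
    mem_realizationDomain_iff.2 (.inl (by norm_num))
  have h1 := leaf_mk_eq_baseSection Ψ hψ hΨ ⟨_, hm⟩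
  have h2 := leaf_mk_eq_baseSection Ψ hψ hΨ ⟨_, hm'⟩
  have h3 : (Realization.mk ⟨_, hm⟩ : Realization ψ) = Realization.mk ⟨_, hm'⟩ :=
    Realization.mk_eq_iff.2 (.inr (.inl ⟨k, hx, hs, by norm_num, by norm_num⟩))
  rw [← h1, ← h2, h3]

/-- The pseudogroup of the transitions that preserve a map. -/
def invariancePseudogroup {N Z : Type*} [TopologicalSpace N] (f : N → Z) : StructureGroupoid N :=
  Pregroupoid.groupoid
    { property := fun e s => ∀ x ∈ s, f (e x) = f x
      comp := fun he he' _ _ _ x hx => (he' _ hx.2).trans (he x hx.1)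
      id_mem := fun _ _ => rfl
      locality := fun {_ _} _ h x hx => by
        obtain ⟨v, -, hxv, h⟩ := h x hx
        exact h x ⟨hx, hxv⟩
      congr := fun {_ _ _} _ h he x hx => by rw [h x hx, he x hx] }

theorem mem_invariancePseudogroup_iff {N Z : Type*} [TopologicalSpace N] {f : N → Z}
    {e : OpenPartialHomeomorph N N} :
    e ∈ invariancePseudogroup f ↔ ∀ x ∈ e.source, f (e x) = f x := by
  refine mem_groupoid_of_pregroupoid.trans ⟨fun h => h.1, fun h => ⟨h, fun x hx => ?_⟩⟩
  have := h _ (e.map_target hx)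
  rw [e.right_inv hx] at this
  exact this.symm

instance {N Z : Type*} [TopologicalSpace N] (f : N → Z) :
    ClosedUnderRestriction (invariancePseudogroup f) where
  closedUnderRestriction {e} he s hs := by
    rw [mem_invariancePseudogroup_iff] at he ⊢
    exact fun x hx => he x hx.1

/-- The transitions that preserve the leaf of the base section form a pseudogroup. It contains the
generators, so by minimality it contains `Ψ`. -/
theorem leaf_baseSection_eq (hgen : PseudogroupGeneratedBy Ψ ψ)
    {e : OpenPartialHomeomorph (DisjUnion V) (DisjUnion V)} (he : e ∈ Ψ) {x : DisjUnion V}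
    (hx : x ∈ e.source) :
    (realizationFoliation Ψ hψ hΨ).leaf (Realization.mk (baseSection ψ (e x))) =
      (realizationFoliation Ψ hψ hΨ).leaf (Realization.mk (baseSection ψ x)) :=
  mem_invariancePseudogroup_iff.1 ((hgen e).1 he
    (invariancePseudogroup fun x =>
      (realizationFoliation Ψ hψ hΨ).leaf (Realization.mk (baseSection ψ x))) inferInstance
    fun k => mem_invariancePseudogroup_iff.2 fun _ hx => leaf_baseSection_apply Ψ hψ hΨ k hx) x hx

/-- A function that is invariant under the transitions descends to the leaf space. -/
def leafLift {Z : Type*} (f : DisjUnion V → Z) (hf : ∀ k, ∀ x ∈ (ψ k).source, f (ψ k x) = f x) :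
    (realizationFoliation Ψ hψ hΨ).LeafSpace → Z :=
  Quot.lift (Quot.lift (fun v : realizationDomain ψ => f v.1.1) (by
    rintro v w ⟨k, hx, -, -, e⟩
    rw [e]
    exact (hf k _ hx).symm)) (by
    -- Points of one plaque have representatives in the same summand with the same transverse
    -- coordinate, hence over the same point of `N`.
    rintro m m' ⟨_, ⟨v, a, rfl⟩, hm, hm'⟩
    have h := connectedComponentIn_subset _ _ hm'
    obtain ⟨h1, h2⟩ := h
    rw [foliatedChart_source] at hm h1
    obtain ⟨u, -, hu, rfl, e⟩ := exists_mem_source_realizationChart hm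
    obtain ⟨u', -, hu', rfl, e'⟩ := exists_mem_source_realizationChart h1
    rw [foliatedChart_snd, foliatedChart_snd, e, e'] at h2
    have h3 : u'.1.1 = u.1.1 := DisjUnion.ext (hu'.trans hu.symm) h2
    change f u.1.1 = f u'.1.1
    rw [h3])

end LeafSpace

/-! ### The diffeomorphism from the leaf space to the quasifold -/

section QuasifoldLeafSpace

variable {ι : Type*} {n : ℕ} {X : Type*} [DiffeologicalSpace X] {A : ι → QuasifoldChart n X}
  {ψ : ℕ → OpenPartialHomeomorph (ChartUnion A) (ChartUnion A)}

theorem contMDiffOn_of_mem_structuralPseudogroup :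
    ∀ ρ ∈ structuralPseudogroup A, ContMDiffOn 𝓘(ℝ, EuclideanSpace ℝ (Fin n))
      𝓘(ℝ, EuclideanSpace ℝ (Fin n)) ∞ ρ ρ.source :=
  fun _ hρ => (mem_structuralPseudogroup_iff.1 hρ).1

theorem PseudogroupGeneratedBy.mem {N : Type*} [TopologicalSpace N] {Ψ : StructureGroupoid N}
    {ψ : ℕ → OpenPartialHomeomorph N N} (h : PseudogroupGeneratedBy Ψ ψ) (k : ℕ) : ψ k ∈ Ψ :=
  (h (ψ k)).2 fun _ _ h' => h' k

/-- The leaf space of the realization is diffeomorphic to the quasifold. -/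
theorem exists_leafSpace_equiv (hA : ∀ x : X, ∃ i, x ∈ (A i).U)
    (hgen : PseudogroupGeneratedBy (structuralPseudogroup A) ψ) :
    ∃ Φ : (realizationFoliation (structuralPseudogroup A) hgen.mem
        contMDiffOn_of_mem_structuralPseudogroup).LeafSpace ≃ X, DSmooth Φ ∧ DSmooth Φ.symm ∧
      ∀ v : realizationDomain ψ, Φ ((realizationFoliation (structuralPseudogroup A) hgen.mem
        contMDiffOn_of_mem_structuralPseudogroup).leaf (Realization.mk v)) =
          chartProjection A v.1.1 := by
  have hΨ := contMDiffOn_of_mem_structuralPseudogroup (A := A)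
  have hman := isManifold_realization (structuralPseudogroup A) hgen.mem hΨ
  set 𝓕 := realizationFoliation (structuralPseudogroup A) hgen.mem hΨ with h𝓕
  let f : 𝓕.LeafSpace → X := leafLift (structuralPseudogroup A) hgen.mem hΨ (chartProjection A)
    fun k x hx => (mem_structuralPseudogroup_iff.1 (hgen.mem k)).2.2 x hx
  have hf : ∀ v, f (𝓕.leaf (Realization.mk v)) = chartProjection A v.1.1 := fun v => rfl
  have hbij : Function.Bijective f := by
    constructor
    · intro l l' h
      obtain ⟨m, rfl⟩ := Quot.mk_surjective l
      obtain ⟨m', rfl⟩ := Quot.mk_surjective l'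
      obtain ⟨v, rfl⟩ := Realization.mk_surjective m
      obtain ⟨w, rfl⟩ := Realization.mk_surjective m'
      obtain ⟨e, he, hx, hxe⟩ := exists_mem_structuralPseudogroup (A := A)
        (p := v.1.1) (q := w.1.1) h
      change 𝓕.leaf (Realization.mk v) = 𝓕.leaf (Realization.mk w)
      rw [h𝓕, leaf_mk_eq_baseSection _ _ _ v, leaf_mk_eq_baseSection _ _ _ w, ← hxe]
      exact (leaf_baseSection_eq _ _ _ hgen he hx).symm
    · intro x
      obtain ⟨i, hi⟩ := hA x
      obtain ⟨y, hy⟩ := exists_chartProjection_eq hi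
      exact ⟨𝓕.leaf (Realization.mk (baseSection ψ ⟨i, y⟩)), hy⟩
  have hleaf : ∀ {k : ℕ} {p : EuclideanSpace ℝ (Fin k) → 𝓕.LeafSpace}, IsPlot p ↔
      ∀ r, ∃ q : EuclideanSpace ℝ (Fin k) → Realization ψ,
        ContMDiff 𝓘(ℝ, EuclideanSpace ℝ (Fin k)) (realizationModelWithCorners n) ∞ q ∧
        ∀ᶠ y in 𝓝 r, 𝓕.leaf (q y) = p y := by
    intro k p
    let _ : DiffeologicalSpace (Realization ψ) :=
      manifoldDiffeology (realizationModelWithCorners n) (Realization ψ)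
    refine (isPlot_quotientDiffeology_iff 𝓕.leaf Quot.mk_surjective).trans ?_
    simp only [isPlot_manifoldDiffeology_iff]
  refine ⟨Equiv.ofBijective f hbij, ?_, ?_, hf⟩
  · intro k p hp
    refine isPlot_of_locally fun r => ?_
    obtain ⟨q, hq, e⟩ := hleaf.1 hp r
    have hsrc := (hq.continuous.continuousAt (x := r)).preimage_mem_nhds
      ((chartAt (RealizationModel n) (q r)).open_source.mem_nhds (mem_chart_source _ (q r)))
    -- Once the lift to `M` is confined to one chart domain, its transverse coordinate is a globally
    -- defined smooth map into one summand, and the projection of that map is a plot of `X`.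
    obtain ⟨b, hb, hbs, hbr⟩ := exists_contDiff_mem_eventually_eq_self r hsrc
    let c : EuclideanSpace ℝ (Fin k) → EuclideanSpace ℝ (Fin n) × ℝ × ℝ := fun y =>
      extChartAt (realizationModelWithCorners n) (q r) (q (b y))
    have hc : ContDiff ℝ ∞ c := by
      rw [← contMDiff_iff_contDiff]
      intro y
      exact (contMDiffAt_extChartAt' (hbs y)).comp y
        ((hq.comp hb.contMDiff).contMDiffAt)
    have hu : ∀ y, ∃ u : realizationDomain ψ, u.1.1.1 = (repr (q r)).1.1.1 ∧
        Realization.mk u = q (b y) ∧ c y = domainCoord u := fun y => by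
      obtain ⟨u, -, h1, h2, h3⟩ := exists_mem_source_realizationChart (hbs y)
      exact ⟨u, h1, h2, h3⟩
    have hV : ∀ y, (c y).1 ∈ (A (repr (q r)).1.1.1).V := fun y => by
      obtain ⟨u, h1, -, h3⟩ := hu y
      rw [h3]
      exact DisjUnion.coord_mem h1
    refine ⟨_, isPlot_chartProjection (A := A) (i := (repr (q r)).1.1.1)
      (q := fun y => ⟨(c y).1, hV y⟩) (contDiff_fst.comp hc), ?_⟩
    filter_upwards [e, hbr] with y h1 h2
    change _ = f (p y)
    obtain ⟨u, h3, h4, h5⟩ := hu y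
    rw [← h1, ← h2, ← h4, hf, h2]
    refine congrArg _ (DisjUnion.ext h3.symm ?_)
    change (c y).1 = _
    rw [h5]
    rfl
  · intro k p hp
    refine hleaf.2 fun r => ?_
    -- Conversely, a plot of `X` lifts locally to a summand, and the base section carries the lift
    -- to `M`.
    obtain ⟨i, hi⟩ := hA (p r)
    obtain ⟨q, hq, e⟩ := exists_lift hp r hi
    refine ⟨fun y => Realization.mk (baseSection ψ ⟨i, q y⟩),
      (contMDiff_mk (structuralPseudogroup A) hgen.mem hΨ).comp (contMDiff_baseSection hq), ?_⟩
    filter_upwards [e] with y hy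
    rw [Function.comp_apply, Equiv.eq_symm_apply]
    exact hy

end QuasifoldLeafSpace

/-! ### Tensor fields and vector fields in coordinates -/

section TangentCoordinates

variable {E H : Type*} [NormedAddCommGroup E] [NormedSpace ℝ E]
  [TopologicalSpace H] {I : ModelWithCorners ℝ E H}
  {M : Type*} [TopologicalSpace M] [ChartedSpace H M] [IsManifold I ∞ M]

/-- A field of bilinear forms on the tangent spaces is smooth if it is smooth in coordinates. -/
theorem contMDiffAt_bilinear_iff (B : Π x : M, TangentSpace I x →L[ℝ] TangentSpace I x →L[ℝ] ℝ)
    (x₀ : M) :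
    ContMDiffAt I (I.prod 𝓘(ℝ, E →L[ℝ] E →L[ℝ] ℝ)) ∞
      (fun x => Bundle.TotalSpace.mk' (E →L[ℝ] E →L[ℝ] ℝ) x (B x)) x₀ ↔
    ContMDiffAt I 𝓘(ℝ, E →L[ℝ] E →L[ℝ] ℝ) ∞
      (fun x => ContinuousLinearMap.bilinearComp (E := E) (F := E) (G := ℝ) (B x)
        (tangentCoordChange I x₀ x x) (tangentCoordChange I x₀ x x)) x₀ := by
  rw [Bundle.contMDiffAt_section]
  refine Filter.EventuallyEq.contMDiffAt_iff ?_
  filter_upwards [(chartAt H x₀).open_source.mem_nhds (mem_chart_source H x₀)] with x hx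
  ext v w
  rw [hom_trivializationAt_apply]
  refine (inCoordinates_apply_eq₂ (E₁ := TangentSpace I) (E₂ := TangentSpace I)
    (E₃ := fun _ : M => ℝ) hx hx (mem_univ _)).trans ?_
  have h := TangentBundle.symmL_trivializationAt_eq_core (I := I) hx
  have h' : ∀ v, (trivializationAt E (TangentSpace I) x₀).symm x v =
      (tangentCoordChange I x₀ x x v : E) := fun v =>
    (Bundle.Trivialization.symmL_apply _ hx _).symm.trans (DFunLike.congr_fun h v)
  rw [h', h']
  simp
  rfl

theorem contMDiffAt_vectorField_iff (X : Π x : M, TangentSpace I x) (x₀ : M) :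
    ContMDiffAt I I.tangent ∞ (fun x => (⟨x, X x⟩ : TangentBundle I M)) x₀ ↔
    ContMDiffAt I 𝓘(ℝ, E) ∞ (fun x => tangentCoordChange I x x₀ x (X x)) x₀ :=
  Bundle.contMDiffAt_section x₀

theorem mfderiv_extChartAt {x x₀ : M} (hx : x ∈ (chartAt H x₀).source) :
    mfderiv I 𝓘(ℝ, E) (extChartAt I x₀) x = tangentCoordChange I x x₀ x := by
  rw [← TangentBundle.continuousLinearMapAt_trivializationAt hx,
    TangentBundle.continuousLinearMapAt_trivializationAt_eq_core hx]

/-- The coordinate representation of a vector field in the preferred chart at a point. -/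
def coordField (X : Π x : M, TangentSpace I x) (x₀ : M) (z : E) : E :=
  tangentCoordChange I ((extChartAt I x₀).symm z) x₀ ((extChartAt I x₀).symm z)
    (X ((extChartAt I x₀).symm z))

theorem mpullbackWithin_extChartAt_symm (X : Π x : M, TangentSpace I x) (x₀ : M) {z : E}
    (hz : z ∈ (extChartAt I x₀).target) :
    VectorField.mpullbackWithin 𝓘(ℝ, E) I (extChartAt I x₀).symm X (range I) z =
      coordField X x₀ z := by
  have hx := (extChartAt I x₀).map_target hz
  rw [VectorField.mpullbackWithin_apply, ContinuousLinearMap.inverse_eq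
    (mfderivWithin_extChartAt_symm_comp_mfderiv_extChartAt hz)
    (mfderiv_extChartAt_comp_mfderivWithin_extChartAt_symm hz),
    mfderiv_extChartAt (by rwa [extChartAt_source] at hx)]
  rfl

variable [I.Boundaryless]

/-- The bracket on a manifold is computed in the preferred chart, whose derivative at its own base
point is the identity of the model space. -/
theorem mlieBracket_eq_lieBracket_coordField (X Y : Π x : M, TangentSpace I x) (x₀ : M) :
    VectorField.mlieBracket I X Y x₀ =
      (VectorField.lieBracket ℝ (coordField X x₀) (coordField Y x₀) (extChartAt I x₀ x₀) : E) := by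
  have hc : ∀ X : Π x : M, TangentSpace I x,
      VectorField.mpullbackWithin 𝓘(ℝ, E) I (extChartAt I x₀).symm X (range I)
      =ᶠ[𝓝 (extChartAt I x₀ x₀)] coordField X x₀ := fun X => by
    filter_upwards [extChartAt_target_mem_nhds (I := I) x₀] with z hz
    exact mpullbackWithin_extChartAt_symm X x₀ hz
  have h : ∀ A B : E → E, VectorField.lieBracketWithin ℝ A B (range I) (extChartAt I x₀ x₀) =
      VectorField.lieBracket ℝ A B (extChartAt I x₀ x₀) := fun A B => by
    rw [I.range_eq_univ, VectorField.lieBracketWithin_univ]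
  rw [← VectorField.mlieBracketWithin_univ, VectorField.mlieBracketWithin_apply,
    mfderiv_extChartAt_self, preimage_univ, univ_inter]
  exact (DFunLike.congr_fun (ContinuousLinearMap.inverse_id (R := ℝ) (M := E)) _).trans
    ((h _ _).trans ((hc X).lieBracket_vectorField_eq (hc Y)))

theorem contDiffAt_coordField {X : Π x : M, TangentSpace I x} {x₀ : M}
    (h : ContMDiffAt I I.tangent ∞ (fun x => (⟨x, X x⟩ : TangentBundle I M)) x₀) :
    ContDiffAt ℝ ∞ (coordField X x₀) (extChartAt I x₀ x₀) := by
  rw [contMDiffAt_vectorField_iff, contMDiffAt_iff] at h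
  have h2 := h.2
  rw [I.range_eq_univ, contDiffWithinAt_univ] at h2
  exact h2

end TangentCoordinates

/-! ### The metric of the realization -/

section DisjUnionMetric

variable {ι : Type*} {n : ℕ} {V : ι → Opens (EuclideanSpace ℝ (Fin n))}

theorem mfderiv_eq_fderiv_coordRep {ρ : DisjUnion V → DisjUnion V} {p : DisjUnion V}
    (h : ContMDiffAt 𝓘(ℝ, EuclideanSpace ℝ (Fin n)) 𝓘(ℝ, EuclideanSpace ℝ (Fin n)) ∞ ρ p) :
    mfderiv 𝓘(ℝ, EuclideanSpace ℝ (Fin n)) 𝓘(ℝ, EuclideanSpace ℝ (Fin n)) ρ p =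
      fderiv ℝ (coordRep ρ p) p.coord := by
  have hp : extChartAt 𝓘(ℝ, EuclideanSpace ℝ (Fin n)) p p = p.coord := chartAt_disjUnion_apply rfl
  refine (hasMFDerivAt_of_eventuallyEq (G := coordRep ρ p) h.continuousAt ?_ ?_).mfderiv
  · rw [hp]
    filter_upwards [(tendsto_chartAt_disjUnion_symm p).eventually
      (h.continuousAt.eventually (DisjUnion.eventually_fst_eq (ρ p)))] with x hx
    exact chartAt_disjUnion_apply hx
  · rw [hp]
    exact ((contDiffAt_coordRep h).differentiableAt (by simp)).hasFDerivAt

/-- The preferred charts at points of one summand coincide. Hence the coefficients of a metric form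
a smooth function without any correction. -/
theorem tangentCoordChange_disjUnion {p q : DisjUnion V} (h : q.1 = p.1) :
    tangentCoordChange 𝓘(ℝ, EuclideanSpace ℝ (Fin n)) p q q = .id ℝ _ := by
  have h1 : achart (EuclideanSpace ℝ (Fin n)) p = achart (EuclideanSpace ℝ (Fin n)) q :=
    Subtype.ext (chartAt_disjUnion_congr h).symm
  ext1 v
  rw [tangentCoordChange, h1]
  exact (tangentBundleCore _ _).coordChange_self _ _ (mem_chart_source _ q) v

variable (g : Bundle.ContMDiffRiemannianMetric 𝓘(ℝ, EuclideanSpace ℝ (Fin n)) ∞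
  (EuclideanSpace ℝ (Fin n))
  (fun p : DisjUnion V => TangentSpace 𝓘(ℝ, EuclideanSpace ℝ (Fin n)) p))

/-- The coefficients of a metric in the standard coordinates of the disjoint union. -/
def metricCoord (p : DisjUnion V) :
    EuclideanSpace ℝ (Fin n) →L[ℝ] EuclideanSpace ℝ (Fin n) →L[ℝ] ℝ := g.inner p

theorem contMDiff_metricCoord : ContMDiff 𝓘(ℝ, EuclideanSpace ℝ (Fin n))
    𝓘(ℝ, EuclideanSpace ℝ (Fin n) →L[ℝ] EuclideanSpace ℝ (Fin n) →L[ℝ] ℝ) ∞ (metricCoord g) := by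
  intro p
  refine ((contMDiffAt_bilinear_iff g.inner p).1 (g.contMDiff p)).congr_of_eventuallyEq ?_
  filter_upwards [DisjUnion.eventually_fst_eq p] with q hq
  rw [tangentCoordChange_disjUnion hq]
  rfl

/-- The standard inner product of `ℝ²`, as a continuous bilinear form. -/
def planeForm : (ℝ × ℝ) →L[ℝ] (ℝ × ℝ) →L[ℝ] ℝ :=
  (ContinuousLinearMap.mul ℝ ℝ).bilinearComp (.fst ℝ ℝ ℝ) (.fst ℝ ℝ ℝ) +
    (ContinuousLinearMap.mul ℝ ℝ).bilinearComp (.snd ℝ ℝ ℝ) (.snd ℝ ℝ ℝ)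

theorem planeForm_apply (z w : ℝ × ℝ) : planeForm z w = z.1 * w.1 + z.2 * w.2 := rfl

variable {E : Type*} [NormedAddCommGroup E] [NormedSpace ℝ E]

/-- The product of a bilinear form with the standard inner product of `ℝ²`. -/
def prodForm (b : E →L[ℝ] E →L[ℝ] ℝ) : (E × ℝ × ℝ) →L[ℝ] (E × ℝ × ℝ) →L[ℝ] ℝ :=
  b.bilinearComp (.fst ℝ E (ℝ × ℝ)) (.fst ℝ E (ℝ × ℝ)) +
    planeForm.bilinearComp (.snd ℝ E (ℝ × ℝ)) (.snd ℝ E (ℝ × ℝ))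

theorem prodForm_apply (b : E →L[ℝ] E →L[ℝ] ℝ) (z w : E × ℝ × ℝ) :
    prodForm b z w = b z.1 w.1 + planeForm z.2 w.2 := rfl

theorem contDiff_flip {F : Type*} [NormedAddCommGroup F] [NormedSpace ℝ F] :
    ContDiff ℝ ∞ fun b : E →L[ℝ] F →L[ℝ] ℝ => b.flip := by
  let L : (E →L[ℝ] F →L[ℝ] ℝ) →L[ℝ] (F →L[ℝ] E →L[ℝ] ℝ) :=
    (ContinuousLinearMap.flipₗᵢ ℝ E F ℝ).toContinuousLinearEquiv
  exact ContinuousLinearMap.contDiff (𝕜 := ℝ) (E := E →L[ℝ] F →L[ℝ] ℝ)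
    (F := F →L[ℝ] E →L[ℝ] ℝ) L

/-- The form is affine in `b`. Restriction in each argument is composition with a fixed linear map,
with flips used to reach the second argument. -/
theorem contDiff_prodForm : ContDiff ℝ ∞ (prodForm (E := E)) := by
  refine ContDiff.add ?_ contDiff_const
  exact contDiff_flip.comp ((contDiff_flip.comp
    (contDiff_id.clm_comp contDiff_const)).clm_comp contDiff_const)

theorem prodForm_pos {b : E →L[ℝ] E →L[ℝ] ℝ} (hb : ∀ v, v ≠ 0 → 0 < b v v) (z : E × ℝ × ℝ)
    (hz : z ≠ 0) : 0 < prodForm b z z := by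
  obtain ⟨v, s, t⟩ := z
  rw [prodForm_apply, planeForm_apply]
  have h1 : 0 ≤ b v v := by
    rcases eq_or_ne v 0 with rfl | hv
    · simp
    · exact (hb v hv).le
  rcases eq_or_ne v 0 with rfl | hv
  · have : s ≠ 0 ∨ t ≠ 0 := by
      by_contra! h
      exact hz (by simp [h.1, h.2])
    rcases this with h | h
    · nlinarith [mul_self_pos.2 h, mul_self_nonneg t]
    · nlinarith [mul_self_pos.2 h, mul_self_nonneg s]
  · nlinarith [hb v hv, mul_self_nonneg t, mul_self_nonneg s]

/-- Both summands are nonnegative, so the unit ball lies in the unit ball of `b` times the square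
`[-1, 1]²`. -/
theorem isBounded_prodForm_lt {b : E →L[ℝ] E →L[ℝ] ℝ} (hb : ∀ v, v ≠ 0 → 0 < b v v)
    (h : Bornology.IsBounded {v | b v v < 1}) :
    Bornology.IsBounded {z | prodForm b z z < 1} := by
  refine (h.prod ((Metric.isBounded_Icc (-1 : ℝ) 1).prod (Metric.isBounded_Icc (-1 : ℝ) 1))).subset ?_
  rintro ⟨v, s, t⟩ hz
  rw [mem_ofPred_eq, prodForm_apply, planeForm_apply] at hz
  dsimp only at hz
  have h1 : 0 ≤ b v v := by
    rcases eq_or_ne v 0 with rfl | hv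
    · simp
    · exact (hb v hv).le
  refine ⟨?_, ⟨?_, ?_⟩, ?_, ?_⟩ <;> dsimp <;> nlinarith [mul_self_nonneg t, mul_self_nonneg s]

end DisjUnionMetric

/-! ### Gluing the product metrics -/

section Metric

variable {ι : Type*} {n : ℕ} {V : ι → Opens (EuclideanSpace ℝ (Fin n))}
  {ψ : ℕ → OpenPartialHomeomorph (DisjUnion V) (DisjUnion V)}
  (Ψ : StructureGroupoid (DisjUnion V))
  (g : Bundle.ContMDiffRiemannianMetric 𝓘(ℝ, EuclideanSpace ℝ (Fin n)) ∞
    (EuclideanSpace ℝ (Fin n))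
    (fun p : DisjUnion V => TangentSpace 𝓘(ℝ, EuclideanSpace ℝ (Fin n)) p))

/-- The coefficients of the metric of the realization in the preferred chart at `m₀`. -/
def chartForm (m₀ : Realization ψ) (z : EuclideanSpace ℝ (Fin n) × ℝ × ℝ) :
    (EuclideanSpace ℝ (Fin n) × ℝ × ℝ) →L[ℝ] (EuclideanSpace ℝ (Fin n) × ℝ × ℝ) →L[ℝ] ℝ :=
  prodForm (metricCoord g ((chartAt (EuclideanSpace ℝ (Fin n)) (repr m₀).1.1).symm z.1))

theorem contDiffAt_metricCoord_symm (p : DisjUnion V) :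
    ContDiffAt ℝ ∞ (fun x => metricCoord g ((chartAt (EuclideanSpace ℝ (Fin n)) p).symm x))
      p.coord := by
  rw [← contMDiffAt_iff_contDiffAt]
  exact (contMDiff_metricCoord g).contMDiffAt.comp _ (contMDiffAt_chartAt_disjUnion_symm p p.2.2)

theorem contDiffAt_chartForm (m₀ : Realization ψ) :
    ContDiffAt ℝ ∞ (chartForm g m₀) (extChartAt (realizationModelWithCorners n) m₀ m₀) := by
  have h : extChartAt (realizationModelWithCorners n) m₀ m₀ = domainCoord (repr m₀) :=
    chartAt_realization_self m₀
  rw [h]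
  have h1 : ContDiffAt ℝ ∞
      (fun x => metricCoord g ((chartAt (EuclideanSpace ℝ (Fin n)) (repr m₀).1.1).symm x))
      (domainCoord (repr m₀)).1 := contDiffAt_metricCoord_symm g (repr m₀).1.1
  exact (contDiff_prodForm (E := EuclideanSpace ℝ (Fin n))).contDiffAt.comp (domainCoord (repr m₀))
    (h1.comp (domainCoord (repr m₀)) contDiffAt_fst)

theorem tangentCoordChange_realization_snd
    [IsManifold (realizationModelWithCorners n) ∞ (Realization ψ)] (hψ : ∀ k, ψ k ∈ Ψ)
    (hΨ : ∀ ρ ∈ Ψ, ContMDiffOn 𝓘(ℝ, EuclideanSpace ℝ (Fin n))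
      𝓘(ℝ, EuclideanSpace ℝ (Fin n)) ∞ ρ ρ.source) {m m₀ : Realization ψ}
    (hm : m ∈ (chartAt (RealizationModel n) m₀).source)
    (z : EuclideanSpace ℝ (Fin n) × ℝ × ℝ) :
    (tangentCoordChange (realizationModelWithCorners n) m m₀ m z).2 = z.2 := by
  obtain ⟨ρ, -, -, -, h⟩ := tangentCoordChange_realization Ψ hψ hΨ hm
  rw [h]
  rfl

theorem tangentCoordChange_realization_zero
    [IsManifold (realizationModelWithCorners n) ∞ (Realization ψ)] (hψ : ∀ k, ψ k ∈ Ψ)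
    (hΨ : ∀ ρ ∈ Ψ, ContMDiffOn 𝓘(ℝ, EuclideanSpace ℝ (Fin n))
      𝓘(ℝ, EuclideanSpace ℝ (Fin n)) ∞ ρ ρ.source) {m m₀ : Realization ψ}
    (hm : m ∈ (chartAt (RealizationModel n) m₀).source) (w : ℝ × ℝ) :
    tangentCoordChange (realizationModelWithCorners n) m m₀ m
      ((0, w) : EuclideanSpace ℝ (Fin n) × ℝ × ℝ) = (0, w) := by
  obtain ⟨ρ, -, -, -, h⟩ := tangentCoordChange_realization Ψ hψ hΨ hm
  rw [h]
  exact Prod.ext (map_zero (fderiv ℝ (coordRep ρ (repr m).1.1) (repr m).1.1.coord)) rfl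

/-- The isometry hypothesis enters here: the tangent coordinate change is `dρ × id` with `ρ ∈ Ψ`, so
it preserves the product form. -/
theorem chartForm_tangentCoordChange
    [IsManifold (realizationModelWithCorners n) ∞ (Realization ψ)] (hψ : ∀ k, ψ k ∈ Ψ)
    (hΨ : ∀ ρ ∈ Ψ, ContMDiffOn 𝓘(ℝ, EuclideanSpace ℝ (Fin n))
      𝓘(ℝ, EuclideanSpace ℝ (Fin n)) ∞ ρ ρ.source)
    (hg : ∀ ρ ∈ Ψ, ∀ p ∈ ρ.source, ∀ v w : TangentSpace 𝓘(ℝ, EuclideanSpace ℝ (Fin n)) p,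
      g.inner (ρ p)
        (mfderiv 𝓘(ℝ, EuclideanSpace ℝ (Fin n)) 𝓘(ℝ, EuclideanSpace ℝ (Fin n)) ρ p v)
        (mfderiv 𝓘(ℝ, EuclideanSpace ℝ (Fin n)) 𝓘(ℝ, EuclideanSpace ℝ (Fin n)) ρ p w) =
      g.inner p v w) {m m₀ : Realization ψ}
    (hm : m ∈ (chartAt (RealizationModel n) m₀).source)
    (z w : EuclideanSpace ℝ (Fin n) × ℝ × ℝ) :
    chartForm g m₀ (extChartAt (realizationModelWithCorners n) m₀ m)
      (tangentCoordChange (realizationModelWithCorners n) m m₀ m z)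
      (tangentCoordChange (realizationModelWithCorners n) m m₀ m w) =
    prodForm (metricCoord g (repr m).1.1) z w := by
  obtain ⟨ρ, hρ, hp, hρp, h⟩ := tangentCoordChange_realization Ψ hψ hΨ hm
  have h1 := hg ρ hρ _ hp z.1 w.1
  rw [mfderiv_eq_fderiv_coordRep ((hΨ ρ hρ).contMDiffAt (ρ.open_source.mem_nhds hp)), hρp] at h1
  rw [h, prodForm_apply, chartForm, prodForm_apply]
  exact congrArg₂ (· + ·) h1 rfl

theorem chartForm_eq_bilinearComp
    [IsManifold (realizationModelWithCorners n) ∞ (Realization ψ)] (hψ : ∀ k, ψ k ∈ Ψ)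
    (hΨ : ∀ ρ ∈ Ψ, ContMDiffOn 𝓘(ℝ, EuclideanSpace ℝ (Fin n))
      𝓘(ℝ, EuclideanSpace ℝ (Fin n)) ∞ ρ ρ.source)
    (hg : ∀ ρ ∈ Ψ, ∀ p ∈ ρ.source, ∀ v w : TangentSpace 𝓘(ℝ, EuclideanSpace ℝ (Fin n)) p,
      g.inner (ρ p)
        (mfderiv 𝓘(ℝ, EuclideanSpace ℝ (Fin n)) 𝓘(ℝ, EuclideanSpace ℝ (Fin n)) ρ p v)
        (mfderiv 𝓘(ℝ, EuclideanSpace ℝ (Fin n)) 𝓘(ℝ, EuclideanSpace ℝ (Fin n)) ρ p w) =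
      g.inner p v w) {m m₀ : Realization ψ}
    (hm : m ∈ (chartAt (RealizationModel n) m₀).source) :
    (prodForm (metricCoord g (repr m).1.1)).bilinearComp
      (tangentCoordChange (realizationModelWithCorners n) m₀ m m)
      (tangentCoordChange (realizationModelWithCorners n) m₀ m m) =
    chartForm g m₀ (extChartAt (realizationModelWithCorners n) m₀ m) := by
  have h : ∀ z, tangentCoordChange (realizationModelWithCorners n) m m₀ m
      (tangentCoordChange (realizationModelWithCorners n) m₀ m m z) = z := fun z => by
    have h1 : m ∈ (extChartAt (realizationModelWithCorners n) m₀).source := by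
      rwa [extChartAt_source]
    rw [tangentCoordChange_comp ⟨⟨h1, mem_extChartAt_source m⟩, h1⟩, tangentCoordChange_self h1]
  refine ContinuousLinearMap.ext fun z => ContinuousLinearMap.ext fun w => ?_
  rw [ContinuousLinearMap.bilinearComp_apply,
    ← chartForm_tangentCoordChange Ψ g hψ hΨ hg hm, h, h]

/-- The metric of the realization that is locally the product of the given metric with the
Euclidean metric of `ℝ²`. -/
def realizationMetric
    [IsManifold (realizationModelWithCorners n) ∞ (Realization ψ)] (hψ : ∀ k, ψ k ∈ Ψ)
    (hΨ : ∀ ρ ∈ Ψ, ContMDiffOn 𝓘(ℝ, EuclideanSpace ℝ (Fin n))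
      𝓘(ℝ, EuclideanSpace ℝ (Fin n)) ∞ ρ ρ.source)
    (hg : ∀ ρ ∈ Ψ, ∀ p ∈ ρ.source, ∀ v w : TangentSpace 𝓘(ℝ, EuclideanSpace ℝ (Fin n)) p,
      g.inner (ρ p)
        (mfderiv 𝓘(ℝ, EuclideanSpace ℝ (Fin n)) 𝓘(ℝ, EuclideanSpace ℝ (Fin n)) ρ p v)
        (mfderiv 𝓘(ℝ, EuclideanSpace ℝ (Fin n)) 𝓘(ℝ, EuclideanSpace ℝ (Fin n)) ρ p w) =
      g.inner p v w) :
    Bundle.ContMDiffRiemannianMetric (realizationModelWithCorners n) ∞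
      (EuclideanSpace ℝ (Fin n) × ℝ × ℝ)
      (fun m : Realization ψ => TangentSpace (realizationModelWithCorners n) m) where
  inner m := prodForm (metricCoord g (repr m).1.1)
  symm m z w := by
    refine congrArg₂ (· + ·) (g.symm (repr m).1.1 z.1 w.1) ?_
    change planeForm _ _ = planeForm _ _
    rw [planeForm_apply, planeForm_apply, mul_comm, add_right_inj, mul_comm]
  pos m z hz := prodForm_pos (g.pos (repr m).1.1) z hz
  isVonNBounded m := (NormedSpace.isVonNBounded_iff ℝ (E := EuclideanSpace ℝ (Fin n) × ℝ × ℝ)).2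
    (isBounded_prodForm_lt (g.pos (repr m).1.1)
      ((NormedSpace.isVonNBounded_iff ℝ (E := EuclideanSpace ℝ (Fin n))).1
        (g.isVonNBounded (repr m).1.1)))
  contMDiff m₀ := by
    refine (contMDiffAt_bilinear_iff _ m₀).2 ?_
    have h := (contDiffAt_chartForm g m₀).contMDiffAt.comp m₀
      (contMDiffAt_extChartAt (I := realizationModelWithCorners n))
    refine h.congr_of_eventuallyEq ?_
    -- The fibrewise definition uses arbitrary representatives. In a fixed chart, invariance
    -- replaces it by `chartForm`, which is smooth.
    filter_upwards [(chartAt (RealizationModel n) m₀).open_source.mem_nhds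
      (mem_chart_source _ m₀)] with m hm
    exact chartForm_eq_bilinearComp Ψ g hψ hΨ hg hm

end Metric

/-! ### The metric of the realization is bundle-like -/

section BundleLike

/-- The derivative of a pairing that depends only on the first components vanishes along vectors
along which these are constant. -/
theorem exists_hasFDerivAt_pairing {E F : Type*} [NormedAddCommGroup E] [NormedSpace ℝ E]
    [NormedAddCommGroup F] [NormedSpace ℝ F] {b : F → E →L[ℝ] E →L[ℝ] ℝ} {X Y : F → E} {z : F}
    (hb : DifferentiableAt ℝ b z) (hX : DifferentiableAt ℝ X z) (hY : DifferentiableAt ℝ Y z) :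
    ∃ L : F →L[ℝ] ℝ, HasFDerivAt (fun z => b z (X z) (Y z)) L z ∧
      ∀ w, fderiv ℝ b z w = 0 → fderiv ℝ X z w = 0 → fderiv ℝ Y z w = 0 → L w = 0 := by
  refine ⟨_, (hb.hasFDerivAt.clm_apply hX.hasFDerivAt).clm_apply hY.hasFDerivAt, ?_⟩
  intro w h1 h2 h3
  simp [h1, h2, h3]

theorem eq_zero_of_planeForm {z : ℝ × ℝ} (h : ∀ w, planeForm z w = 0) : z = 0 := by
  have h1 := h (1, 0)
  have h2 := h (0, 1)
  simp only [planeForm_apply, mul_one, mul_zero, add_zero, zero_add] at h1 h2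
  exact Prod.ext h1 h2

variable {ι : Type*} {n : ℕ} {V : ι → Opens (EuclideanSpace ℝ (Fin n))}
  {ψ : ℕ → OpenPartialHomeomorph (DisjUnion V) (DisjUnion V)}
  (Ψ : StructureGroupoid (DisjUnion V))

theorem mem_realizationFoliation_tangent_iff (hψ : ∀ k, ψ k ∈ Ψ)
    (hΨ : ∀ ρ ∈ Ψ, ContMDiffOn 𝓘(ℝ, EuclideanSpace ℝ (Fin n))
      𝓘(ℝ, EuclideanSpace ℝ (Fin n)) ∞ ρ ρ.source) {m : Realization ψ}
    {z : EuclideanSpace ℝ (Fin n) × ℝ × ℝ} :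
    z ∈ (realizationFoliation Ψ hψ hΨ).tangent m ↔ z.1 = 0 := by
  rw [realizationFoliation_tangent]
  rfl

/-- The vertical vector field with constant coordinates. -/
def verticalField (w : ℝ × ℝ) (m : Realization ψ) :
    TangentSpace (realizationModelWithCorners n) m :=
  ((0, w) : EuclideanSpace ℝ (Fin n) × ℝ × ℝ)

theorem eventually_mem_source_symm (m₀ : Realization ψ) :
    ∀ᶠ z in 𝓝 (extChartAt (realizationModelWithCorners n) m₀ m₀),
      (extChartAt (realizationModelWithCorners n) m₀).symm z ∈
        (chartAt (RealizationModel n) m₀).source := by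
  filter_upwards [extChartAt_target_mem_nhds (I := realizationModelWithCorners n) m₀] with z hz
  have := (extChartAt (realizationModelWithCorners n) m₀).map_target hz
  rwa [extChartAt_source] at this

variable [IsManifold (realizationModelWithCorners n) ∞ (Realization ψ)]

/-- Coordinate changes fix `0 × ℝ²` pointwise, so a constant vertical vector defines a smooth field
on all of `M`. These fields test whether a field is foliate. -/
theorem isTangentOn_verticalField (hψ : ∀ k, ψ k ∈ Ψ)
    (hΨ : ∀ ρ ∈ Ψ, ContMDiffOn 𝓘(ℝ, EuclideanSpace ℝ (Fin n))
      𝓘(ℝ, EuclideanSpace ℝ (Fin n)) ∞ ρ ρ.source) (w : ℝ × ℝ) (U : Set (Realization ψ)) :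
    (realizationFoliation Ψ hψ hΨ).IsTangentOn (verticalField w) U := by
  refine ⟨fun m₀ _ => ContMDiffAt.contMDiffWithinAt ?_,
    fun m _ => (mem_realizationFoliation_tangent_iff Ψ hψ hΨ).2 rfl⟩
  rw [contMDiffAt_vectorField_iff]
  refine (contMDiffAt_const (c := ((0, w) : EuclideanSpace ℝ (Fin n) × ℝ × ℝ))).congr_of_eventuallyEq ?_
  filter_upwards [(chartAt (RealizationModel n) m₀).open_source.mem_nhds
    (mem_chart_source _ m₀)] with m hm
  exact tangentCoordChange_realization_zero Ψ hψ hΨ hm w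

theorem coordField_verticalField (hψ : ∀ k, ψ k ∈ Ψ)
    (hΨ : ∀ ρ ∈ Ψ, ContMDiffOn 𝓘(ℝ, EuclideanSpace ℝ (Fin n))
      𝓘(ℝ, EuclideanSpace ℝ (Fin n)) ∞ ρ ρ.source) (w : ℝ × ℝ) (m₀ : Realization ψ) :
    coordField (I := realizationModelWithCorners n) (verticalField w) m₀
      =ᶠ[𝓝 (extChartAt (realizationModelWithCorners n) m₀ m₀)] fun _ => (0, w) := by
  filter_upwards [eventually_mem_source_symm m₀] with z hz
  exact tangentCoordChange_realization_zero Ψ hψ hΨ hz w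

/-- The horizontal coordinates of a foliate vector field are constant along the leaves. -/
theorem fderiv_coordField_of_isFoliateOn (hψ : ∀ k, ψ k ∈ Ψ)
    (hΨ : ∀ ρ ∈ Ψ, ContMDiffOn 𝓘(ℝ, EuclideanSpace ℝ (Fin n))
      𝓘(ℝ, EuclideanSpace ℝ (Fin n)) ∞ ρ ρ.source) {U : Set (Realization ψ)}
    {X : Π m : Realization ψ, TangentSpace (realizationModelWithCorners n) m}
    (hX : (realizationFoliation Ψ hψ hΨ).IsFoliateOn X U) {m₀ : Realization ψ} (hm₀ : m₀ ∈ U)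
    (w : ℝ × ℝ) :
    (fderiv ℝ (coordField X m₀) (extChartAt (realizationModelWithCorners n) m₀ m₀) (0, w)).1
      = 0 := by
  -- The bracket with a constant vertical field is minus the derivative of the coordinates of `X`
  -- along `(0, w)`. Tangency says that its first component vanishes.
  have h := hX.2 _ (isTangentOn_verticalField Ψ hψ hΨ w U) m₀ hm₀
  have hv := coordField_verticalField Ψ hψ hΨ w m₀
  rw [mlieBracket_eq_lieBracket_coordField] at h
  have h' := (mem_realizationFoliation_tangent_iff Ψ hψ hΨ).1 h
  rw [VectorField.lieBracket_eq] at h'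
  dsimp only at h'
  rw [hv.fderiv_eq, hv.self_of_nhds, fderiv_fun_const] at h'
  simpa using h'

variable (g : Bundle.ContMDiffRiemannianMetric 𝓘(ℝ, EuclideanSpace ℝ (Fin n)) ∞
    (EuclideanSpace ℝ (Fin n))
    (fun p : DisjUnion V => TangentSpace 𝓘(ℝ, EuclideanSpace ℝ (Fin n)) p))

theorem snd_eq_zero_of_perpendicular (hψ : ∀ k, ψ k ∈ Ψ)
    (hΨ : ∀ ρ ∈ Ψ, ContMDiffOn 𝓘(ℝ, EuclideanSpace ℝ (Fin n))
      𝓘(ℝ, EuclideanSpace ℝ (Fin n)) ∞ ρ ρ.source)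
    (hg : ∀ ρ ∈ Ψ, ∀ p ∈ ρ.source, ∀ v w : TangentSpace 𝓘(ℝ, EuclideanSpace ℝ (Fin n)) p,
      g.inner (ρ p)
        (mfderiv 𝓘(ℝ, EuclideanSpace ℝ (Fin n)) 𝓘(ℝ, EuclideanSpace ℝ (Fin n)) ρ p v)
        (mfderiv 𝓘(ℝ, EuclideanSpace ℝ (Fin n)) 𝓘(ℝ, EuclideanSpace ℝ (Fin n)) ρ p w) =
      g.inner p v w) {m : Realization ψ} {z : EuclideanSpace ℝ (Fin n) × ℝ × ℝ}
    (hz : ∀ v ∈ (realizationFoliation Ψ hψ hΨ).tangent m,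
      (realizationMetric Ψ g hψ hΨ hg).inner m z v = 0) : z.2 = 0 := by
  refine eq_zero_of_planeForm fun w => ?_
  have h := hz ((0, w) : EuclideanSpace ℝ (Fin n) × ℝ × ℝ)
    ((mem_realizationFoliation_tangent_iff Ψ hψ hΨ).2 rfl)
  have h' : metricCoord g (repr m).1.1 z.1 0 + planeForm z.2 w = 0 := h
  rwa [map_zero, zero_add] at h'

/-- Perpendicularity removes the `ℝ²` components. What remains is the metric of `N` at `x` applied
to the horizontal components of the two fields. The metric does not depend on `(s, t)`, and the
horizontal components have zero vertical derivative. -/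
theorem realizationFoliation_isBundleLike (hψ : ∀ k, ψ k ∈ Ψ)
    (hΨ : ∀ ρ ∈ Ψ, ContMDiffOn 𝓘(ℝ, EuclideanSpace ℝ (Fin n))
      𝓘(ℝ, EuclideanSpace ℝ (Fin n)) ∞ ρ ρ.source)
    (hg : ∀ ρ ∈ Ψ, ∀ p ∈ ρ.source, ∀ v w : TangentSpace 𝓘(ℝ, EuclideanSpace ℝ (Fin n)) p,
      g.inner (ρ p)
        (mfderiv 𝓘(ℝ, EuclideanSpace ℝ (Fin n)) 𝓘(ℝ, EuclideanSpace ℝ (Fin n)) ρ p v)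
        (mfderiv 𝓘(ℝ, EuclideanSpace ℝ (Fin n)) 𝓘(ℝ, EuclideanSpace ℝ (Fin n)) ρ p w) =
      g.inner p v w) :
    (realizationFoliation Ψ hψ hΨ).IsBundleLike (realizationMetric Ψ g hψ hΨ hg) := by
  intro U hU X Y hX hY hX' hY'
  -- the expression of `g (X, Y)` in the preferred chart at a point
  let G : Realization ψ → EuclideanSpace ℝ (Fin n) × ℝ × ℝ → ℝ := fun m₀ z =>
    metricCoord g ((chartAt (EuclideanSpace ℝ (Fin n)) (repr m₀).1.1).symm z.1)
      (coordField X m₀ z).1 (coordField Y m₀ z).1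
  have hG : ∀ m₀ ∈ U, ∀ m ∈ U, m ∈ (chartAt (RealizationModel n) m₀).source →
      (realizationMetric Ψ g hψ hΨ hg).inner m (X m) (Y m) =
        G m₀ (extChartAt (realizationModelWithCorners n) m₀ m) := by
    intro m₀ _ m hm hm'
    have h0 : (extChartAt (realizationModelWithCorners n) m₀).symm
        (extChartAt (realizationModelWithCorners n) m₀ m) = m :=
      (extChartAt (realizationModelWithCorners n) m₀).left_inv (by rwa [extChartAt_source])
    have h1 := chartForm_tangentCoordChange Ψ g hψ hΨ hg hm' (X m) (Y m)
    have h2 := (tangentCoordChange_realization_snd Ψ hψ hΨ hm' (X m)).trans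
      (snd_eq_zero_of_perpendicular Ψ g hψ hΨ hg (hX' m hm))
    refine h1.symm.trans ?_
    rw [chartForm, prodForm_apply, h2, map_zero, zero_apply, add_zero]
    simp only [G, coordField]
    rw [h0]
  have hloc : ∀ m₀ ∈ U, writtenInExtChartAt (realizationModelWithCorners n) 𝓘(ℝ, ℝ) m₀
      (fun m => (realizationMetric Ψ g hψ hΨ hg).inner m (X m) (Y m))
      =ᶠ[𝓝 (extChartAt (realizationModelWithCorners n) m₀ m₀)] G m₀ := by
    intro m₀ hm₀
    have h3 := continuousAt_extChartAt_symm (I := realizationModelWithCorners n) m₀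
    rw [ContinuousAt, extChartAt_to_inv] at h3
    filter_upwards [eventually_mem_source_symm m₀, h3.eventually (hU.mem_nhds hm₀),
      extChartAt_target_mem_nhds (I := realizationModelWithCorners n) m₀] with z h4 h5 h6
    refine (hG m₀ hm₀ _ h5 h4).trans ?_
    rw [(extChartAt (realizationModelWithCorners n) m₀).right_inv h6]
  have hb : ∀ m₀ : Realization ψ, ContDiffAt ℝ ∞
      (fun x => metricCoord g ((chartAt (EuclideanSpace ℝ (Fin n)) (repr m₀).1.1).symm x))
      (extChartAt (realizationModelWithCorners n) m₀ m₀).1 := fun m₀ => by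
    have h : extChartAt (realizationModelWithCorners n) m₀ m₀ = domainCoord (repr m₀) :=
      chartAt_realization_self m₀
    rw [h]
    exact contDiffAt_metricCoord_symm g (repr m₀).1.1
  have hcX : ∀ m₀ ∈ U, ContDiffAt ℝ ∞ (coordField X m₀)
      (extChartAt (realizationModelWithCorners n) m₀ m₀) := fun m₀ hm₀ =>
    contDiffAt_coordField ((hX.1 m₀ hm₀).contMDiffAt (hU.mem_nhds hm₀))
  have hcY : ∀ m₀ ∈ U, ContDiffAt ℝ ∞ (coordField Y m₀)
      (extChartAt (realizationModelWithCorners n) m₀ m₀) := fun m₀ hm₀ =>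
    contDiffAt_coordField ((hY.1 m₀ hm₀).contMDiffAt (hU.mem_nhds hm₀))
  have hGs : ∀ m₀ ∈ U, ContDiffAt ℝ ∞ (G m₀)
      (extChartAt (realizationModelWithCorners n) m₀ m₀) := fun m₀ hm₀ =>
    (((hb m₀).comp _ contDiffAt_fst).clm_apply (hcX m₀ hm₀).fst).clm_apply (hcY m₀ hm₀).fst
  have hcont : ∀ m₀ ∈ U, ContinuousAt
      (fun m => (realizationMetric Ψ g hψ hΨ hg).inner m (X m) (Y m)) m₀ := fun m₀ hm₀ => by
    refine ((hGs m₀ hm₀).continuousAt.comp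
      (continuousAt_extChartAt (I := realizationModelWithCorners n) m₀)).congr ?_
    filter_upwards [hU.mem_nhds hm₀, (chartAt (RealizationModel n) m₀).open_source.mem_nhds
      (mem_chart_source _ m₀)] with m hm hm'
    exact (hG m₀ hm₀ m hm hm').symm
  refine ⟨fun m₀ hm₀ => (contMDiffAt_of_eventuallyEq (hcont m₀ hm₀) (hloc m₀ hm₀)
    (hGs m₀ hm₀)).contMDiffWithinAt, ?_⟩
  intro Z hZ m₀ hm₀
  have hz := (mem_realizationFoliation_tangent_iff Ψ hψ hΨ).1 (hZ.2 m₀ hm₀)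
  have hdX := (hcX m₀ hm₀).differentiableAt (by simp)
  have hdY := (hcY m₀ hm₀).differentiableAt (by simp)
  have hdb := (hb m₀).differentiableAt (by simp)
  obtain ⟨L, hL, hL0⟩ := exists_hasFDerivAt_pairing
    (hdb.comp (extChartAt (realizationModelWithCorners n) m₀ m₀) differentiableAt_fst)
    hdX.fst hdY.fst
  rw [(hasMFDerivAt_of_eventuallyEq (hcont m₀ hm₀) (hloc m₀ hm₀) hL).mfderiv]
  generalize Z m₀ = z at hz
  obtain ⟨u, w⟩ : EuclideanSpace ℝ (Fin n) × ℝ × ℝ := z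
  obtain rfl : u = 0 := hz
  -- By the product rule it is enough that the metric coefficients and both horizontal components
  -- have zero derivative along `(0, w)`.
  refine hL0 _ ?_ ?_ ?_
  · rw [fderiv_comp _ hdb differentiableAt_fst, fderiv_fst]
    exact map_zero (fderiv ℝ (fun x => metricCoord g
      ((chartAt (EuclideanSpace ℝ (Fin n)) (repr m₀).1.1).symm x)) _)
  · rw [fderiv.fst hdX]
    exact fderiv_coordField_of_isFoliateOn Ψ hψ hΨ hX hm₀ w
  · rw [fderiv.fst hdY]
    exact fderiv_coordField_of_isFoliateOn Ψ hψ hΨ hY hm₀ w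

end BundleLike

end Quasifold

end

/-! ### The main theorem -/

theorem corollary6p3 {n : ℕ} {X : Type*} [DiffeologicalSpace X] (hX : IsQuasifold n X)
    {ι : Type*} [Countable ι] (A : ι → QuasifoldChart n X) (hA : ∀ x : X, ∃ i, x ∈ (A i).U)
    (g : Bundle.ContMDiffRiemannianMetric 𝓘(ℝ, EuclideanSpace ℝ (Fin n)) ∞
      (EuclideanSpace ℝ (Fin n))
      (fun p : ChartUnion A => TangentSpace 𝓘(ℝ, EuclideanSpace ℝ (Fin n)) p))
    (hΓ : ∀ i, ∀ γ (hγ : γ ∈ (A i).Γ), ∀ (x : (A i).V) (v w : EuclideanSpace ℝ (Fin n)),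
      g.inner ⟨i, ⟨γ x, (A i).invariant γ hγ x x.2⟩⟩ (γ.linear v) (γ.linear w) =
        g.inner ⟨i, x⟩ v w)
    (hΨ : ∀ ψ ∈ structuralPseudogroup A, ∀ p ∈ ψ.source,
      ∀ v w : TangentSpace 𝓘(ℝ, EuclideanSpace ℝ (Fin n)) p,
        g.inner (ψ p)
          (mfderiv 𝓘(ℝ, EuclideanSpace ℝ (Fin n)) 𝓘(ℝ, EuclideanSpace ℝ (Fin n)) ψ p v)
          (mfderiv 𝓘(ℝ, EuclideanSpace ℝ (Fin n)) 𝓘(ℝ, EuclideanSpace ℝ (Fin n)) ψ p w) =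
        g.inner p v w) :
    (∃ ψ : ℕ → OpenPartialHomeomorph (ChartUnion A) (ChartUnion A),
      PseudogroupGeneratedBy (structuralPseudogroup A) ψ) ∧
    ∀ ψ : ℕ → OpenPartialHomeomorph (ChartUnion A) (ChartUnion A),
      PseudogroupGeneratedBy (structuralPseudogroup A) ψ →
      -- the quotient is a manifold such that the quotient map is a smooth submersion
      ∃ (_ : ChartedSpace (RealizationModel n) (Realization ψ))
        (_ : IsManifold (realizationModelWithCorners n) ∞ (Realization ψ)),
        T2Space (Realization ψ) ∧ SecondCountableTopology (Realization ψ) ∧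
        ContMDiff (realizationModelWithCorners n) (realizationModelWithCorners n) ∞
          (Realization.mk (ψ := ψ)) ∧
        (∀ v : realizationDomain ψ, Function.Surjective
          (mfderiv (realizationModelWithCorners n) (realizationModelWithCorners n)
            (Realization.mk (ψ := ψ)) v)) ∧
        ∃ 𝓕 : Foliation (realizationModelWithCorners n) (Realization ψ) 2 n,
          -- the foliation is induced by the fibres of the first projection
          (∀ v : realizationDomain ψ, 𝓕.tangent (Realization.mk v) =
            (LinearMap.ker (mfderiv (realizationModelWithCorners n)
              𝓘(ℝ, EuclideanSpace ℝ (Fin n))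
              (fun w : realizationDomain ψ => w.1.1) v).toLinearMap).map
            (mfderiv (realizationModelWithCorners n) (realizationModelWithCorners n)
              (Realization.mk (ψ := ψ)) v).toLinearMap) ∧
          -- its leaf space is diffeomorphic to the quasifold
          (∃ Φ : 𝓕.LeafSpace ≃ X, DSmooth Φ ∧ DSmooth Φ.symm ∧
            ∀ v : realizationDomain ψ,
              Φ (𝓕.leaf (Realization.mk v)) = chartProjection A v.1.1) ∧
          -- the foliation is Riemannian
          𝓕.IsRiemannian := by
  refine ⟨exists_pseudogroupGeneratedBy, fun ψ hgen => ?_⟩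
  have hM := isManifold_realization (structuralPseudogroup A) hgen.mem
    contMDiffOn_of_mem_structuralPseudogroup
  exact ⟨inferInstance, hM, inferInstance, inferInstance,
    contMDiff_mk (structuralPseudogroup A) hgen.mem contMDiffOn_of_mem_structuralPseudogroup,
    mfderiv_mk_surjective (structuralPseudogroup A) hgen.mem
      contMDiffOn_of_mem_structuralPseudogroup,
    realizationFoliation (structuralPseudogroup A) hgen.mem
      contMDiffOn_of_mem_structuralPseudogroup,
    realizationFoliation_tangent_mk (structuralPseudogroup A) hgen.mem
      contMDiffOn_of_mem_structuralPseudogroup,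
    exists_leafSpace_equiv hA hgen,
    _, realizationFoliation_isBundleLike (structuralPseudogroup A) g hgen.mem
      contMDiffOn_of_mem_structuralPseudogroup hΨ⟩
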